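/- Let $F_0$ be a finite extension of $\mathbb{Q}_2$ with ring of integers $\mathcal{O}_{F_0}$, and let $F/F_0$ be a quadratic extension with ring of integers $\mathcal{O}_F$ and nontrivial automorphism $x\mapsto\overline{x}$. Let $\pi\in F$ and $\pi_0\in F_0$ be uniformizers and $t\in\mathcal{O}_{F_0}$ with $$\pi^2-t\pi+\pi_0=0,$$ where either (R-U) $\pi_0\mid t\mid 2$, or (R-P) $t=0$ (so $F/F_0$ is ramified). Put $\varepsilon=t$ and $\lambda=\overline{\pi}/t$ in case (R-U), and $\varepsilon=2$ and $\lambda=1/2$ in case (R-P). Let $m\ge 1$, $n=2m+1$, and let $V$ be an $F$-vector space with a hermitian form $h:V\times V\to F$ and a basis $e_1,\dots,e_n$ such that $h(e_i,e_j)=\delta_{i,n+1-j}$. For $0\le i\le m$ let $$\Lambda_i=\mathcal{O}_F\langle \pi^{-1}e_1,\dots,\pi^{-1}e_i,e_{i+1},\dots,e_{m+1},\lambda e_{m+2},\dots,\lambda e_n\rangle\subset V.$$ Let $\mathscr{L}=\varepsilon^{-1}\mathcal{O}_{F_0}$, $s(x,y)=\varepsilon^{-1}\operatorname{Tr}_{F/F_0}h(x,y)$,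 $q(x)=\tfrac12 s(x,x)$ and $\phi(x,y)=\varepsilon^{-1}\operatorname{Tr}_{F/F_0}h(x,\pi^{-1}y)$. Then $q$ restricts to an $\mathscr{L}$-valued quadratic form on each $\Lambda_i$, and $\phi$ restricts to an $\mathscr{L}$-valued $\mathcal{O}_{F_0}$-bilinear form on $\Lambda_0$. For an $\mathcal{O}_{F_0}$-algebra $R$, let $\underline{\mathrm{Sim}}(\Lambda_m)(R)$ be the group of pairs $(\varphi,\gamma)$, where $\varphi$ is an automorphism of the $\mathcal{O}_F\otimes_{\mathcal{O}_{F_0}}R$-module $\Lambda_m\otimes_{\mathcal{O}_{F_0}}R$ and $\gamma$ is an automorphism of the $R$-module $\mathscr{L}\otimes_{\mathcal{O}_{F_0}}R$, such that $q_R(\varphi(x))=\gamma(q_R(x))$ for all $x$, with $q_R$ the base change of $q$. Let $\underline{\mathrm{Sim}}(\Lambda_0,\phi)(R)$ be the group of pairs $(\varphi,\gamma)$ defined in the same way with $\Lambda_0$ in place of $\Lambda_m$, which satisfy in addition $\phi_R(\varphi(x),\varphi(y))=\gamma(\phi_R(x,y))$ for all $x,y$. For an $F_0$-algebra $R$, let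 $\mathrm{GU}(V,h)(R)$ be the group of automorphisms $\varphi$ of the $F\otimes_{F_0}R$-module $V\otimes_{F_0}R$ for which there is $c\in R^\times$ with $h_R(\varphi(x),\varphi(y))=c\,h_R(x,y)$ for all $x,y$. Then the group functor $\underline{\mathrm{Sim}}(\Lambda_m)$ on $\mathcal{O}_{F_0}$-algebras is represented by an affine smooth group scheme over $\mathcal{O}_{F_0}$ whose generic fiber is $\mathrm{GU}(V,h)$. Likewise, the group functor $\underline{\mathrm{Sim}}(\Lambda_0,\phi)$ is represented by an affine smooth group scheme over $\mathcal{O}_{F_0}$ whose generic fiber is $\mathrm{GU}(V,h)$. In both cases the identification of the generic fiber is the natural one: for every $F_0$-algebra $R$ it sends $(\varphi,\gamma)$ to the automorphism of $V\otimes_{F_0}R$ that corresponds to $\varphi$ under $\Lambda_i\otimes_{\mathcal{O}_{F_0}}R= V\otimes_{F_0}R$ (with $i=m$, resp. $i=0$). -/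

import Mathlib

open CategoryTheory TensorProduct AlgebraicGeometry Opposite
universe u
set_option linter.unusedSectionVars false

namespace UnitarySimilitude

section BaseChange
variable {A : Type*} [CommRing A] {M N : Type*} [AddCommGroup M] [Module A M]
  [AddCommGroup N] [Module A N]

theorem exists_quadraticMap_baseChange_aux (R : Type*) [CommRing R] [Algebra A R]
    (q : QuadraticMap A M N) {P : Type*} [AddCommGroup P] [Module A P] (p : P →ₗ[A] M)
    (hp : Function.Surjective p) (B : LinearMap.BilinMap A P N)
    (hBp : ∀ x, B x x = q (p x)) :
    ∃ Q : QuadraticMap R (R ⊗[A] M) (R ⊗[A] N), ∀ x, Q (1 ⊗ₜ[A] x) = 1 ⊗ₜ[A] q x := by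
  obtain ⟨B', hB'⟩ : ∃ B' : LinearMap.BilinMap R (R ⊗[A] P) (R ⊗[A] N),
      ∀ r x s y, B' (r ⊗ₜ x) (s ⊗ₜ y) = (r * s) ⊗ₜ B x y :=
    ⟨LinearMap.BilinMap.baseChange R B, fun _ _ _ _ => rfl⟩
  have hBpol (x y : P) : B x y + B y x = QuadraticMap.polar q (p x) (p y) := by
    have h1 := hBp (x + y)
    simp only [map_add, LinearMap.add_apply, hBp] at h1
    simp only [QuadraticMap.polar, ← h1]
    abel
  obtain ⟨pR, hpRt⟩ : ∃ pR : R ⊗[A] P →ₗ[R] R ⊗[A] M, pR = p.baseChange R := ⟨_, rfl⟩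
  have hpR : Function.Surjective pR := by
    rw [hpRt]; exact LinearMap.lTensor_surjective R hp
  obtain ⟨C, hC⟩ : ∃ C : LinearMap.BilinMap R (R ⊗[A] M) (R ⊗[A] N),
      ∀ r x s y, C (r ⊗ₜ x) (s ⊗ₜ y) = (r * s) ⊗ₜ QuadraticMap.polar q x y :=
    ⟨LinearMap.BilinMap.baseChange R q.polarBilin, fun _ _ _ _ => rfl⟩
  have hpol (z w : R ⊗[A] P) : B' z w + B' w z = C (pR z) (pR w) := by
    induction z with
    | zero => simp
    | add a b ha hb => simp only [map_add, LinearMap.add_apply, ← ha, ← hb]; abel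
    | tmul r x =>
      induction w with
      | zero => simp
      | add a b ha hb => simp only [map_add, LinearMap.add_apply, ← ha, ← hb]; abel
      | tmul s y =>
        simp only [hB', hC, hpRt, LinearMap.baseChange_tmul, ← hBpol, TensorProduct.tmul_add,
          mul_comm s r]
  have hker (k : R ⊗[A] P) (hk : pR k = 0) : B' k k = 0 := by
    have hex := lTensor_exact R (LinearMap.exact_subtype_ker_map p) hp
    have hk0 : LinearMap.lTensor R p k = 0 := by rw [hpRt] at hk; exact hk
    obtain ⟨k', rfl⟩ := (hex k).1 hk0
    clear hk hk0
    have key (a : R ⊗[A] LinearMap.ker p) :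
        pR (LinearMap.lTensor R (LinearMap.ker p).subtype a) = 0 := by
      rw [hpRt]; exact (hex _).2 ⟨a, rfl⟩
    induction k' with
    | zero => simp
    | tmul r x =>
      rw [LinearMap.lTensor_tmul, hB', hBp, Submodule.subtype_apply, LinearMap.mem_ker.1 x.2,
        QuadraticMap.map_zero, TensorProduct.tmul_zero]
    | add a b ha hb =>
      have := hpol (LinearMap.lTensor R (LinearMap.ker p).subtype a)
        (LinearMap.lTensor R (LinearMap.ker p).subtype b)
      rw [key a, map_zero, LinearMap.zero_apply] at this
      simp only [map_add, LinearMap.add_apply, ha, hb, zero_add, add_zero]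
      rw [add_comm] at this
      exact this
  have hwd (z w : R ⊗[A] P) (hzw : pR z = pR w) : B' z z = B' w w := by
    have h0 : pR (z - w) = 0 := by rw [map_sub, hzw, sub_self]
    have h1 := hker _ h0
    have h2 := hpol (z - w) w
    rw [h0, map_zero, LinearMap.zero_apply] at h2
    have h3 : B' z z = B' (z - w) (z - w) + (B' (z - w) w + B' w (z - w)) + B' w w := by
      simp only [map_sub, LinearMap.sub_apply]; abel
    rw [h3, h1, h2]; simp
  obtain ⟨sec, hsec⟩ : ∃ sec : R ⊗[A] M → R ⊗[A] P, ∀ y, pR (sec y) = y :=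
    hpR.hasRightInverse
  refine ⟨⟨fun y => B' (sec y) (sec y), ?_, C, ?_⟩, ?_⟩
  · intro a y
    rw [hwd (sec (a • y)) (a • sec y) (by rw [map_smul, hsec, hsec])]
    simp [mul_smul]
  · intro x y
    rw [hwd (sec (x + y)) (sec x + sec y) (by rw [map_add, hsec, hsec, hsec])]
    have := hpol (sec x) (sec y)
    rw [hsec, hsec] at this
    simp only [map_add, LinearMap.add_apply, ← this]
    abel
  · intro x
    obtain ⟨y, rfl⟩ := hp x
    change B' (sec _) (sec _) = _
    rw [hwd (sec (1 ⊗ₜ p y)) (1 ⊗ₜ y) (by rw [hsec]; simp [hpRt]), hB', hBp, mul_one]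

theorem exists_quadraticMap_baseChange (R : Type*) [CommRing R] [Algebra A R]
    (q : QuadraticMap A M N) :
    ∃ Q : QuadraticMap R (R ⊗[A] M) (R ⊗[A] N), ∀ x, Q (1 ⊗ₜ[A] x) = 1 ⊗ₜ[A] q x := by
  obtain ⟨B, hB⟩ := LinearMap.BilinMap.toQuadraticMap_surjective
    (q.comp (Finsupp.linearCombination A (id : M → M)))
  refine exists_quadraticMap_baseChange_aux R q _ (Finsupp.linearCombination_id_surjective A M) B
    fun x => ?_
  exact congrArg (fun Q => Q x) hB

/-- The base change of a quadratic map along `A → R`: the unique quadratic map over `R` with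
`1 ⊗ x ↦ 1 ⊗ q x`. No division by `2` is involved. -/
noncomputable def quadBaseChange (R : Type*) [CommRing R] [Algebra A R]
    (q : QuadraticMap A M N) : QuadraticMap R (R ⊗[A] M) (R ⊗[A] N) :=
  (exists_quadraticMap_baseChange R q).choose

theorem quadBaseChange_one_tmul (R : Type*) [CommRing R] [Algebra A R]
    (q : QuadraticMap A M N) (x : M) :
    quadBaseChange R q (1 ⊗ₜ[A] x) = 1 ⊗ₜ[A] q x :=
  (exists_quadraticMap_baseChange R q).choose_spec x

theorem polarBilin_quadBaseChange (R : Type*) [CommRing R] [Algebra A R]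
    (q : QuadraticMap A M N) :
    (quadBaseChange R q).polarBilin = LinearMap.BilinMap.baseChange R q.polarBilin := by
  ext x y
  simp [QuadraticMap.polar, ← TensorProduct.tmul_add, quadBaseChange_one_tmul,
    TensorProduct.tmul_sub]

end BaseChange

section Functors

variable {A : Type*} [CommRing A]

/-- The map `R ⊗ M → S ⊗ M` induced by a morphism of `A`-algebras `R → S`. -/
noncomputable abbrev changeRing {R S : Type*} [CommRing R] [CommRing S] [Algebra A R] [Algebra A S]
    (f : R →ₐ[A] S) (M : Type*) [AddCommGroup M] [Module A M] : R ⊗[A] M →ₗ[A] S ⊗[A] M :=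
  f.toLinearMap.rTensor M

section
variable {R S T : Type*} [CommRing R] [CommRing S] [CommRing T] [Algebra A R] [Algebra A S]
  [Algebra A T] {M L : Type*} [AddCommGroup M] [Module A M] [AddCommGroup L] [Module A L]

theorem changeRing_smul (f : R →ₐ[A] S) (r : R) (x : R ⊗[A] M) :
    changeRing f M (r • x) = f r • changeRing f M x := by
  induction x with
  | zero => simp
  | tmul s m => simp [TensorProduct.smul_tmul']
  | add x y hx hy => simp only [smul_add, map_add, hx, hy]

/-- Base change of an `R`-linear map `R ⊗ M → R ⊗ L` along `f : R → S`: the unique `S`-linear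
map compatible with the maps `R ⊗ - → S ⊗ -`. -/
noncomputable def pushHom (f : R →ₐ[A] S) (g : R ⊗[A] M →ₗ[R] R ⊗[A] L) :
    S ⊗[A] M →ₗ[S] S ⊗[A] L :=
  LinearMap.liftBaseChange S
    (changeRing f L ∘ₗ g.restrictScalars A ∘ₗ TensorProduct.mk A R M 1)

theorem pushHom_one_tmul (f : R →ₐ[A] S) (g : R ⊗[A] M →ₗ[R] R ⊗[A] L) (m : M) :
    pushHom f g (1 ⊗ₜ m) = changeRing f L (g (1 ⊗ₜ m)) := by
  simp [pushHom]

theorem pushHom_changeRing (f : R →ₐ[A] S) (g : R ⊗[A] M →ₗ[R] R ⊗[A] L) (x : R ⊗[A] M) :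
    pushHom f g (changeRing f M x) = changeRing f L (g x) := by
  induction x with
  | zero => simp
  | add x y hx hy => simp only [map_add, hx, hy]
  | tmul r m =>
    have h : r ⊗ₜ[A] m = r • ((1 : R) ⊗ₜ[A] m) := by simp [TensorProduct.smul_tmul']
    rw [h, changeRing_smul, map_smul, map_smul, changeRing_smul]
    congr 1
    simpa using pushHom_one_tmul f g m

theorem hom_ext_one_tmul {Y : Type*} [AddCommGroup Y] [Module A Y] [Module S Y]
    [IsScalarTower A S Y] {g g' : S ⊗[A] M →ₗ[S] Y}
    (h : ∀ m, g (1 ⊗ₜ m) = g' (1 ⊗ₜ m)) : g = g' := by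
  ext m; simpa using h m

/-- Base change of endomorphisms as a morphism of monoids. -/
noncomputable def pushEnd (f : R →ₐ[A] S) (M : Type*) [AddCommGroup M] [Module A M] :
    Module.End R (R ⊗[A] M) →* Module.End S (S ⊗[A] M) where
  toFun g := pushHom f g
  map_one' := hom_ext_one_tmul fun m => by simp [pushHom_one_tmul]
  map_mul' g g' := hom_ext_one_tmul fun m => by
    simp only [pushHom_one_tmul, Module.End.mul_apply, pushHom_changeRing]

/-- Base change of automorphisms. -/
noncomputable def pushGL (f : R →ₐ[A] S) (M : Type*) [AddCommGroup M] [Module A M] :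
    LinearMap.GeneralLinearGroup R (R ⊗[A] M) →* LinearMap.GeneralLinearGroup S (S ⊗[A] M) :=
  Units.map (pushEnd f M)

theorem pushGL_val (f : R →ₐ[A] S) (g : LinearMap.GeneralLinearGroup R (R ⊗[A] M)) :
    (pushGL f M g).val = pushHom f g.val := rfl

theorem pushGL_id (g : LinearMap.GeneralLinearGroup R (R ⊗[A] M)) :
    pushGL (AlgHom.id A R) M g = g := by
  refine Units.ext (hom_ext_one_tmul fun m => ?_)
  rw [pushGL_val, pushHom_one_tmul]
  simp [changeRing]

theorem pushGL_comp (f : R →ₐ[A] S) (f' : S →ₐ[A] T)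
    (g : LinearMap.GeneralLinearGroup R (R ⊗[A] M)) :
    pushGL (f'.comp f) M g = pushGL f' M (pushGL f M g) := by
  refine Units.ext (hom_ext_one_tmul fun m => ?_)
  simp only [pushGL_val, pushHom_one_tmul]
  simp [changeRing, LinearMap.rTensor_comp]

theorem bilin_changeRing {M' : Type*} [AddCommGroup M'] [Module A M']
    (B : LinearMap.BilinMap A M L) (f : R →ₐ[A] S) (x y : R ⊗[A] M) :
    LinearMap.BilinMap.baseChange S B (changeRing f M x) (changeRing f M y) =
      changeRing f L (LinearMap.BilinMap.baseChange R B x y) := by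
  induction x with
  | zero => simp
  | add x x' hx hx' => simp only [map_add, LinearMap.add_apply, hx, hx']
  | tmul r m =>
    induction y with
    | zero => simp
    | add y y' hy hy' => simp only [map_add, hy, hy']
    | tmul s n => simp

theorem quad_changeRing (q : QuadraticMap A M L) (f : R →ₐ[A] S) (x : R ⊗[A] M) :
    quadBaseChange S q (changeRing f M x) = changeRing f L (quadBaseChange R q x) := by
  induction x with
  | zero => simp
  | tmul r m =>
    have h : r ⊗ₜ[A] m = r • ((1 : R) ⊗ₜ[A] m) := by simp [TensorProduct.smul_tmul']
    rw [h, changeRing_smul, QuadraticMap.map_smul, QuadraticMap.map_smul, changeRing_smul,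
      quadBaseChange_one_tmul]
    simp [quadBaseChange_one_tmul]
  | add x y hx hy =>
    have hS := LinearMap.congr_fun₂ (polarBilin_quadBaseChange S q) (changeRing f M x)
      (changeRing f M y)
    have hR := LinearMap.congr_fun₂ (polarBilin_quadBaseChange R q) x y
    rw [bilin_changeRing (M' := M), ← hR] at hS
    simp only [QuadraticMap.polarBilin_apply_apply, QuadraticMap.polar, map_sub, hx, hy,
      sub_left_inj] at hS
    rw [map_add, hS]

end

section Groups

variable {B : Type*} [CommRing B] [Algebra A B]
variable {M L : Type*} [AddCommGroup M] [Module A M] [Module B M] [IsScalarTower A B M]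
  [AddCommGroup L] [Module A L]

/-- The action of `b ∈ B` on `R ⊗[A] M`, for a `B`-module `M`. -/
noncomputable def scalarAction (A : Type*) [CommRing A] {B : Type*} [CommRing B] [Algebra A B]
    (R : Type*) [CommRing R] [Algebra A R]
    (M : Type*) [AddCommGroup M] [Module A M] [Module B M] [IsScalarTower A B M] (b : B) :
    R ⊗[A] M →ₗ[R] R ⊗[A] M :=
  (Algebra.lsmul A A M b).baseChange R

/-- `GL_{B ⊗ R}(M ⊗ R)`: the `R`-linear automorphisms of `R ⊗[A] M` which commute with the action
of `B`, i.e. the automorphisms of the `B ⊗[A] R`-module `M ⊗[A] R`. -/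
noncomputable def linearGroup (A : Type*) [CommRing A] (B : Type*) [CommRing B] [Algebra A B]
    (M : Type*) [AddCommGroup M] [Module A M] [Module B M] [IsScalarTower A B M]
    (R : Type*) [CommRing R] [Algebra A R] :
    Subgroup (LinearMap.GeneralLinearGroup R (R ⊗[A] M)) where
  carrier := {g | ∀ (b : B) (x : R ⊗[A] M),
    g.val (scalarAction A R M b x) = scalarAction A R M b (g.val x)}
  one_mem' := fun _ _ => rfl
  mul_mem' := fun {g g'} hg hg' b x => by
    simp only [Units.val_mul, Module.End.mul_apply, hg' b, hg b]
  inv_mem' := fun {g} hg b x => by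
    have hinv (y) : g.val (g⁻¹.val y) = y := by
      rw [← Module.End.mul_apply, Units.mul_inv]; rfl
    have hinv' (y) : g⁻¹.val (g.val y) = y := by
      rw [← Module.End.mul_apply, Units.inv_mul]; rfl
    have := hg b (g⁻¹.val x)
    rw [hinv] at this
    rw [← this, hinv']

theorem gl_inv_apply {R X : Type*} [CommRing R] [AddCommGroup X] [Module R X]
    (g : LinearMap.GeneralLinearGroup R X) (y : X) : g⁻¹.val (g.val y) = y := by
  rw [← Module.End.mul_apply, Units.inv_mul]; rfl

theorem gl_apply_inv {R X : Type*} [CommRing R] [AddCommGroup X] [Module R X]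
    (g : LinearMap.GeneralLinearGroup R X) (y : X) : g.val (g⁻¹.val y) = y := by
  rw [← Module.End.mul_apply, Units.mul_inv]; rfl

/-- The group of similitudes `(φ, γ)` of `(M, q, L) ⊗ R`: `φ` is an automorphism of the
`B ⊗ R`-module `M ⊗ R`, `γ` is an automorphism of the `R`-module `L ⊗ R`, and
`q (φ x) = γ (q x)`. -/
noncomputable def simGroup (B : Type*) [CommRing B] [Algebra A B]
    [Module B M] [IsScalarTower A B M] (q : QuadraticMap A M L)
    (R : Type*) [CommRing R] [Algebra A R] :
    Subgroup (LinearMap.GeneralLinearGroup R (R ⊗[A] M) ×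
      LinearMap.GeneralLinearGroup R (R ⊗[A] L)) where
  carrier := {g | g.1 ∈ linearGroup A B M R ∧
    ∀ x : R ⊗[A] M, quadBaseChange R q (g.1.val x) = g.2.val (quadBaseChange R q x)}
  one_mem' := ⟨one_mem _, fun _ => rfl⟩
  mul_mem' := fun {g g'} hg hg' => ⟨mul_mem hg.1 hg'.1, fun x => by
    simp only [Prod.fst_mul, Prod.snd_mul, Units.val_mul, Module.End.mul_apply, hg.2, hg'.2]⟩
  inv_mem' := fun {g} hg => ⟨inv_mem hg.1, fun x => by
    have := hg.2 (g.1⁻¹.val x)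
    rw [gl_apply_inv] at this
    rw [Prod.fst_inv, Prod.snd_inv, this, gl_inv_apply]⟩

/-- The group of similitudes `(φ, γ)` of `(M, q, L) ⊗ R` which preserve the bilinear form `b`,
i.e. satisfy `b (φ x, φ y) = γ (b (x, y))`. -/
noncomputable def simGroupPreserving (B : Type*) [CommRing B] [Algebra A B]
    [Module B M] [IsScalarTower A B M] (q : QuadraticMap A M L) (b : LinearMap.BilinMap A M L)
    (R : Type*) [CommRing R] [Algebra A R] :
    Subgroup (LinearMap.GeneralLinearGroup R (R ⊗[A] M) ×
      LinearMap.GeneralLinearGroup R (R ⊗[A] L)) where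
  carrier := {g | g ∈ simGroup B q R ∧ ∀ x y : R ⊗[A] M,
    LinearMap.BilinMap.baseChange R b (g.1.val x) (g.1.val y) =
      g.2.val (LinearMap.BilinMap.baseChange R b x y)}
  one_mem' := ⟨one_mem _, fun _ _ => rfl⟩
  mul_mem' := fun {g g'} hg hg' => ⟨mul_mem hg.1 hg'.1, fun x y => by
    simp only [Prod.fst_mul, Prod.snd_mul, Units.val_mul, Module.End.mul_apply, hg.2, hg'.2]⟩
  inv_mem' := fun {g} hg => ⟨inv_mem hg.1, fun x y => by
    have := hg.2 (g.1⁻¹.val x) (g.1⁻¹.val y)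
    rw [gl_apply_inv, gl_apply_inv] at this
    rw [Prod.fst_inv, Prod.snd_inv, this, gl_inv_apply]⟩

/-- The group `GU(M, h)(R)` for an `A`-bilinear form `h : M × M → B`: the automorphisms `φ` of the
`B ⊗ R`-module `M ⊗ R` for which there is `c ∈ Rˣ` with `h (φ x, φ y) = c h (x, y)`. -/
noncomputable def guGroup (h : LinearMap.BilinMap A M B) (R : Type*) [CommRing R] [Algebra A R] :
    Subgroup (LinearMap.GeneralLinearGroup R (R ⊗[A] M)) where
  carrier := {g | g ∈ linearGroup A B M R ∧ ∃ c : Rˣ, ∀ x y : R ⊗[A] M,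
    LinearMap.BilinMap.baseChange R h (g.val x) (g.val y) =
      (c : R) • LinearMap.BilinMap.baseChange R h x y}
  one_mem' := ⟨one_mem _, 1, fun _ _ => by simp⟩
  mul_mem' := fun {g g'} ⟨hg, c, hc⟩ ⟨hg', c', hc'⟩ => ⟨mul_mem hg hg', c * c', fun x y => by
    simp only [Units.val_mul, Module.End.mul_apply, hc, hc', mul_smul]⟩
  inv_mem' := fun {g} ⟨hg, c, hc⟩ => ⟨inv_mem hg, c⁻¹, fun x y => by
    have := hc (g⁻¹.val x) (g⁻¹.val y)
    rw [gl_apply_inv, gl_apply_inv] at this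
    rw [this, smul_smul, Units.inv_mul, one_smul]⟩

variable {R S : Type*} [CommRing R] [CommRing S] [Algebra A R] [Algebra A S]

theorem scalarAction_changeRing (f : R →ₐ[A] S) (b : B) (x : R ⊗[A] M) :
    scalarAction A S M b (changeRing f M x) = changeRing f M (scalarAction A R M b x) := by
  induction x with
  | zero => simp
  | add x y hx hy => simp only [map_add, hx, hy]
  | tmul r m => simp [scalarAction]

theorem pushGL_mem_linearGroup (f : R →ₐ[A] S) {g : LinearMap.GeneralLinearGroup R (R ⊗[A] M)}
    (hg : g ∈ linearGroup A B M R) : pushGL f M g ∈ linearGroup A B M S := by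
  intro b
  refine LinearMap.congr_fun (f := (pushGL f M g).val ∘ₗ scalarAction A S M b)
    (g := scalarAction A S M b ∘ₗ (pushGL f M g).val) (hom_ext_one_tmul fun m => ?_)
  have h1 : (1 : S) ⊗ₜ[A] m = changeRing f M (1 ⊗ₜ m) := by simp
  simp only [LinearMap.comp_apply, pushGL_val]
  rw [h1, scalarAction_changeRing, pushHom_changeRing, pushHom_changeRing, hg b,
    scalarAction_changeRing]

theorem bilin_ext_one_tmul {Y : Type*} [AddCommGroup Y] [Module A Y] [Module S Y]
    [IsScalarTower A S Y] {g g' : LinearMap.BilinMap S (S ⊗[A] M) Y}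
    (h : ∀ m n, g (1 ⊗ₜ m) (1 ⊗ₜ n) = g' (1 ⊗ₜ m) (1 ⊗ₜ n)) : g = g' := by
  ext m n; simpa using h m n

theorem push_mem_simGroup {q : QuadraticMap A M L} (f : R →ₐ[A] S)
    {g : LinearMap.GeneralLinearGroup R (R ⊗[A] M) × LinearMap.GeneralLinearGroup R (R ⊗[A] L)}
    (hg : g ∈ simGroup B q R) : (pushGL f M g.1, pushGL f L g.2) ∈ simGroup B q S := by
  refine ⟨pushGL_mem_linearGroup f hg.1, fun x => ?_⟩
  refine congrArg (fun Q => Q x) (baseChange_ext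
    (Q₁ := (quadBaseChange S q).comp (pushGL f M g.1).val)
    (Q₂ := (pushGL f L g.2).val.compQuadraticMap (quadBaseChange S q)) fun m => ?_)
  have h1 : (1 : S) ⊗ₜ[A] m = changeRing f M (1 ⊗ₜ m) := by simp
  simp only [QuadraticMap.comp_apply, LinearMap.compQuadraticMap_apply, pushGL_val]
  rw [h1, pushHom_changeRing, quad_changeRing, quad_changeRing, hg.2, pushHom_changeRing]

theorem push_mem_simGroupPreserving {q : QuadraticMap A M L} {b : LinearMap.BilinMap A M L}
    (f : R →ₐ[A] S)
    {g : LinearMap.GeneralLinearGroup R (R ⊗[A] M) × LinearMap.GeneralLinearGroup R (R ⊗[A] L)}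
    (hg : g ∈ simGroupPreserving B q b R) :
    (pushGL f M g.1, pushGL f L g.2) ∈ simGroupPreserving B q b S := by
  refine ⟨push_mem_simGroup f hg.1, fun x y => ?_⟩
  refine LinearMap.congr_fun₂ (bilin_ext_one_tmul
    (g := (LinearMap.BilinMap.baseChange S b).compl₁₂ (pushGL f M g.1).val (pushGL f M g.1).val)
    (g' := (LinearMap.BilinMap.baseChange S b).compr₂ (pushGL f L g.2).val) fun m n => ?_) x y
  have h1 (m : M) : (1 : S) ⊗ₜ[A] m = changeRing f M (1 ⊗ₜ m) := by simp
  simp only [LinearMap.compl₁₂_apply, LinearMap.compr₂_apply, pushGL_val]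
  rw [h1 m, h1 n, pushHom_changeRing, pushHom_changeRing, bilin_changeRing (M' := M),
    bilin_changeRing (M' := M), hg.2, pushHom_changeRing]

theorem pushGL_mem_guGroup {h : LinearMap.BilinMap A M B} (f : R →ₐ[A] S)
    {g : LinearMap.GeneralLinearGroup R (R ⊗[A] M)} (hg : g ∈ guGroup h R) :
    pushGL f M g ∈ guGroup h S := by
  obtain ⟨hg, c, hc⟩ := hg
  refine ⟨pushGL_mem_linearGroup f hg, Units.map f c, fun x y => ?_⟩
  refine LinearMap.congr_fun₂ (bilin_ext_one_tmul
    (g := (LinearMap.BilinMap.baseChange S h).compl₁₂ (pushGL f M g).val (pushGL f M g).val)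
    (g' := f c • LinearMap.BilinMap.baseChange S h) fun m n => ?_) x y
  have h1 (m : M) : (1 : S) ⊗ₜ[A] m = changeRing f M (1 ⊗ₜ m) := by simp
  simp only [LinearMap.compl₁₂_apply, LinearMap.smul_apply, pushGL_val]
  rw [h1 m, h1 n, pushHom_changeRing, pushHom_changeRing, bilin_changeRing (M' := M),
    bilin_changeRing (M' := M), hc, changeRing_smul]

end Groups

section

variable {A B M L : Type u} [CommRing A] [CommRing B] [Algebra A B]
  [AddCommGroup M] [Module A M] [Module B M] [IsScalarTower A B M] [AddCommGroup L] [Module A L]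

/-- The functor `Sim(M, q, L)` from `A`-algebras to groups, for a `B`-module `M` and a quadratic
map `q : M → L`. -/
noncomputable def simFunctor (B : Type u) [CommRing B] [Algebra A B]
    [Module B M] [IsScalarTower A B M] (q : QuadraticMap A M L) :
    CommAlgCat.{u} A ⥤ GrpCat.{u} where
  obj R := GrpCat.of (simGroup B q R)
  map {R S} f := GrpCat.ofHom
    ((((pushGL f.hom M).prodMap (pushGL f.hom L)).comp (simGroup B q R).subtype).codRestrict
      (simGroup B q S) fun g => push_mem_simGroup f.hom g.2)
  map_id R := by
    refine GrpCat.hom_ext (MonoidHom.ext fun g => ?_)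
    exact Subtype.ext (Prod.ext (pushGL_id g.1.1) (pushGL_id g.1.2))
  map_comp f f' := by
    refine GrpCat.hom_ext (MonoidHom.ext fun g => ?_)
    exact Subtype.ext (Prod.ext (pushGL_comp f.hom f'.hom g.1.1) (pushGL_comp f.hom f'.hom g.1.2))

/-- The functor `Sim(M, q, L, b)` of similitudes preserving the bilinear form `b`. -/
noncomputable def simPreservingFunctor (B : Type u) [CommRing B] [Algebra A B]
    [Module B M] [IsScalarTower A B M] (q : QuadraticMap A M L) (b : LinearMap.BilinMap A M L) :
    CommAlgCat.{u} A ⥤ GrpCat.{u} where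
  obj R := GrpCat.of (simGroupPreserving B q b R)
  map {R S} f := GrpCat.ofHom
    ((((pushGL f.hom M).prodMap (pushGL f.hom L)).comp
      (simGroupPreserving B q b R).subtype).codRestrict
      (simGroupPreserving B q b S) fun g => push_mem_simGroupPreserving f.hom g.2)
  map_id R := by
    refine GrpCat.hom_ext (MonoidHom.ext fun g => ?_)
    exact Subtype.ext (Prod.ext (pushGL_id g.1.1) (pushGL_id g.1.2))
  map_comp f f' := by
    refine GrpCat.hom_ext (MonoidHom.ext fun g => ?_)
    exact Subtype.ext (Prod.ext (pushGL_comp f.hom f'.hom g.1.1) (pushGL_comp f.hom f'.hom g.1.2))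

/-- The automorphism `φ` of a similitude `(φ, γ)`. -/
def simFunctorAction (q : QuadraticMap A M L) (R : CommAlgCat.{u} A)
    (g : (simFunctor B q).obj R) : LinearMap.GeneralLinearGroup R (R ⊗[A] M) :=
  (show simGroup B q R from g).1.1

/-- The automorphism `φ` of a similitude `(φ, γ)` preserving `b`. -/
def simPreservingFunctorAction (q : QuadraticMap A M L) (b : LinearMap.BilinMap A M L)
    (R : CommAlgCat.{u} A) (g : (simPreservingFunctor B q b).obj R) :
    LinearMap.GeneralLinearGroup R (R ⊗[A] M) :=
  (show simGroupPreserving B q b R from g).1.1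

/-- The functor `GU(M, h)` from `A`-algebras to groups. -/
noncomputable def guFunctor (h : LinearMap.BilinMap A M B) : CommAlgCat.{u} A ⥤ GrpCat.{u} where
  obj R := GrpCat.of (guGroup h R)
  map {R S} f := GrpCat.ofHom
    (((pushGL f.hom M).comp (guGroup h R).subtype).codRestrict
      (guGroup h S) fun g => pushGL_mem_guGroup f.hom g.2)
  map_id R := by
    refine GrpCat.hom_ext (MonoidHom.ext fun g => ?_)
    exact Subtype.ext (pushGL_id g.1)
  map_comp f f' := by
    refine GrpCat.hom_ext (MonoidHom.ext fun g => ?_)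
    exact Subtype.ext (pushGL_comp f.hom f'.hom g.1)

/-- The automorphism underlying an element of `GU(M, h)(R)`. -/
def guFunctorAction (h : LinearMap.BilinMap A M B) (R : CommAlgCat.{u} A)
    (g : (guFunctor h).obj R) : LinearMap.GeneralLinearGroup R (R ⊗[A] M) :=
  (show guGroup h R from g).1

end

end Functors

/-- The functor of points of a group scheme `G` over `Spec A`, on `A`-algebras:
`R ↦ Hom_{Spec A}(Spec R, G)` with its group structure. -/
noncomputable def pointsFunctor {A : CommRingCat.{u}} (G : Over (Spec A)) [GrpObj G] :
    CommAlgCat.{u} A ⥤ GrpCat.{u} :=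
  (algSpec A).rightOp ⋙ yonedaGrpObj G

/-- The base change of a scheme over `Spec A` along `A → K`; it is again a group scheme if `G`
is one. -/
noncomputable abbrev baseChangeScheme (A K : Type u) [CommRing A] [CommRing K] [Algebra A K]
    (G : Over (Spec (.of A))) : Over (Spec (.of K)) :=
  (Over.pullback (Spec.map (CommRingCat.ofHom (algebraMap A K)))).obj G

noncomputable instance baseChangeGrpObj (A K : Type u) [CommRing A] [CommRing K] [Algebra A K]
    (G : Over (Spec (.of A))) [GrpObj G] : GrpObj (baseChangeScheme A K G) :=
  Functor.grpObjObj

section Generic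

variable {A K : Type u} [CommRing A] [CommRing K] [Algebra A K]

/-- For a `K`-algebra `R`, the `R`-valued point of `G` over `A` given by an `R`-valued point of the
base change of `G` to `K`: the composite `Spec R → G ×_{Spec A} Spec K → G`. -/
noncomputable def restrictPoint {G : Over (Spec (.of A))} {R : Type u} [CommRing R] [Algebra A R]
    [Algebra K R] [IsScalarTower A K R]
    (p : (algSpec (.of K)).obj (op (.of K R)) ⟶ baseChangeScheme A K G) :
    (algSpec (.of A)).obj (op (.of A R)) ⟶ G :=
  Over.homMk (p.left ≫ Limits.pullback.fst _ _) (by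
    have hc := Limits.pullback.condition (f := G.hom)
      (g := Spec.map (CommRingCat.ofHom (algebraMap A K)))
    have h' : p.left ≫ Limits.pullback.snd G.hom (Spec.map (CommRingCat.ofHom (algebraMap A K))) =
      Spec.map (CommRingCat.ofHom (algebraMap K R)) := Over.w p
    have he : Spec.map (CommRingCat.ofHom (algebraMap K R)) ≫
        Spec.map (CommRingCat.ofHom (algebraMap A K)) =
          Spec.map (CommRingCat.ofHom (algebraMap A R)) := by
      rw [← Spec.map_comp, ← CommRingCat.ofHom_comp, ← IsScalarTower.algebraMap_eq]
    exact (Category.assoc _ _ _).trans ((congrArg (p.left ≫ ·) hc).trans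
      ((Category.assoc _ _ _).symm.trans ((congrArg (· ≫ _) h').trans he))))

variable {M V : Type u} [AddCommGroup M] [Module A M] [AddCommGroup V] [Module A V] [Module K V]
  [IsScalarTower A K V]

/-- The map `R ⊗[A] M → R ⊗[K] V` induced by `i : M → V`, for a `K`-algebra `R`. -/
noncomputable def compareMap (i : M →ₗ[A] V) (R : Type u) [CommRing R] [Algebra A R] [Algebra K R]
    [IsScalarTower A K R] : R ⊗[A] M →ₗ[R] R ⊗[K] V :=
  LinearMap.liftBaseChange R ((TensorProduct.mk K R V 1).restrictScalars A ∘ₗ i)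

/-- Suppose that `G` represents a functor `S` whose elements over `R` act on `M ⊗ R` (through `u`)
and that the generic fiber of `G` represents a functor `T` whose elements act on `V ⊗ R`
(through `v`), where `i : M → V`. The two identifications are compatible if for every `K`-algebra
`R`, every `R`-valued point of the generic fiber acts in the same way on `M ⊗ R` and on `V ⊗ R`
under `M ⊗ R → V ⊗ R`. -/
def GenericCompatible (i : M →ₗ[A] V) {S : CommAlgCat.{u} A ⥤ GrpCat.{u}}
    {T : CommAlgCat.{u} K ⥤ GrpCat.{u}}
    (u : ∀ R : CommAlgCat.{u} A, S.obj R → LinearMap.GeneralLinearGroup R (R ⊗[A] M))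
    (v : ∀ R : CommAlgCat.{u} K, T.obj R → LinearMap.GeneralLinearGroup R (R ⊗[K] V))
    {G : Over (Spec (.of A))} [GrpObj G] (α : pointsFunctor G ≅ S)
    (β : pointsFunctor (baseChangeScheme A K G) ≅ T) : Prop :=
  ∀ (R : Type u) [CommRing R] [Algebra A R] [Algebra K R] [IsScalarTower A K R]
    (p : (algSpec (.of K)).obj (op (.of K R)) ⟶ baseChangeScheme A K G) (x : R ⊗[A] M),
    (v (.of K R) (β.hom.app (.of K R) p)).val (compareMap i R x) =
      compareMap i R ((u (.of A R) (α.hom.app (.of A R) (restrictPoint p))).val x)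

end Generic

section Arithmetic

/-- The ring of integers of a finite extension `K` of `ℚ₂`: the integral closure in `K` of
`ℤ₂ = PadicInt.subring 2`. -/
noncomputable abbrev baseIntegers (K : Type*) [Field K] [Algebra ℚ_[2] K] :
    Subalgebra (PadicInt.subring 2) K :=
  integralClosure (PadicInt.subring 2) K

/-- The ring of integers of a finite extension `F` of `F₀`. -/
noncomputable abbrev extIntegers (F₀ F : Type*) [Field F₀] [Algebra ℚ_[2] F₀] [Field F]
    [Algebra F₀ F] : Subalgebra (baseIntegers F₀) F :=
  integralClosure (baseIntegers F₀) F

/-- `O_{F₀}` as a type (a synonym which keeps type class search short). -/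
def IntBase (K : Type*) [Field K] [Algebra ℚ_[2] K] : Type _ := ↥(baseIntegers K)

/-- `O_F` as a type. -/
def IntExt (F₀ F : Type*) [Field F₀] [Algebra ℚ_[2] F₀] [Field F] [Algebra F₀ F] : Type _ :=
  ↥(extIntegers F₀ F)

section
variable (F₀ F : Type*) [Field F₀] [Algebra ℚ_[2] F₀] [Field F] [Algebra F₀ F]
  (V : Type*) [AddCommGroup V]

noncomputable instance : CommRing (IntBase F₀) := inferInstanceAs (CommRing (baseIntegers F₀))

noncomputable instance : CommRing (IntExt F₀ F) := inferInstanceAs (CommRing (extIntegers F₀ F))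

noncomputable instance : Algebra (IntBase F₀) F₀ := RingHom.toAlgebra (baseIntegers F₀).val.toRingHom

noncomputable instance : Algebra (IntBase F₀) (IntExt F₀ F) :=
  inferInstanceAs (Algebra (baseIntegers F₀) (extIntegers F₀ F))

noncomputable instance : Algebra (IntExt F₀ F) F :=
  RingHom.toAlgebra (extIntegers F₀ F).val.toRingHom

noncomputable instance [Module F₀ V] : Module (IntBase F₀) V :=
  Module.compHom V (algebraMap (IntBase F₀) F₀)

noncomputable instance [Module F V] : Module (IntExt F₀ F) V :=
  Module.compHom V (algebraMap (IntExt F₀ F) F)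

instance [Module F₀ V] : IsScalarTower (IntBase F₀) F₀ V :=
  ⟨fun a x v => mul_smul (algebraMap (IntBase F₀) F₀ a) x v⟩

instance [Module F V] : IsScalarTower (IntExt F₀ F) F V :=
  ⟨fun a x v => mul_smul (algebraMap (IntExt F₀ F) F a) x v⟩

instance [Module F₀ V] [Module F V] [IsScalarTower F₀ F V] :
    IsScalarTower (IntBase F₀) (IntExt F₀ F) V :=
  ⟨fun a x v => by
    have h : algebraMap (IntExt F₀ F) F (a • x) =
      algebraMap (IntBase F₀) F₀ a • algebraMap (IntExt F₀ F) F x := rfl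
    change algebraMap (IntExt F₀ F) F (a • x) • v =
      algebraMap (IntBase F₀) F₀ a • algebraMap (IntExt F₀ F) F x • v
    rw [h, smul_assoc]⟩

end

theorem mem_baseIntegers_or_inv {K : Type*} [Field K] [Algebra ℚ_[2] K] [FiniteDimensional ℚ_[2] K]
    (x : K) : x ∈ baseIntegers K ∨ x⁻¹ ∈ baseIntegers K := by
  have key (y : K) (hy : spectralNorm ℚ_[2] K y ≤ 1) : y ∈ baseIntegers K := by
    have hyi : IsIntegral ℚ_[2] y := Algebra.IsIntegral.isIntegral y
    have hmon := minpoly.monic hyi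
    have hco : ∀ n, (minpoly ℚ_[2] y).coeff n ∈ PadicInt.subring 2 := by
      intro n
      rcases lt_trichotomy n (minpoly ℚ_[2] y).natDegree with hn | hn | hn
      · have h1 := (le_ciSup (spectralValueTerms_bddAbove (minpoly ℚ_[2] y)) n).trans hy
        rw [spectralValueTerms_of_lt_natDegree _ hn] at h1
        by_contra hc
        have hc' : 1 < ‖(minpoly ℚ_[2] y).coeff n‖ := not_le.1 hc
        refine absurd h1 (not_le.2 (Real.one_lt_rpow hc' ?_))
        have : (n : ℝ) < (minpoly ℚ_[2] y).natDegree := by exact_mod_cast hn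
        exact one_div_pos.2 (sub_pos.2 this)
      · rw [hn, hmon.coeff_natDegree]; exact one_mem _
      · rw [Polynomial.coeff_eq_zero_of_natDegree_lt hn]; exact zero_mem _
    have hl : minpoly ℚ_[2] y ∈ Polynomial.lifts (PadicInt.subring 2).subtype := by
      rw [Polynomial.lifts_iff_coeff_lifts]
      intro n
      exact ⟨⟨_, hco n⟩, rfl⟩
    obtain ⟨p, hp, -, hpm⟩ := Polynomial.lifts_and_natDegree_eq_and_monic hl hmon
    refine ⟨p, hpm, ?_⟩
    have h2 := minpoly.aeval ℚ_[2] y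
    rw [← hp, Polynomial.aeval_def, Polynomial.eval₂_map] at h2
    exact h2
  by_cases hx : spectralNorm ℚ_[2] K x ≤ 1
  · exact Or.inl (key x hx)
  · refine Or.inr (key _ ?_)
    have hx0 : x ≠ 0 := by
      rintro rfl
      simp [spectralNorm_zero] at hx
    have hmul : spectralNorm ℚ_[2] K x * spectralNorm ℚ_[2] K x⁻¹ = 1 := by
      have := (spectralMulAlgNorm ℚ_[2] K).map_mul' x x⁻¹
      rw [mul_inv_cancel₀ hx0] at this
      have h1 := (spectralMulAlgNorm ℚ_[2] K).map_one'
      exact this.symm.trans h1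
    have hx' := not_le.1 hx
    by_contra hc
    have hc' := not_le.1 hc
    nlinarith

theorem mem_baseIntegers_of_isIntegral {K : Type*} [Field K] [Algebra ℚ_[2] K] {x : K}
    (hx : IsIntegral (baseIntegers K) x) : x ∈ baseIntegers K := by
  have h : x ∈ integralClosure (baseIntegers K) K := hx
  rw [integralClosure_idem] at h
  obtain ⟨y, rfl⟩ := Algebra.mem_bot.1 h
  exact y.2

theorem mem_of_sq_mem {K : Type*} [Field K] [Algebra ℚ_[2] K] {x : K}
    (h : x ^ 2 ∈ baseIntegers K) : x ∈ baseIntegers K :=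
  mem_baseIntegers_of_isIntegral
    (IsIntegral.of_pow (R := baseIntegers K) (n := 2) (by norm_num)
      (isIntegral_algebraMap (R := baseIntegers K) (A := K) (x := ⟨_, h⟩)))

section
variable {F₀ F : Type*} [Field F₀] [Algebra ℚ_[2] F₀] [Field F] [Algebra F₀ F]

theorem mem_baseIntegers_of_mem_extIntegers {x : F₀} (hx : algebraMap F₀ F x ∈ extIntegers F₀ F) :
    x ∈ baseIntegers F₀ :=
  mem_baseIntegers_of_isIntegral
    ((isIntegral_algebraMap_iff (FaithfulSMul.algebraMap_injective F₀ F)).1 hx)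

theorem algebraMap_mem_extIntegers {x : F₀} (hx : x ∈ baseIntegers F₀) :
    algebraMap F₀ F x ∈ extIntegers F₀ F :=
  isIntegral_algebraMap (R := baseIntegers F₀) (A := F) (x := ⟨x, hx⟩)

theorem equiv_mem_extIntegers (σ : F ≃ₐ[F₀] F) {x : F} (hx : x ∈ extIntegers F₀ F) :
    σ x ∈ extIntegers F₀ F :=
  IsIntegral.map (σ.toAlgHom.restrictScalars (baseIntegers F₀)) hx

/-- `z ∈ F` satisfies `Tr(a z) ∈ O_{F₀}` for all `a ∈ O_F`. -/
def IsDual (F₀ : Type*) {F : Type*} [Field F₀] [Algebra ℚ_[2] F₀] [Field F] [Algebra F₀ F]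
    (z : F) : Prop :=
  ∀ a ∈ extIntegers F₀ F, Algebra.trace F₀ F (a * z) ∈ baseIntegers F₀

theorem IsDual.add {z w : F} (hz : IsDual F₀ z) (hw : IsDual F₀ w) : IsDual F₀ (z + w) :=
  fun a ha => by rw [mul_add, map_add]; exact add_mem (hz a ha) (hw a ha)

theorem IsDual.neg {z : F} (hz : IsDual F₀ z) : IsDual F₀ (-z) :=
  fun a ha => by rw [mul_neg, map_neg]; exact neg_mem (hz a ha)

theorem IsDual.zero : IsDual F₀ (0 : F) :=
  fun a ha => by rw [mul_zero, map_zero]; exact zero_mem _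

theorem IsDual.mul {b z : F} (hb : b ∈ extIntegers F₀ F) (hz : IsDual F₀ z) :
    IsDual F₀ (b * z) :=
  fun a ha => by rw [← mul_assoc]; exact hz _ (mul_mem ha hb)

theorem IsDual.trace_mem {z : F} (hz : IsDual F₀ z) : Algebra.trace F₀ F z ∈ baseIntegers F₀ := by
  have := hz 1 (one_mem _)
  rwa [one_mul] at this

end
end Arithmetic

/-- Standing data: `F/F₀` is a quadratic extension of `2`-adic fields with nontrivial automorphism
`σ`, with uniformizers `π` of `F` and `π₀` of `F₀` such that `π² - t π + π₀ = 0`, where either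
`π₀ ∣ t ∣ 2` (type (R-U)) or `t = 0` (type (R-P)); in particular `F/F₀` is ramified. Moreover
`h` is a hermitian form on `V` and `e` is a basis of `V` with `h (eᵢ, eⱼ) = δ_{i, n + 1 - j}`, where
`n = 2 m + 1`. -/
structure SplitHermitianDatum (F₀ F V : Type*) [Field F₀] [Algebra ℚ_[2] F₀] [Field F]
    [Algebra F₀ F] [AddCommGroup V] [Module F V] (m : ℕ) where
  finrank_eq : Module.finrank F₀ F = 2
  σ : F ≃ₐ[F₀] F
  σ_ne : σ ≠ AlgEquiv.refl
  π : extIntegers F₀ F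
  π₀ : baseIntegers F₀
  t : baseIntegers F₀
  irreducible_π : Irreducible π
  irreducible_π₀ : Irreducible π₀
  equation : (π : F) ^ 2 - algebraMap F₀ F t * π + algebraMap F₀ F π₀ = 0
  type : (π₀ ∣ t ∧ t ∣ 2) ∨ t = 0
  h : V →ₗ[F] V →ₛₗ[(σ : F →+* F)] F
  hermitian : ∀ x y, σ (h x y) = h y x
  e : Module.Basis (Fin (2 * m + 1)) F V
  h_e : ∀ i j, h (e i) (e j) = if j = i.rev then 1 else 0

namespace SplitHermitianDatum

section
variable {F₀ F V : Type*} [Field F₀] [Algebra ℚ_[2] F₀] [Field F] [Algebra F₀ F]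
  [AddCommGroup V] [Module F V] {m : ℕ} (D : SplitHermitianDatum F₀ F V m)

open Classical in
/-- `ε = t` for type (R-U) and `ε = 2` for type (R-P). -/
noncomputable def ε : F₀ := if D.t = 0 then 2 else D.t

open Classical in
/-- `lam = σ π / t` for type (R-U) and `lam = 1 / 2` for type (R-P). -/
noncomputable def lam : F := if D.t = 0 then 2⁻¹ else D.σ D.π / algebraMap F₀ F D.t

theorem charZero : CharZero F₀ :=
  charZero_of_injective_algebraMap (FaithfulSMul.algebraMap_injective ℚ_[2] F₀)

theorem isGalois (D : SplitHermitianDatum F₀ F V m) : IsGalois F₀ F := by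
  have hfd : FiniteDimensional F₀ F := .of_finrank_pos (by rw [D.finrank_eq]; norm_num)
  refine IsGalois.of_card_aut_eq_finrank F₀ F (le_antisymm ?_ ?_)
  · rw [Nat.card_eq_fintype_card]; exact AlgEquiv.card_le
  · rw [D.finrank_eq, Nat.succ_le_iff, Finite.one_lt_card_iff_nontrivial]
    exact ⟨D.σ, AlgEquiv.refl, D.σ_ne⟩

theorem finiteDimensional (D : SplitHermitianDatum F₀ F V m) : FiniteDimensional F₀ F :=
  .of_finrank_pos (by rw [D.finrank_eq]; norm_num)

theorem algebraMap_trace (x : F) : algebraMap F₀ F (Algebra.trace F₀ F x) = x + D.σ x := by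
  classical
  have := D.isGalois
  have := D.finiteDimensional
  have hcard : Fintype.card (F ≃ₐ[F₀] F) = 2 := by
    rw [← Nat.card_eq_fintype_card, IsGalois.card_aut_eq_finrank, D.finrank_eq]
  have huniv : (Finset.univ : Finset (F ≃ₐ[F₀] F)) = {AlgEquiv.refl, D.σ} := by
    symm
    rw [← Finset.card_eq_iff_eq_univ, hcard, Finset.card_pair D.σ_ne.symm]
  rw [trace_eq_sum_automorphisms, huniv, Finset.sum_pair D.σ_ne.symm]
  rfl

theorem σ_σ (x : F) : D.σ (D.σ x) = x := by
  have h1 := D.algebraMap_trace x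
  have h2 := congrArg D.σ h1
  rw [D.σ.commutes, h1, map_add] at h2
  linear_combination -h2

theorem exists_of_σ_eq {x : F} (hx : D.σ x = x) : ∃ y : F₀, algebraMap F₀ F y = x := by
  have := charZero (F₀ := F₀)
  refine ⟨Algebra.trace F₀ F x / 2, ?_⟩
  have : CharZero F := charZero_of_injective_algebraMap (FaithfulSMul.algebraMap_injective F₀ F)
  rw [map_div₀, D.algebraMap_trace, hx, map_ofNat]
  ring

theorem dvd_t : ∃ s ∈ baseIntegers F₀, (D.t : F₀) = D.π₀ * s := by
  rcases D.type with ⟨⟨s, hs⟩, -⟩ | h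
  · exact ⟨s, s.2, by rw [hs]; rfl⟩
  · exact ⟨0, zero_mem _, by rw [h]; simp⟩

theorem π₀_ne : (D.π₀ : F₀) ≠ 0 := fun h => D.irreducible_π₀.ne_zero (Subtype.ext h)

theorem inv_π₀_not_mem : (D.π₀ : F₀)⁻¹ ∉ baseIntegers F₀ := fun h =>
  D.irreducible_π₀.not_isUnit (IsUnit.of_mul_eq_one (⟨_, h⟩ : baseIntegers F₀)
    (Subtype.ext (mul_inv_cancel₀ D.π₀_ne)))

end

section
variable {F₀ F V : Type*} [Field F₀] [Algebra ℚ_[2] F₀] [FiniteDimensional ℚ_[2] F₀]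
  [Field F] [Algebra F₀ F]
  [AddCommGroup V] [Module F V] {m : ℕ} (D : SplitHermitianDatum F₀ F V m)
/-- Units of the local ring `O_{F₀}`: `1 + π₀ c` is invertible. -/
theorem inv_one_add_mem {c : F₀} (hc : c ∈ baseIntegers F₀) :
    1 + D.π₀ * c ≠ 0 ∧ (1 + D.π₀ * c)⁻¹ ∈ baseIntegers F₀ := by
  have hne : (1 : F₀) + D.π₀ * c ≠ 0 := by
    intro h
    refine D.inv_π₀_not_mem ?_
    have : (D.π₀ : F₀)⁻¹ = -c := by
      rw [inv_eq_iff_eq_inv, ← mul_eq_one_iff_eq_inv₀]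
      · linear_combination -h
      · rintro h0
        rw [neg_eq_zero] at h0
        simp [h0] at h
    rw [this]
    exact neg_mem hc
  refine ⟨hne, ?_⟩
  rcases mem_baseIntegers_or_inv ((1 + D.π₀ * c)⁻¹ : F₀) with h | h
  · exact h
  · rw [inv_inv] at h
    by_contra hcon
    have hnu : ¬ IsUnit (⟨_, h⟩ : baseIntegers F₀) := by
      intro hu
      obtain ⟨b, hb⟩ := hu.exists_right_inv
      have hb' : (1 + D.π₀ * c : F₀) * b = 1 := congrArg Subtype.val hb
      exact hcon (by rw [← eq_inv_of_mul_eq_one_right hb']; exact b.2)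
    -- compare `u = 1 + π₀ c` with `π₀`
    rcases mem_baseIntegers_or_inv ((1 + D.π₀ * c : F₀) / D.π₀) with h1 | h1
    · refine D.inv_π₀_not_mem ?_
      have : (D.π₀ : F₀)⁻¹ = (1 + D.π₀ * c : F₀) / D.π₀ - c := by
        have := D.π₀_ne
        field_simp
        ring
      rw [this]
      exact sub_mem h1 hc
    · have hfac : D.π₀ = (⟨_, h⟩ : baseIntegers F₀) * ⟨_, h1⟩ := by
        refine Subtype.ext ?_
        change (D.π₀ : F₀) = (1 + D.π₀ * c) * ((1 + D.π₀ * c : F₀) / D.π₀)⁻¹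
        have := D.π₀_ne
        field_simp
      rcases D.irreducible_π₀.isUnit_or_isUnit hfac with hu | hu
      · exact hnu hu
      · obtain ⟨b, hb⟩ := hu.exists_right_inv
        have hb' : ((1 + D.π₀ * c : F₀) / D.π₀)⁻¹ * b = 1 := congrArg Subtype.val hb
        refine D.inv_π₀_not_mem ?_
        have h2 : (D.π₀ : F₀)⁻¹ = b - c := by
          have h3 := D.π₀_ne
          field_simp at hb'
          field_simp
          linear_combination -hb'
        rw [h2]
        exact sub_mem b.2 hc

theorem not_sq_mul_π₀ {x : F₀} (h : D.π₀ * x ^ 2 ∈ baseIntegers F₀) : x ∈ baseIntegers F₀ := by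
  rcases mem_baseIntegers_or_inv x with hx | hx
  · exact hx
  · by_cases hx0 : x = 0
    · rw [hx0]; exact zero_mem _
    rcases mem_baseIntegers_or_inv (D.π₀ * x) with h1 | h1
    · have hfac : D.π₀ = (⟨_, h1⟩ : baseIntegers F₀) * ⟨_, hx⟩ := by
        refine Subtype.ext ?_
        change (D.π₀ : F₀) = D.π₀ * x * x⁻¹
        field_simp
      rcases D.irreducible_π₀.isUnit_or_isUnit hfac with hu | hu
      · obtain ⟨b, hb⟩ := hu.exists_right_inv
        have hb' : (D.π₀ * x : F₀) * b = 1 := congrArg Subtype.val hb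
        have h2 : x = D.π₀ * x ^ 2 * b := by linear_combination -x * hb'
        rw [h2]
        exact mul_mem h b.2
      · obtain ⟨b, hb⟩ := hu.exists_right_inv
        have hb' : (x⁻¹ : F₀) * b = 1 := congrArg Subtype.val hb
        have h2 : x = b := by field_simp at hb'; exact hb'.symm
        rw [h2]
        exact b.2
    · have h2 : x = (D.π₀ * x ^ 2) * (D.π₀ * x)⁻¹ := by
        have := D.π₀_ne
        field_simp
      rw [h2]
      exact mul_mem h h1

theorem mem_of_norm_mem {x y : F₀} (h : x ^ 2 + D.t * x * y + D.π₀ * y ^ 2 ∈ baseIntegers F₀) :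
    x ∈ baseIntegers F₀ ∧ y ∈ baseIntegers F₀ := by
  obtain ⟨s, hs, hts⟩ := D.dvd_t
  rw [hts] at h
  have hsq := D.π₀.2
  by_cases hx0 : x = 0
  · subst hx0
    exact ⟨zero_mem _, D.not_sq_mul_π₀ (by simpa using h)⟩
  by_cases hz : y / x ∈ baseIntegers F₀
  · have hc : s * (y / x) + (y / x) ^ 2 ∈ baseIntegers F₀ :=
      add_mem (mul_mem hs hz) (pow_mem hz 2)
    obtain ⟨hne, hinv⟩ := D.inv_one_add_mem hc
    have hx : x ∈ baseIntegers F₀ := by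
      refine mem_of_sq_mem ?_
      have : x ^ 2 = (x ^ 2 + D.π₀ * s * x * y + D.π₀ * y ^ 2) *
          (1 + D.π₀ * (s * (y / x) + (y / x) ^ 2))⁻¹ := by
        rw [eq_mul_inv_iff_mul_eq₀ hne]
        field_simp
        ring
      rw [this]
      exact mul_mem h hinv
    refine ⟨hx, ?_⟩
    have : y = y / x * x := by field_simp
    rw [this]
    exact mul_mem hz hx
  · have hz' := (mem_baseIntegers_or_inv (y / x)).resolve_left hz
    rw [inv_div] at hz'
    by_cases hy0 : y = 0
    · subst hy0
      simp at hz
    have hp := D.π₀_ne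
    have h1 : x / y / D.π₀ ∈ baseIntegers F₀ := by
      rcases mem_baseIntegers_or_inv (x / y / D.π₀) with h1 | h1
      · exact h1
      have hfac : D.π₀ = (⟨_, hz'⟩ : baseIntegers F₀) * ⟨_, h1⟩ := by
        refine Subtype.ext ?_
        change (D.π₀ : F₀) = (x / y) * (x / y / D.π₀)⁻¹
        field_simp
      rcases D.irreducible_π₀.isUnit_or_isUnit hfac with hu | hu
      · obtain ⟨b, hb⟩ := hu.exists_right_inv
        have hb' : (x / y : F₀) * b = 1 := congrArg Subtype.val hb
        refine absurd ?_ hz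
        have : y / x = b := by field_simp at hb' ⊢; exact hb'.symm
        rw [this]; exact b.2
      · obtain ⟨b, hb⟩ := hu.exists_right_inv
        have hb' : (x / y / D.π₀ : F₀)⁻¹ * b = 1 := congrArg Subtype.val hb
        have : x / y / D.π₀ = b := by field_simp at hb' ⊢; exact hb'.symm
        rw [this]; exact b.2
    have hy : y ∈ baseIntegers F₀ := by
      obtain ⟨hne, hinv⟩ := D.inv_one_add_mem
        (add_mem (pow_mem h1 2) (mul_mem hs h1))
      refine D.not_sq_mul_π₀ ?_
      have : D.π₀ * y ^ 2 = (x ^ 2 + D.π₀ * s * x * y + D.π₀ * y ^ 2) *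
          (1 + D.π₀ * ((x / y / D.π₀) ^ 2 + s * (x / y / D.π₀)))⁻¹ := by
        rw [eq_mul_inv_iff_mul_eq₀ hne]
        field_simp
        ring
      rw [this]
      exact mul_mem h hinv
    refine ⟨?_, hy⟩
    have : x = x / y * y := by field_simp
    rw [this]
    exact mul_mem hz' hy

theorem σ_π_ne : D.σ D.π ≠ D.π := by
  intro h
  obtain ⟨c, hc⟩ := D.exists_of_σ_eq h
  obtain ⟨s, hs, hts⟩ := D.dvd_t
  have hcm : c ∈ baseIntegers F₀ :=
    mem_baseIntegers_of_mem_extIntegers (F := F) (by rw [hc]; exact D.π.2)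
  have heq : c ^ 2 - D.t * c + D.π₀ = 0 := by
    refine FaithfulSMul.algebraMap_injective F₀ F ?_
    have := D.equation
    rw [← hc] at this
    simpa using this
  have hfac : D.π₀ = (⟨c, hcm⟩ : baseIntegers F₀) * (D.t - ⟨c, hcm⟩) := by
    refine Subtype.ext ?_
    change (D.π₀ : F₀) = c * (D.t - c)
    linear_combination heq
  have hp := D.π₀_ne
  rcases D.irreducible_π₀.isUnit_or_isUnit hfac with hu | hu
  · obtain ⟨b, hb⟩ := hu.exists_right_inv
    have hb' : c * (b : F₀) = 1 := congrArg Subtype.val hb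
    refine D.inv_π₀_not_mem ?_
    have : (D.π₀ : F₀)⁻¹ = (c * s - 1) * b ^ 2 := by
      rw [inv_eq_iff_eq_inv, ← mul_eq_one_iff_eq_inv₀]
      · rw [hts] at heq
        linear_combination (c * b + 1) * hb' - b ^ 2 * heq
      · intro h0
        have : (1 : F₀) = 0 := by
          rw [hts] at heq
          linear_combination (-(c * b + 1)) * hb' + b ^ 2 * heq + D.π₀ * h0
        exact one_ne_zero this
    rw [this]
    exact mul_mem (sub_mem (mul_mem hcm hs) (one_mem _)) (pow_mem b.2 2)
  · obtain ⟨b, hb⟩ := hu.exists_right_inv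
    have hb' : (D.t - c : F₀) * b = 1 := congrArg Subtype.val hb
    refine D.inv_π₀_not_mem ?_
    have hcb : c = D.π₀ * b := by linear_combination (-c) * hb' - b * heq
    have : (D.π₀ : F₀)⁻¹ = (s - b) * b := by
      rw [hts, hcb] at hb'
      field_simp
      linear_combination -hb'
    rw [this]
    exact mul_mem (sub_mem hs b.2) b.2

theorem σ_π : D.σ D.π = algebraMap F₀ F D.t - D.π := by
  have h1 := D.equation
  have h2 := congrArg D.σ h1
  simp only [map_add, map_sub, map_mul, map_pow, D.σ.commutes, map_zero] at h2
  have h3 : (D.σ D.π - D.π) * (D.σ D.π + D.π - algebraMap F₀ F D.t) = 0 := by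
    linear_combination h2 - h1
  rcases mul_eq_zero.1 h3 with h | h
  · exact absurd (sub_eq_zero.1 h) D.σ_π_ne
  · linear_combination h

theorem π_mul_σ_π : (D.π : F) * D.σ D.π = algebraMap F₀ F D.π₀ := by
  rw [D.σ_π]
  linear_combination -D.equation

theorem π_ne : (D.π : F) ≠ 0 := fun h => D.irreducible_π.ne_zero (Subtype.ext h)

theorem σ_π_ne_zero : D.σ D.π ≠ 0 := by
  rw [Ne, map_eq_zero_iff _ D.σ.injective]; exact D.π_ne

/-- `O_F = O_{F₀} ⊕ O_{F₀} π`. -/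
theorem exists_eq_add_mul_π {a : F} (ha : a ∈ extIntegers F₀ F) :
    ∃ x ∈ baseIntegers F₀, ∃ y ∈ baseIntegers F₀,
      a = algebraMap F₀ F x + algebraMap F₀ F y * D.π := by
  have hd : (D.π : F) - D.σ D.π ≠ 0 := sub_ne_zero.2 D.σ_π_ne.symm
  have hd' : D.σ D.π - (D.π : F) ≠ 0 := sub_ne_zero.2 D.σ_π_ne
  obtain ⟨y, hy⟩ := D.exists_of_σ_eq (x := (a - D.σ a) / (D.π - D.σ D.π)) (by
    rw [map_div₀, map_sub, map_sub, D.σ_σ, D.σ_σ]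
    rw [div_eq_div_iff hd' hd]
    ring)
  rw [eq_div_iff hd] at hy
  obtain ⟨x, hx⟩ := D.exists_of_σ_eq (x := a - algebraMap F₀ F y * D.π) (by
    rw [map_sub, map_mul, D.σ.commutes]
    linear_combination hy)
  have hax : a = algebraMap F₀ F x + algebraMap F₀ F y * D.π := by rw [hx]; ring
  have hn : x ^ 2 + D.t * x * y + D.π₀ * y ^ 2 ∈ baseIntegers F₀ := by
    refine mem_baseIntegers_of_mem_extIntegers (F := F) ?_
    have : algebraMap F₀ F (x ^ 2 + D.t * x * y + D.π₀ * y ^ 2) = a * D.σ a := by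
      rw [hax]
      simp only [map_add, map_mul, map_pow, D.σ.commutes]
      rw [← D.π_mul_σ_π, D.σ_π]
      ring
    rw [this]
    exact mul_mem ha (equiv_mem_extIntegers D.σ ha)
  obtain ⟨hxm, hym⟩ := D.mem_of_norm_mem hn
  exact ⟨x, hxm, y, hym, hax⟩

theorem two_ne : (2 : F₀) ≠ 0 := by
  have := charZero (F₀ := F₀)
  exact two_ne_zero

theorem algebraMap_ne {x : F₀} (hx : x ≠ 0) : algebraMap F₀ F x ≠ 0 := by
  rwa [Ne, map_eq_zero_iff _ (FaithfulSMul.algebraMap_injective F₀ F)]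

theorem σ_lam_add_lam : D.lam + D.σ D.lam = 1 := by
  have h2 : (2 : F) ≠ 0 := by
    have := algebraMap_ne (F := F) (two_ne (F₀ := F₀))
    rwa [map_ofNat] at this
  unfold lam
  split_ifs with h
  · rw [map_inv₀, map_ofNat]; field_simp; norm_num
  · have ht : algebraMap F₀ F D.t ≠ 0 := algebraMap_ne fun h' => h (Subtype.ext h')
    rw [map_div₀, D.σ.commutes, D.σ_σ, D.σ_π]
    field_simp
    ring

end

section
variable {F₀ F V : Type*} [Field F₀] [Algebra ℚ_[2] F₀] [FiniteDimensional ℚ_[2] F₀]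
  [Field F] [Algebra F₀ F]
  [AddCommGroup V] [Module F V] {m : ℕ} (D : SplitHermitianDatum F₀ F V m)
theorem σ_π_mem : D.σ D.π ∈ extIntegers F₀ F := equiv_mem_extIntegers D.σ D.π.2

/-- The four basic elements of the inverse different. -/
theorem isDual_basic :
    IsDual F₀ ((D.π : F)⁻¹ * D.σ D.lam) ∧ IsDual F₀ ((D.σ D.π)⁻¹ * D.lam) ∧
      IsDual F₀ ((D.σ D.π)⁻¹ * D.σ D.lam) ∧ IsDual F₀ ((D.σ D.π)⁻¹) := by
  have hπ := D.π_ne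
  have hσπ := D.σ_π_ne_zero
  have h2 : (2 : F) ≠ 0 := by
    have := algebraMap_ne (F := F) (two_ne (F₀ := F₀))
    rwa [map_ofNat] at this
  have hσ := D.σ_π
  have hππ := D.π_mul_σ_π
  have htwo : (2 : F) ∈ extIntegers F₀ F := by
    have h11 : (2 : F) = 1 + 1 := one_add_one_eq_two.symm
    rw [h11]; exact add_mem (one_mem _) (one_mem _)
  by_cases h : D.t = 0
  · have hlam : D.lam = 2⁻¹ := if_pos h
    have hσlam : D.σ D.lam = 2⁻¹ := by rw [hlam, map_inv₀, map_ofNat]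
    have hσ' : D.σ D.π = -D.π := by rw [hσ, h]; simp
    have key : IsDual F₀ ((D.π : F)⁻¹ * 2⁻¹) := by
      intro a ha
      obtain ⟨x, hx, y, hy, rfl⟩ := D.exists_eq_add_mul_π ha
      have : Algebra.trace F₀ F ((algebraMap F₀ F x + algebraMap F₀ F y * D.π) *
          ((D.π : F)⁻¹ * 2⁻¹)) = y := by
        refine FaithfulSMul.algebraMap_injective F₀ F ?_
        rw [D.algebraMap_trace]
        simp only [map_add, map_mul, map_inv₀, map_ofNat, D.σ.commutes, hσ']
        field_simp
        ring
      rw [this]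
      exact hy
    rw [hσlam, hlam, hσ', inv_neg]
    refine ⟨key, ?_, ?_, ?_⟩
    · rw [neg_mul]; exact key.neg
    · rw [neg_mul]; exact key.neg
    · have : (D.π : F)⁻¹ = 2 * ((D.π : F)⁻¹ * 2⁻¹) := by field_simp
      rw [this]
      exact (key.mul htwo).neg
  · have htF : (D.t : F₀) ≠ 0 := fun h' => h (Subtype.ext h')
    have ht : algebraMap F₀ F D.t ≠ 0 := algebraMap_ne htF
    have hlam : D.lam = D.σ D.π / algebraMap F₀ F D.t := if_neg h
    have hσlam : D.σ D.lam = D.π / algebraMap F₀ F D.t := by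
      rw [hlam, map_div₀, D.σ.commutes, D.σ_σ]
    obtain ⟨-, k, hk⟩ := D.type.resolve_right h
    have hk' : (2 : F₀) = D.t * k := congrArg Subtype.val hk
    have hkF : (2 : F) = algebraMap F₀ F D.t * algebraMap F₀ F k := by
      rw [← map_mul, ← hk', map_ofNat]
    have key : IsDual F₀ (algebraMap F₀ F D.t)⁻¹ := by
      intro a ha
      obtain ⟨x, hx, y, hy, rfl⟩ := D.exists_eq_add_mul_π ha
      have : Algebra.trace F₀ F ((algebraMap F₀ F x + algebraMap F₀ F y * D.π) *
          (algebraMap F₀ F D.t)⁻¹) = k * x + y := by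
        refine FaithfulSMul.algebraMap_injective F₀ F ?_
        rw [D.algebraMap_trace]
        simp only [map_add, map_mul, map_inv₀, D.σ.commutes, hσ]
        field_simp
        linear_combination algebraMap F₀ F x * hkF
      rw [this]
      exact add_mem (mul_mem k.2 hx) hy
    obtain ⟨s, hs, hts⟩ := D.dvd_t
    have htsF : algebraMap F₀ F D.t = D.π * D.σ D.π * algebraMap F₀ F s := by
      rw [hππ, ← map_mul, hts]
    have hsF := algebraMap_mem_extIntegers (F := F) hs
    have hq : (D.σ D.π)⁻¹ * D.π = D.π * algebraMap F₀ F s - 1 := by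
      field_simp
      have : (D.π : F) = algebraMap F₀ F D.t - D.σ D.π := by rw [hσ]; ring
      linear_combination this + htsF
    rw [hσlam, hlam]
    refine ⟨?_, ?_, ?_, ?_⟩
    · have : (D.π : F)⁻¹ * (D.π / algebraMap F₀ F D.t) = (algebraMap F₀ F D.t)⁻¹ := by field_simp
      rw [this]; exact key
    · have : (D.σ D.π)⁻¹ * (D.σ D.π / algebraMap F₀ F D.t) = (algebraMap F₀ F D.t)⁻¹ := by
        field_simp
      rw [this]; exact key
    · have : (D.σ D.π)⁻¹ * (D.π / algebraMap F₀ F D.t) =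
          (D.π * algebraMap F₀ F s - 1) * (algebraMap F₀ F D.t)⁻¹ := by
        rw [← hq]; field_simp
      rw [this]
      exact key.mul (sub_mem (mul_mem D.π.2 hsF) (one_mem _))
    · have : (D.σ D.π)⁻¹ = (D.π * algebraMap F₀ F s) * (algebraMap F₀ F D.t)⁻¹ := by
        field_simp
        linear_combination htsF
      rw [this]
      exact key.mul (mul_mem D.π.2 hsF)

end

section
variable {F₀ F V : Type*} [Field F₀] [Algebra ℚ_[2] F₀]
  [Field F] [Algebra F₀ F]
  [AddCommGroup V] [Module F V] {m : ℕ} (D : SplitHermitianDatum F₀ F V m)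

/-- The coefficient of `e_{j + 1}` in the basis of `Λᵢ`: `π⁻¹` for the first `i` basis vectors, `1`
up to `e_{m + 1}`, and `lam` for the last `m` basis vectors. -/
noncomputable def latticeCoeff (i : ℕ) (j : Fin (2 * m + 1)) : F :=
  if (j : ℕ) < i then (D.π : F)⁻¹ else if (j : ℕ) ≤ m then 1 else D.lam

/-- The lattice `Λᵢ = O_F ⟨π⁻¹ e₁, …, π⁻¹ eᵢ, e_{i+1}, …, e_{m+1}, lam e_{m+2}, …, lam eₙ⟩`,
for `0 ≤ i ≤ m`. -/
noncomputable def lattice (i : ℕ) : Submodule (IntExt F₀ F) V :=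
  Submodule.span (IntExt F₀ F) (Set.range fun j => D.latticeCoeff i j • D.e j)

/-- The invertible `O_{F₀}`-module `𝓛 = ε⁻¹ O_{F₀} ⊆ F₀`. -/
noncomputable def valueModule : Submodule (IntBase F₀) F₀ :=
  Submodule.span (IntBase F₀) {D.ε⁻¹}

variable [Module F₀ V] [IsScalarTower F₀ F V]

/-- The hermitian form as an `F₀`-bilinear map. -/
noncomputable def hBilin : LinearMap.BilinMap F₀ V F :=
  LinearMap.mk₂ F₀ (fun x y => D.h x y) (fun x y z => by simp)
    (fun c x y => by
      rw [← algebraMap_smul F c x, map_smul, LinearMap.smul_apply, algebraMap_smul])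
    (fun x y z => by simp)
    (fun c x y => by
      rw [← algebraMap_smul F c y, LinearMap.map_smulₛₗ]
      simp [Algebra.smul_def])

/-- `s(x, y) = ε⁻¹ Tr h(x, y)`. -/
noncomputable def s : LinearMap.BilinMap F₀ V F₀ :=
  D.ε⁻¹ • D.hBilin.compr₂ (Algebra.trace F₀ F)

/-- `q(x) = s(x, x) / 2`. -/
noncomputable def q : QuadraticMap F₀ V F₀ :=
  (2⁻¹ : F₀) • LinearMap.BilinMap.toQuadraticMap D.s

/-- `φ(x, y) = ε⁻¹ Tr h(x, π⁻¹ y)`. -/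
noncomputable def φ : LinearMap.BilinMap F₀ V F₀ :=
  D.s.compl₂ (Algebra.lsmul F₀ F₀ V (D.π : F)⁻¹)

theorem s_apply (x y : V) : D.s x y = D.ε⁻¹ * Algebra.trace F₀ F (D.h x y) := rfl

theorem q_apply (x : V) : D.q x = 2⁻¹ * D.s x x := rfl

theorem φ_apply (x y : V) :
    D.φ x y = D.ε⁻¹ * Algebra.trace F₀ F (D.h x ((D.π : F)⁻¹ • y)) := rfl

theorem mem_valueModule {x : F₀} (hx : x ∈ baseIntegers F₀) : D.ε⁻¹ * x ∈ D.valueModule := by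
  rw [mul_comm]
  exact Submodule.smul_mem _ (⟨x, hx⟩ : IntBase F₀) (Submodule.subset_span rfl)

end

section
variable {F₀ F V : Type*} [Field F₀] [Algebra ℚ_[2] F₀] [FiniteDimensional ℚ_[2] F₀]
  [Field F] [Algebra F₀ F] [AddCommGroup V] [Module F V] {m : ℕ}
  (D : SplitHermitianDatum F₀ F V m)

theorem smul_coe (b : IntExt F₀ F) (x : V) : b • x = algebraMap (IntExt F₀ F) F b • x := rfl

theorem isDual_mul_h {i : ℕ} {w : F}
    (hw : ∀ j k, IsDual F₀ (w * D.h (D.latticeCoeff i j • D.e j) (D.latticeCoeff i k • D.e k)))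
    {x y : V} (hx : x ∈ D.lattice i) (hy : y ∈ D.lattice i) : IsDual F₀ (w * D.h x y) := by
  induction hx using Submodule.span_induction with
  | zero => simpa using IsDual.zero
  | add x x' _ _ h h' => rw [map_add, LinearMap.add_apply, mul_add]; exact h.add h'
  | smul b x _ h =>
    rw [smul_coe, map_smul, LinearMap.smul_apply, smul_eq_mul, mul_left_comm]
    exact h.mul b.2
  | mem x hx =>
    obtain ⟨j, rfl⟩ := hx
    induction hy using Submodule.span_induction with
    | zero => simpa using IsDual.zero
    | add x x' _ _ h h' => rw [map_add, mul_add]; exact h.add h'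
    | smul b x _ h =>
      rw [smul_coe, LinearMap.map_smulₛₗ, smul_eq_mul, mul_left_comm]
      exact h.mul (equiv_mem_extIntegers D.σ b.2)
    | mem y hy =>
      obtain ⟨k, rfl⟩ := hy
      exact hw j k

theorem h_gen (i : ℕ) (j k : Fin (2 * m + 1)) :
    D.h (D.latticeCoeff i j • D.e j) (D.latticeCoeff i k • D.e k) =
      if k = j.rev then D.latticeCoeff i j * D.σ (D.latticeCoeff i k) else 0 := by
  rw [LinearMap.map_smulₛₗ, D.h.map_smul, LinearMap.smul_apply, D.h_e]
  split_ifs <;> simp [mul_comm]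

theorem isDual_h {i : ℕ} (hi : i ≤ m) {x y : V} (hx : x ∈ D.lattice i) (hy : y ∈ D.lattice i) :
    IsDual F₀ (D.h x y) := by
  obtain ⟨h1, h2, h3, h4⟩ := D.isDual_basic
  have hπ := D.π_ne
  have hσπ := D.σ_π_ne_zero
  have key := D.isDual_mul_h (i := i) (w := 1) (x := x) (y := y) ?_ hx hy
  · rwa [one_mul] at key
  intro j k
  rw [one_mul, h_gen]
  split_ifs with hjk
  swap
  · exact IsDual.zero
  have hkj : (k : ℕ) = 2 * m - j := by rw [hjk, Fin.val_rev]; omega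
  have hσl : IsDual F₀ (D.σ D.lam) := by
    have := h1.mul D.π.2
    rwa [mul_inv_cancel_left₀ hπ] at this
  have hl : IsDual F₀ D.lam := by
    have := h2.mul D.σ_π_mem
    rwa [mul_inv_cancel_left₀ hσπ] at this
  have hone : IsDual F₀ (1 : F) := by
    have := h4.mul D.σ_π_mem
    rwa [mul_inv_cancel₀ hσπ] at this
  have hj := j.2
  unfold latticeCoeff
  rw [hkj]
  by_cases c1 : (j : ℕ) < i
  · rw [if_pos c1, if_neg (by omega), if_neg (by omega)]
    exact h1
  rw [if_neg c1]
  by_cases c2 : (j : ℕ) ≤ m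
  · rw [if_pos c2, one_mul, if_neg (by omega)]
    by_cases c3 : (j : ℕ) = m
    · rw [if_pos (by omega), map_one]; exact hone
    · rw [if_neg (by omega)]; exact hσl
  · rw [if_neg c2]
    by_cases c3 : 2 * m - (j : ℕ) < i
    · rw [if_pos c3, map_inv₀, mul_comm]; exact h2
    · rw [if_neg c3, if_pos (by omega), map_one, mul_one]; exact hl

theorem isDual_inv_h {x y : V} (hx : x ∈ D.lattice 0) (hy : y ∈ D.lattice 0) :
    IsDual F₀ ((D.σ D.π)⁻¹ * D.h x y) := by
  obtain ⟨h1, h2, h3, h4⟩ := D.isDual_basic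
  refine D.isDual_mul_h ?_ hx hy
  intro j k
  rw [h_gen]
  split_ifs with hjk
  swap
  · rw [mul_zero]; exact IsDual.zero
  have hkj : (k : ℕ) = 2 * m - j := by rw [hjk, Fin.val_rev]; omega
  have hj := j.2
  unfold latticeCoeff
  rw [hkj, if_neg (Nat.not_lt_zero _), if_neg (Nat.not_lt_zero _)]
  by_cases c2 : (j : ℕ) ≤ m
  · rw [if_pos c2, one_mul]
    by_cases c3 : (j : ℕ) = m
    · rw [if_pos (by omega), map_one, mul_one]; exact h4
    · rw [if_neg (by omega)]; exact h3
  · rw [if_neg c2, if_pos (by omega), map_one, mul_one]; exact h2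

variable [Module F₀ V] [IsScalarTower F₀ F V]

theorem s_mem {i : ℕ} (hi : i ≤ m) {x y : V} (hx : x ∈ D.lattice i) (hy : y ∈ D.lattice i) :
    D.s x y ∈ D.valueModule :=
  D.mem_valueModule (D.isDual_h hi hx hy).trace_mem

theorem φ_mem {x y : V} (hx : x ∈ D.lattice 0) (hy : y ∈ D.lattice 0) :
    D.φ x y ∈ D.valueModule := by
  rw [φ_apply]
  refine D.mem_valueModule ?_
  have := (D.isDual_inv_h hx hy).trace_mem
  rwa [← map_inv₀, ← smul_eq_mul, ← RingHom.coe_coe (D.σ), ← LinearMap.map_smulₛₗ] at this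

theorem s_comm (x y : V) : D.s x y = D.s y x := by
  have h : Algebra.trace F₀ F (D.h x y) = Algebra.trace F₀ F (D.h y x) := by
    refine FaithfulSMul.algebraMap_injective F₀ F ?_
    rw [D.algebraMap_trace, D.algebraMap_trace, D.hermitian, D.hermitian, add_comm]
  rw [s_apply, s_apply, h]

theorem q_add (x y : V) : D.q (x + y) = D.q x + D.q y + D.s x y := by
  have h2 := two_ne (F₀ := F₀)
  simp only [q_apply, map_add, LinearMap.add_apply, D.s_comm y x]
  field_simp
  ring

theorem polar_q (x y : V) : QuadraticMap.polar D.q x y = D.s x y := by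
  rw [QuadraticMap.polar, q_add]; ring

theorem q_mem {i : ℕ} (hi : i ≤ m) {x : V} (hx : x ∈ D.lattice i) : D.q x ∈ D.valueModule := by
  have h2 := two_ne (F₀ := F₀)
  induction hx using Submodule.span_induction with
  | zero => simp
  | add x y hx hy h h' => rw [q_add]; exact add_mem (add_mem h h') (D.s_mem hi hx hy)
  | smul b x hx h =>
    have hb : algebraMap (IntExt F₀ F) F b ∈ extIntegers F₀ F := b.2
    obtain ⟨n, hn⟩ := D.exists_of_σ_eq
      (x := algebraMap (IntExt F₀ F) F b * D.σ (algebraMap (IntExt F₀ F) F b))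
      (by rw [map_mul, D.σ_σ, mul_comm])
    have hnm : n ∈ baseIntegers F₀ := mem_baseIntegers_of_mem_extIntegers (F := F) (by
      rw [hn]; exact mul_mem hb (equiv_mem_extIntegers D.σ hb))
    have : D.q (b • x) = (show IntBase F₀ from ⟨n, hnm⟩) • D.q x := by
      have h1 : D.h (b • x) (b • x) = n • D.h x x := by
        rw [smul_coe, LinearMap.map_smulₛₗ, D.h.map_smul, LinearMap.smul_apply, smul_eq_mul,
          smul_eq_mul, Algebra.smul_def n (D.h x x), hn, RingHom.coe_coe]
        ring
      have h3 : (show IntBase F₀ from ⟨n, hnm⟩) • D.q x = n * D.q x := rfl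
      rw [h3, q_apply, q_apply, s_apply, s_apply, h1, map_smul, smul_eq_mul]
      ring
    rw [this]
    exact Submodule.smul_mem _ _ h
  | mem x hx =>
    obtain ⟨j, rfl⟩ := hx
    change D.q (D.latticeCoeff i j • D.e j) ∈ _
    rw [q_apply, s_apply, h_gen]
    split_ifs with hj
    · have hjm : (j : ℕ) = m := by
        have := congrArg Fin.val hj
        rw [Fin.val_rev] at this
        omega
      have hc : D.latticeCoeff i j = 1 := by
        unfold latticeCoeff
        rw [if_neg (by omega), if_pos (by omega)]
      have ht : Algebra.trace F₀ F 1 = 2 := by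
        have := Algebra.trace_algebraMap (S := F) (1 : F₀)
        rw [map_one, D.finrank_eq] at this
        rw [this]; norm_num
      rw [hc, map_one, mul_one, ht]
      have : (2⁻¹ : F₀) * (D.ε⁻¹ * 2) = D.ε⁻¹ * 1 := by field_simp
      rw [this]
      exact D.mem_valueModule (one_mem _)
    · simp

/-- The `𝓛`-valued quadratic form `q` on `Λᵢ`. -/
noncomputable def latticeQ (i : ℕ) (hi : i ≤ m) :
    QuadraticMap (IntBase F₀) (D.lattice i) D.valueModule :=
  QuadraticMap.ofPolar (fun x => ⟨D.q x, D.q_mem hi x.2⟩)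
    (fun a x => Subtype.ext <| by
      have h := QuadraticMap.map_smul D.q (algebraMap (IntBase F₀) F₀ a) (x : V)
      rw [smul_eq_mul, ← map_mul, ← Algebra.smul_def] at h
      exact h)
    (fun x x' y => Subtype.ext <| by
      change QuadraticMap.polar D.q (x + x' : V) (y : V) =
        QuadraticMap.polar D.q (x : V) (y : V) + QuadraticMap.polar D.q (x' : V) (y : V)
      exact QuadraticMap.polar_add_left D.q _ _ _)
    (fun a x y => Subtype.ext <| by
      change QuadraticMap.polar D.q (algebraMap (IntBase F₀) F₀ a • (x : V)) (y : V) =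
        algebraMap (IntBase F₀) F₀ a • QuadraticMap.polar D.q (x : V) (y : V)
      exact QuadraticMap.polar_smul_left D.q _ _ _)

theorem coe_latticeQ (i : ℕ) (hi : i ≤ m) (x : D.lattice i) :
    (D.latticeQ i hi x : F₀) = D.q (x : V) := rfl

/-- The `𝓛`-valued bilinear form `φ` on `Λ₀`. -/
noncomputable def latticeφ : LinearMap.BilinMap (IntBase F₀) (D.lattice 0) D.valueModule :=
  LinearMap.mk₂ (IntBase F₀) (fun x y => ⟨D.φ x y, D.φ_mem x.2 y.2⟩)
    (fun x x' y => Subtype.ext (LinearMap.map_add₂ D.φ (x : V) x' y))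
    (fun a x y => Subtype.ext (LinearMap.map_smul₂ D.φ (algebraMap (IntBase F₀) F₀ a) (x : V) y))
    (fun x y y' => Subtype.ext (map_add (D.φ (x : V)) (y : V) y'))
    (fun a x y => Subtype.ext (map_smul (D.φ (x : V)) (algebraMap (IntBase F₀) F₀ a) (y : V)))

theorem coe_latticeφ (x y : D.lattice 0) : (D.latticeφ x y : F₀) = D.φ (x : V) y := rfl

/-- The inclusion `Λᵢ → V`. -/
noncomputable def latticeIncl (i : ℕ) : D.lattice i →ₗ[IntBase F₀] V :=
  (D.lattice i).subtype.restrictScalars (IntBase F₀)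

end

section
variable {F₀ F V : Type u} [Field F₀] [Algebra ℚ_[2] F₀] [FiniteDimensional ℚ_[2] F₀]
  [Field F] [Algebra F₀ F] [AddCommGroup V] [Module F₀ V] [Module F V] [IsScalarTower F₀ F V]
  {m : ℕ} (D : SplitHermitianDatum F₀ F V m)

/-- The functor `Sim(Λₘ, q, 𝓛)` on `O_{F₀}`-algebras. -/
noncomputable abbrev simLatticeM : CommAlgCat.{u} (IntBase F₀) ⥤ GrpCat.{u} :=
  simFunctor (IntExt F₀ F) (D.latticeQ m le_rfl)

/-- The functor `Sim(Λ₀, q, 𝓛, φ)` on `O_{F₀}`-algebras. -/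
noncomputable abbrev simLatticeZero : CommAlgCat.{u} (IntBase F₀) ⥤ GrpCat.{u} :=
  simPreservingFunctor (IntExt F₀ F) (D.latticeQ 0 (Nat.zero_le m)) D.latticeφ

/-- The functor `GU(V, h)` on `F₀`-algebras. -/
noncomputable abbrev unitarySimilitudes : CommAlgCat.{u} F₀ ⥤ GrpCat.{u} :=
  guFunctor D.hBilin

end

end SplitHermitianDatum

end UnitarySimilitude

/-! Both functors are instances of one construction: similitudes of a lattice Λ with its quadratic
form q which also scale an auxiliary bilinear form b by the same γ. For Λₘ, b is the polar form s of
q, which similitudes preserve anyway; for Λ₀, b is φ. In both cases b = ε⁻¹ Tr(w h), with w = 1 or w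
= (σ π)⁻¹.

Representability is elementary. Λ and 𝓛 are free of finite rank over the noetherian ring O_{F₀}, so
a similitude together with its inverse is a tuple of matrix entries satisfying polynomial equations,
and the coordinate ring H is finitely presented. Yoneda makes Spec H a group scheme. Over an
F₀-algebra q and b are linear functions of h, while h is recovered from s(x, y) and s(x, π y)
because π ≠ σ π (`exists_h_eq`). The multiplier γ is determined by the automorphism, since
q(e_{m+1}) generates 𝓛. Hence the generic fiber is GU(V, h).

The substance is smoothness, where one cannot divide by 2. Let I² = 0 and let a similitude be given
over R/I. Lift it to an O_F ⊗ R-linear map g and a unit γ. The errors Q ∘ g - γ Q and b(g, g) - γ b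
have values in I and satisfy the same identities as (Q, b), those of `IsHermitianPair`. Therefore
they vanish as soon as they vanish on Q(fᵢ) and, for one of the two orders of each pair i ≠ j, on
b(fᵢ, fⱼ) and b(fᵢ, π fⱼ), where the fᵢ generate Λ over O_F. Every fᵢ except the middle one f_o has
dual vectors for the functionals b(fₖ, ·) and b(fₖ, π ·), so its errors are removed by replacing g
by g(1 + η). The remaining error in Q(f_o) is absorbed into γ, as Q(f_o) = 1. Putting f_o last among
the generators ensures that no vector dual to f_o is needed (`IsHermitianPair.exists_deformation`).

The dual vectors exist because of the choice of lattices and forms: on a pair e_j, e_{n+1-j} with j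
off the middle, b is the form Tr(κ x σ(y)) up to ε⁻¹, where κ lies in the inverse different and Tr(κ
σ π) = ± 1. Its Gram determinant is then ± 1 modulo π₀ (`exists_dual_basis`). -/

namespace UnitarySimilitude

/-! ### Affine group schemes from corepresentable group functors -/

section GroupScheme

open MonObj

/-- The presheaf of groups `T ↦ F(Γ(T))` on schemes over `Spec A`. -/
noncomputable def globalPresheaf {A : CommRingCat.{u}} (F : CommAlgCat.{u} A ⥤ GrpCat.{u}) :
    (Over (Spec A))ᵒᵖ ⥤ GrpCat.{u} :=
  (algΓ A).leftOp ⋙ F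

/-- By the adjunction between global sections and Spec, a morphism X → Spec H over Spec A is an
algebra map H → Γ(X), that is, an element of F(Γ(X)). -/
noncomputable def globalPresheafRepresentableBy {A : CommRingCat.{u}}
    (F : CommAlgCat.{u} A ⥤ GrpCat.{u})
    {H : CommAlgCat.{u} A} (ρ : (F ⋙ forget GrpCat).CorepresentableBy H) :
    (globalPresheaf F ⋙ forget _).RepresentableBy ((algSpec A).obj (op H)) where
  homEquiv {X} := ((algΓAlgSpecAdjunction A).homEquiv X (op H)).symm.trans
    ((opEquiv _ _).trans ρ.homEquiv)
  homEquiv_comp f g := by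
    simp only [Equiv.trans_apply, Adjunction.homEquiv_naturality_left_symm]
    exact ρ.homEquiv_comp _ _

/-- The counit of the adjunction between global sections and `Spec`. -/
noncomputable def algSpecΓIso (A : CommRingCat.{u}) :
    (algSpec A).rightOp ⋙ (algΓ A).leftOp ≅ 𝟭 (CommAlgCat.{u} A) :=
  NatIso.ofComponents
    (fun R => ((asIso ((algΓAlgSpecAdjunction A).counit.app (op R))).unop).symm)
    (fun {R S} f => by
      have := (algΓAlgSpecAdjunction A).counit.naturality f.op
      have h := congrArg Quiver.Hom.unop this
      dsimp at h ⊢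
      rw [Iso.eq_inv_comp, ← Category.assoc, Iso.comp_inv_eq]
      exact h)

/-- The group structure on `Spec H` given by a group functor corepresented by `H`. -/
noncomputable abbrev specGrpObj {A : CommRingCat.{u}}
    (F : CommAlgCat.{u} A ⥤ GrpCat.{u})
    {H : CommAlgCat.{u} A} (ρ : (F ⋙ forget GrpCat).CorepresentableBy H) :
    GrpObj ((algSpec A).obj (op H)) :=
  GrpObj.ofRepresentableBy _ _ (globalPresheafRepresentableBy F ρ)

/-- If `H` corepresents `F`, then the functor of points of `Spec H` is `F`. -/
noncomputable def pointsFunctorSpecIso {A : CommRingCat.{u}} (F : CommAlgCat.{u} A ⥤ GrpCat.{u})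
    {H : CommAlgCat.{u} A} (ρ : (F ⋙ forget GrpCat).CorepresentableBy H) :
    letI := specGrpObj F ρ
    pointsFunctor ((algSpec A).obj (op H)) ≅ F :=
  letI := specGrpObj F ρ
  Functor.isoWhiskerLeft (algSpec A).rightOp
      (yonedaGrpObjIsoOfRepresentableBy _ _ (globalPresheafRepresentableBy F ρ)) ≪≫
    (Functor.associator _ _ F).symm ≪≫ Functor.isoWhiskerRight (algSpecΓIso A) F ≪≫
    F.leftUnitor

/-! ### Points of the base change -/

section BaseChange

variable {A K : Type u} [CommRing A] [CommRing K] [Algebra A K] {G : Over (Spec (.of A))}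

/-- Universal property of the fiber product: the component of a point in Spec K is forced to be the
structure map, so only the component in G is free. -/
theorem restrictPoint_bijective {R : Type u} [CommRing R] [Algebra A R]
    [Algebra K R] [IsScalarTower A K R] :
    Function.Bijective (restrictPoint (A := A) (K := K) (G := G) (R := R)) := by
  constructor
  · intro p p' h
    refine Over.OverMorphism.ext (Limits.pullback.hom_ext ?_ ?_)
    · exact congrArg CommaMorphism.left h
    · exact (Over.w p).trans (Over.w p').symm
  · intro r
    refine ⟨Over.homMk (Limits.pullback.lift r.left
      (Spec.map (CommRingCat.ofHom (algebraMap K R))) ?_) ?_, ?_⟩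
    · have he : Spec.map (CommRingCat.ofHom (algebraMap K R)) ≫
          Spec.map (CommRingCat.ofHom (algebraMap A K)) =
            Spec.map (CommRingCat.ofHom (algebraMap A R)) := by
        rw [← Spec.map_comp, ← CommRingCat.ofHom_comp, ← IsScalarTower.algebraMap_eq]
      exact (Over.w r).trans he.symm
    · exact Limits.pullback.lift_snd _ _ _
    · exact Over.OverMorphism.ext (Limits.pullback.lift_fst _ _ _)

theorem restrictPoint_comp {R S : Type u} [CommRing R] [Algebra A R]
    [Algebra K R] [IsScalarTower A K R] [CommRing S] [Algebra A S]
    [Algebra K S] [IsScalarTower A K S] (f : R →ₐ[K] S)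
    (p : (algSpec (.of K)).obj (op (.of K R)) ⟶ baseChangeScheme A K G) :
    restrictPoint ((algSpec (.of K)).map (CommAlgCat.ofHom f).op ≫ p) =
      (algSpec (.of A)).map (CommAlgCat.ofHom (f.restrictScalars A)).op ≫ restrictPoint p :=
  Over.OverMorphism.ext (Category.assoc _ _ _)

theorem restrictPoint_map {G' : Over (Spec (.of A))} (g : G ⟶ G') {R : Type u} [CommRing R]
    [Algebra A R] [Algebra K R] [IsScalarTower A K R]
    (p : (algSpec (.of K)).obj (op (.of K R)) ⟶ baseChangeScheme A K G) :
    restrictPoint (p ≫ (Over.pullback _).map g) = restrictPoint p ≫ g := by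
  refine Over.OverMorphism.ext ?_
  change (p.left ≫ Limits.pullback.lift _ _ _) ≫ Limits.pullback.fst _ _ =
    (p.left ≫ Limits.pullback.fst _ _) ≫ g.left
  rw [Category.assoc, Limits.pullback.lift_fst, Category.assoc]

-- The multiplication of the base change is the image of `μ` under the pullback functor, precomposed
-- with its monoidal structure map. Naturality of `restrictPoint` in G, applied to `μ` and to the
-- two projections, then gives the claim.
open CartesianMonoidalCategory in
theorem restrictPoint_mul [GrpObj G] {R : Type u} [CommRing R] [Algebra A R]
    [Algebra K R] [IsScalarTower A K R]
    (p p' : (algSpec (.of K)).obj (op (.of K R)) ⟶ baseChangeScheme A K G) :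
    restrictPoint (p * p') = restrictPoint p * restrictPoint p' := by
  have h : p * p' = (lift p p' ≫ Functor.LaxMonoidal.μ (Over.pullback _) G G) ≫
      (Over.pullback _).map μ := by
    rw [Category.assoc]; rfl
  rw [h, restrictPoint_map, Hom.mul_def]
  congr 1
  ext1
  · rw [lift_fst, ← restrictPoint_map, Category.assoc, Functor.Monoidal.μ_fst, lift_fst]
  · rw [lift_snd, ← restrictPoint_map, Category.assoc, Functor.Monoidal.μ_snd, lift_snd]

variable [GrpObj G]

/-- Let `G` represent `F` and let `T` be the restriction of `F` to `K`-algebras (through `τ`); then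
the base change of `G` to `K` represents `T`. -/
theorem exists_pointsFunctor_baseChange_iso {F : CommAlgCat.{u} A ⥤ GrpCat.{u}}
    (α : pointsFunctor G ≅ F) {T : CommAlgCat.{u} K ⥤ GrpCat.{u}}
    (τ : ∀ (R : Type u) [CommRing R] [Algebra A R] [Algebra K R] [IsScalarTower A K R],
      F.obj (.of A R) ≃* T.obj (.of K R))
    (hτ : ∀ (R S : Type u) [CommRing R] [Algebra A R] [Algebra K R] [IsScalarTower A K R]
      [CommRing S] [Algebra A S] [Algebra K S] [IsScalarTower A K S] (f : R →ₐ[K] S)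
      (x : F.obj (.of A R)), T.map (CommAlgCat.ofHom f) (τ R x) =
        τ S (F.map (CommAlgCat.ofHom (f.restrictScalars A)) x)) :
    ∃ β : pointsFunctor (baseChangeScheme A K G) ≅ T,
      ∀ (R : Type u) [CommRing R] [Algebra A R] [Algebra K R] [IsScalarTower A K R]
      (p : (algSpec (.of K)).obj (op (.of K R)) ⟶ baseChangeScheme A K G),
      β.hom.app (.of K R) p = τ R (α.hom.app (.of A R) (restrictPoint p)) := by
  -- A bare K-algebra is made an A-algebra by composition; the last step shows that any compatible
  -- A-algebra structure equals this one.
  let (R : CommAlgCat.{u} K) : Algebra A R := Algebra.compHom R (algebraMap A K)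
  have (R : CommAlgCat.{u} K) : IsScalarTower A K R := .of_algebraMap_eq fun _ => rfl
  let e (R : CommAlgCat.{u} K) :
      (pointsFunctor (baseChangeScheme A K G)).obj R ≃* T.obj R :=
    (MulEquiv.ofBijective (MulHom.mk (restrictPoint (G := G) (R := R)) restrictPoint_mul)
      restrictPoint_bijective).trans
      (((α.app (.of A R)).groupIsoToMulEquiv).trans (τ R))
  refine ⟨NatIso.ofComponents (fun R => (e R).toGrpIso) ?_, ?_⟩
  · intro R S f
    refine GrpCat.hom_ext (MonoidHom.ext fun p => ?_)
    change τ S (α.hom.app (.of A S) (restrictPoint (R := S) ((algSpec (.of K)).map f.op ≫ p))) =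
      T.map f (τ R (α.hom.app (.of A R) (restrictPoint p)))
    refine Eq.trans ?_ (hτ R S f.hom _).symm
    congr 1
    have h := restrictPoint_comp f.hom p
    refine (congrArg (fun z => α.hom.app (.of A S) z) h).trans ?_
    exact ConcreteCategory.congr_hom
      (α.hom.naturality (CommAlgCat.ofHom (f.hom.restrictScalars A))) (restrictPoint p)
  · intro R _ inst _ _ p
    have : inst = Algebra.compHom R (algebraMap A K) :=
      Algebra.algebra_ext _ _ fun r => IsScalarTower.algebraMap_apply A K R r
    subst this
    rfl

end BaseChange

end GroupScheme

/-- A group functor `F` on `A`-algebras which is corepresented by a smooth algebra is represented by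
a smooth affine group scheme `G`; if `F` restricts to `T` on `K`-algebras, compatibly with the
actions on `M` and `V`, then the generic fiber of `G` represents `T`, compatibly. -/
theorem exists_smooth_affine_groupScheme {A K M V : Type u} [CommRing A] [CommRing K] [Algebra A K]
    [AddCommGroup M] [Module A M] [AddCommGroup V] [Module A V] [Module K V] [IsScalarTower A K V]
    (i : M →ₗ[A] V) {F : CommAlgCat.{u} A ⥤ GrpCat.{u}} {H : CommAlgCat.{u} A}
    (ρ : (F ⋙ forget GrpCat).CorepresentableBy H) [Algebra.Smooth A H]
    {T : CommAlgCat.{u} K ⥤ GrpCat.{u}}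
    (a : ∀ R : CommAlgCat.{u} A, F.obj R → LinearMap.GeneralLinearGroup R (R ⊗[A] M))
    (b : ∀ R : CommAlgCat.{u} K, T.obj R → LinearMap.GeneralLinearGroup R (R ⊗[K] V))
    (τ : ∀ (R : Type u) [CommRing R] [Algebra A R] [Algebra K R] [IsScalarTower A K R],
      F.obj (.of A R) ≃* T.obj (.of K R))
    (hτ : ∀ (R S : Type u) [CommRing R] [Algebra A R] [Algebra K R] [IsScalarTower A K R]
      [CommRing S] [Algebra A S] [Algebra K S] [IsScalarTower A K S] (f : R →ₐ[K] S)
      (x : F.obj (.of A R)), T.map (CommAlgCat.ofHom f) (τ R x) =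
        τ S (F.map (CommAlgCat.ofHom (f.restrictScalars A)) x))
    (hab : ∀ (R : Type u) [CommRing R] [Algebra A R] [Algebra K R] [IsScalarTower A K R]
      (g : F.obj (.of A R)) (x : R ⊗[A] M),
      (b (.of K R) (τ R g)).val (compareMap i R x) = compareMap i R ((a (.of A R) g).val x)) :
    ∃ (G : Over (Spec (.of A))) (_ : GrpObj G), IsAffine G.left ∧ Smooth G.hom ∧
      ∃ (α : pointsFunctor G ≅ F) (β : pointsFunctor (baseChangeScheme A K G) ≅ T),
        GenericCompatible i a b α β := by
  let _ := specGrpObj (A := .of A) F ρ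
  obtain ⟨β, hβ⟩ := exists_pointsFunctor_baseChange_iso (pointsFunctorSpecIso (A := .of A) F ρ) τ hτ
  refine ⟨(algSpec (.of A)).obj (op H), specGrpObj (A := .of A) F ρ, ?_, ?_,
    pointsFunctorSpecIso (A := .of A) F ρ, β, ?_⟩
  · exact inferInstanceAs (IsAffine (Spec (.of H)))
  · have h : Smooth (Spec.map (CommRingCat.ofHom (algebraMap A H))) :=
      (HasRingHomProperty.Spec_iff (P := @Smooth)).2 (RingHom.smooth_algebraMap.2 ‹_›)
    exact h
  · intro R _ _ _ _ p x
    rw [hβ]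
    exact hab R _ x


/-! ### Similitude functors are cut out by polynomial equations -/

section Corepresentable

variable {A : Type u} [CommRing A] {σ : Type}

/-- A condition on points `v : σ → R` of affine space which is given by polynomial equations. -/
def IsClosedCondition (P : ∀ R : CommAlgCat.{u} A, (σ → R) → Prop) : Prop :=
  ∃ E : Set (MvPolynomial σ A), ∀ R v, P R v ↔ ∀ p ∈ E, MvPolynomial.aeval v p = 0

theorem IsClosedCondition.and {P Q : ∀ R : CommAlgCat.{u} A, (σ → R) → Prop}
    (hP : IsClosedCondition P) (hQ : IsClosedCondition Q) :
    IsClosedCondition fun R v => P R v ∧ Q R v := by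
  obtain ⟨E, hE⟩ := hP
  obtain ⟨E', hE'⟩ := hQ
  refine ⟨E ∪ E', fun R v => ?_⟩
  simp only [hE, hE', Set.mem_union, or_imp, forall_and]

theorem IsClosedCondition.forall {ι : Type*} {P : ι → ∀ R : CommAlgCat.{u} A, (σ → R) → Prop}
    (hP : ∀ i, IsClosedCondition (P i)) : IsClosedCondition fun R v => ∀ i, P i R v := by
  choose E hE using hP
  refine ⟨⋃ i, E i, fun R v => ?_⟩
  simp only [hE, Set.mem_iUnion]
  exact ⟨fun h p ⟨i, hi⟩ => h i p hi, fun h i p hi => h p ⟨i, hi⟩⟩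

theorem baseChange_repr_changeRing {R S N κ : Type*} [CommRing R] [CommRing S] [Algebra A R]
    [Algebra A S] [AddCommGroup N] [Module A N] (b : Module.Basis κ A N) (f : R →ₐ[A] S)
    (x : R ⊗[A] N) (k : κ) :
    (b.baseChange S).repr (changeRing f N x) k = f ((b.baseChange R).repr x k) := by
  induction x with
  | zero => simp
  | tmul r n => simp [Algebra.smul_def]
  | add x y hx hy => simp [hx, hy]

/-- An equality between natural vector-valued functions is a closed condition. -/
theorem IsClosedCondition.eq {N : Type*} {κ : Type*} [AddCommGroup N] [Module A N]
    (b : Module.Basis κ A N)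
    {e e' : ∀ R : CommAlgCat.{u} A, (σ → R) → R ⊗[A] N}
    (he : ∀ (R S : CommAlgCat.{u} A) (f : R →ₐ[A] S) (v : σ → R),
      e S (f ∘ v) = changeRing f N (e R v))
    (he' : ∀ (R S : CommAlgCat.{u} A) (f : R →ₐ[A] S) (v : σ → R),
      e' S (f ∘ v) = changeRing f N (e' R v)) :
    IsClosedCondition fun R v => e R v = e' R v := by
  let U : CommAlgCat.{u} A := .of A (MvPolynomial σ A)
  -- The equations are the coordinates of e - e' at the generic point, the tuple of variables over
  -- the polynomial ring; naturality specialises them to an arbitrary v.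
  refine ⟨Set.range fun k => (b.baseChange U).repr (e U MvPolynomial.X - e' U MvPolynomial.X) k,
    fun R v => ?_⟩
  have h : (MvPolynomial.aeval v : U →ₐ[A] R) ∘ MvPolynomial.X = v :=
    funext fun s => MvPolynomial.aeval_X _ _
  have h1 := he U R (MvPolynomial.aeval v) MvPolynomial.X
  have h2 := he' U R (MvPolynomial.aeval v) MvPolynomial.X
  rw [h] at h1 h2
  change e R v = e' R v ↔ _
  rw [Set.forall_mem_range, ← sub_eq_zero, ← (b.baseChange R).repr.map_eq_zero_iff,
    Finsupp.ext_iff]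
  refine forall_congr' fun k => ?_
  rw [← baseChange_repr_changeRing, LinearMap.map_sub, ← h1, ← h2]
  rfl

/-- A functor cut out by equations in an affine space of finite dimension over a noetherian ring is
corepresented by a finitely presented algebra. -/
theorem exists_corepresentableBy_of_isClosedCondition [IsNoetherianRing A] [Finite σ]
    (F : CommAlgCat.{u} A ⥤ GrpCat.{u})
    (c : ∀ R : CommAlgCat.{u} A, F.obj R → σ → R) (hc : ∀ R, Function.Injective (c R))
    (hcn : ∀ (R S : CommAlgCat.{u} A) (f : R ⟶ S) (x : F.obj R), c S (F.map f x) = f.hom ∘ c R x)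
    (himg : IsClosedCondition fun (R : CommAlgCat.{u} A) v => ∃ x, c R x = v) :
    ∃ H : CommAlgCat.{u} A, Nonempty ((F ⋙ forget GrpCat).CorepresentableBy H) ∧
      Algebra.FinitePresentation A H := by
  obtain ⟨E, hE⟩ := himg
  let I : Ideal (MvPolynomial σ A) := Ideal.span E
  let H : CommAlgCat.{u} A := .of A (MvPolynomial σ A ⧸ I)
  -- An algebra map kills I exactly when the images of the variables are the coordinates of an
  -- element of F(R).
  have hI {R : CommAlgCat.{u} A} (g : MvPolynomial σ A →ₐ[A] R) :
      I ≤ RingHom.ker g ↔ ∃ x : F.obj R, c R x = g ∘ MvPolynomial.X := by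
    refine Ideal.span_le.trans (Iff.trans ?_ (hE R _).symm)
    rw [← MvPolynomial.aeval_unique]
    rfl
  have key (R : CommAlgCat.{u} A) (f : H ⟶ R) :
      ∃ x : F.obj R, c R x = (f.hom.comp (Ideal.Quotient.mkₐ A I)) ∘ MvPolynomial.X := by
    refine (hI _).1 fun a ha => ?_
    change f.hom (Ideal.Quotient.mkₐ A I a) = 0
    rw [Ideal.Quotient.mkₐ_eq_mk, Ideal.Quotient.eq_zero_iff_mem.2 ha, map_zero]
  choose x hx using key
  have hinj (R) : Function.Injective (x R) := by
    intro f g h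
    have h1 := (hx R f).symm.trans ((congrArg (c R) h).trans (hx R g))
    exact CommAlgCat.hom_ext
      (Ideal.Quotient.algHom_ext A (MvPolynomial.algHom_ext fun s => congrFun h1 s))
  have hsurj (R) : Function.Surjective (x R) := by
    intro y
    have h2 : (MvPolynomial.aeval (c R y) : MvPolynomial σ A →ₐ[A] R) ∘ MvPolynomial.X = c R y :=
      funext fun s => MvPolynomial.aeval_X _ _
    refine ⟨CommAlgCat.ofHom (Ideal.Quotient.liftₐ I (MvPolynomial.aeval (c R y))
      fun a ha => (hI (MvPolynomial.aeval (c R y))).2 ⟨y, h2.symm⟩ ha), hc R ?_⟩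
    rw [hx]
    exact h2
  refine ⟨H, ⟨⟨fun {R} => Equiv.ofBijective (x R) ⟨hinj R, hsurj R⟩, fun {R S} g f => ?_⟩⟩, ?_⟩
  · refine hc S ?_
    change c S (x S (f ≫ g)) = c S (F.map g (x R f))
    rw [hx, hcn, hx]
    rfl
  · exact Algebra.FinitePresentation.quotient (IsNoetherian.noetherian I)

/-- The endomorphism of `R ⊗ N` with given matrix entries. -/
noncomputable def endOfEntries {N κ : Type*} [Fintype κ] [DecidableEq κ] [AddCommGroup N]
    [Module A N] (b : Module.Basis κ A N) {R : Type*} [CommRing R] [Algebra A R] (v : κ × κ → R) :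
    Module.End R (R ⊗[A] N) :=
  Matrix.toLin (b.baseChange R) (b.baseChange R) (Matrix.of fun i j => v (i, j))

section
variable {N κ : Type*} [Fintype κ] [DecidableEq κ] [AddCommGroup N]
    [Module A N] (b : Module.Basis κ A N) {R S : Type*} [CommRing R] [Algebra A R]
    [CommRing S] [Algebra A S]

/-- The matrix entries of an endomorphism of `R ⊗ N`. -/
noncomputable def entries (g : Module.End R (R ⊗[A] N)) (k : κ × κ) : R :=
  LinearMap.toMatrix (b.baseChange R) (b.baseChange R) g k.1 k.2

theorem endOfEntries_entries (g : Module.End R (R ⊗[A] N)) :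
    endOfEntries b (entries b g) = g :=
  Matrix.toLin_toMatrix _ _ g

theorem entries_endOfEntries (v : κ × κ → R) : entries b (endOfEntries b v) = v := by
  funext k
  exact congrFun₂ (LinearMap.toMatrix_toLin (b.baseChange R) (b.baseChange R) _) k.1 k.2

theorem entries_pushHom (f : R →ₐ[A] S) (g : Module.End R (R ⊗[A] N)) :
    entries b (pushHom f g) = f ∘ entries b g := by
  funext k
  simp only [entries, LinearMap.toMatrix_apply, Function.comp_apply]
  rw [Module.Basis.baseChange_apply, Module.Basis.baseChange_apply, pushHom_one_tmul,
    baseChange_repr_changeRing]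

theorem endOfEntries_comp (f : R →ₐ[A] S) (v : κ × κ → R) :
    endOfEntries b (f ∘ v) = pushHom f (endOfEntries b v) := by
  rw [← endOfEntries_entries b (pushHom f _), entries_pushHom, entries_endOfEntries]
end

section
variable {B M L : Type u} [CommRing B] [Algebra A B]
  [AddCommGroup M] [Module A M] [Module B M] [IsScalarTower A B M] [AddCommGroup L] [Module A L]

/-- The inverses of φ and γ receive coordinates of their own, so that invertibility becomes
polynomial. All conditions are imposed on vectors 1 ⊗ m only, an index set independent of R; this
suffices because linear, bilinear and quadratic maps on R ⊗ M are determined there. -/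
theorem exists_corepresentableBy_simPreservingFunctor [IsNoetherianRing A] {κ κ' : Type}
    [Finite κ] [Finite κ'] (bM : Module.Basis κ A M) (bL : Module.Basis κ' A L)
    (q : QuadraticMap A M L) (b : LinearMap.BilinMap A M L) :
    ∃ H : CommAlgCat.{u} A,
      Nonempty ((simPreservingFunctor B q b ⋙ forget GrpCat).CorepresentableBy H) ∧
      Algebra.FinitePresentation A H := by
  classical
  cases nonempty_fintype κ
  cases nonempty_fintype κ'
  let σ := ((κ × κ) ⊕ (κ × κ)) ⊕ ((κ' × κ') ⊕ (κ' × κ'))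
  let X (R : CommAlgCat.{u} A) (v : σ → R) : Module.End R (R ⊗[A] M) :=
    endOfEntries bM (v ∘ .inl ∘ .inl)
  let X' (R : CommAlgCat.{u} A) (v : σ → R) : Module.End R (R ⊗[A] M) :=
    endOfEntries bM (v ∘ .inl ∘ .inr)
  let Y (R : CommAlgCat.{u} A) (v : σ → R) : Module.End R (R ⊗[A] L) :=
    endOfEntries bL (v ∘ .inr ∘ .inl)
  let Y' (R : CommAlgCat.{u} A) (v : σ → R) : Module.End R (R ⊗[A] L) :=
    endOfEntries bL (v ∘ .inr ∘ .inr)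
  have hX (R S : CommAlgCat.{u} A) (f : R →ₐ[A] S) (v : σ → R) (m : R ⊗[A] M) :
      X S (f ∘ v) (changeRing f M m) = changeRing f M (X R v m) := by
    rw [← pushHom_changeRing, ← endOfEntries_comp]; rfl
  have hX' (R S : CommAlgCat.{u} A) (f : R →ₐ[A] S) (v : σ → R) (m : R ⊗[A] M) :
      X' S (f ∘ v) (changeRing f M m) = changeRing f M (X' R v m) := by
    rw [← pushHom_changeRing, ← endOfEntries_comp]; rfl
  have hY (R S : CommAlgCat.{u} A) (f : R →ₐ[A] S) (v : σ → R) (m : R ⊗[A] L) :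
      Y S (f ∘ v) (changeRing f L m) = changeRing f L (Y R v m) := by
    rw [← pushHom_changeRing, ← endOfEntries_comp]; rfl
  have hY' (R S : CommAlgCat.{u} A) (f : R →ₐ[A] S) (v : σ → R) (m : R ⊗[A] L) :
      Y' S (f ∘ v) (changeRing f L m) = changeRing f L (Y' R v m) := by
    rw [← pushHom_changeRing, ← endOfEntries_comp]; rfl
  have h1 {N : Type u} [AddCommGroup N] [Module A N] (R S : CommAlgCat.{u} A) (f : R →ₐ[A] S)
      (n : N) : (1 : S) ⊗ₜ[A] n = changeRing f N (1 ⊗ₜ n) := by simp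
  have hclosed := ((((((IsClosedCondition.forall fun m : M => IsClosedCondition.eq bM
    (e := fun R v => X R v (X' R v (1 ⊗ₜ m))) (e' := fun R v => 1 ⊗ₜ m)
    (fun R S f v => by rw [h1 R S f, hX', hX]) (fun R S f v => h1 R S f m)).and
    (IsClosedCondition.forall fun m : M => IsClosedCondition.eq bM
    (e := fun R v => X' R v (X R v (1 ⊗ₜ m))) (e' := fun R v => 1 ⊗ₜ m)
    (fun R S f v => by rw [h1 R S f, hX, hX']) (fun R S f v => h1 R S f m))).and
    (IsClosedCondition.forall fun m : L => IsClosedCondition.eq bL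
    (e := fun R v => Y R v (Y' R v (1 ⊗ₜ m))) (e' := fun R v => 1 ⊗ₜ m)
    (fun R S f v => by rw [h1 R S f, hY', hY]) (fun R S f v => h1 R S f m))).and
    (IsClosedCondition.forall fun m : L => IsClosedCondition.eq bL
    (e := fun R v => Y' R v (Y R v (1 ⊗ₜ m))) (e' := fun R v => 1 ⊗ₜ m)
    (fun R S f v => by rw [h1 R S f, hY, hY']) (fun R S f v => h1 R S f m))).and
    (IsClosedCondition.forall fun β : B => IsClosedCondition.forall fun m : M =>
    IsClosedCondition.eq bM
    (e := fun R v => X R v (scalarAction A R M β (1 ⊗ₜ m)))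
    (e' := fun R v => scalarAction A R M β (X R v (1 ⊗ₜ m)))
    (fun R S f v => by rw [h1 R S f, scalarAction_changeRing, hX])
    (fun R S f v => by rw [h1 R S f, hX, scalarAction_changeRing]))).and
    (IsClosedCondition.forall fun m : M => IsClosedCondition.eq bL
    (e := fun R v => quadBaseChange R q (X R v (1 ⊗ₜ m)))
    (e' := fun R v => Y R v (quadBaseChange R q (1 ⊗ₜ m)))
    (fun R S f v => by rw [h1 R S f, hX, quad_changeRing])
    (fun R S f v => by rw [h1 R S f, quad_changeRing, hY]))).and
    (IsClosedCondition.forall fun m : M => IsClosedCondition.forall fun n : M =>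
    IsClosedCondition.eq bL
    (e := fun R v => LinearMap.BilinMap.baseChange R b (X R v (1 ⊗ₜ m)) (X R v (1 ⊗ₜ n)))
    (e' := fun R v => Y R v (LinearMap.BilinMap.baseChange R b (1 ⊗ₜ m) (1 ⊗ₜ n)))
    (fun R S f v => by rw [h1 R S f, h1 R S f, hX, hX, bilin_changeRing (M' := M)])
    (fun R S f v => by rw [h1 R S f, h1 R S f, bilin_changeRing (M' := M), hY]))
  refine exists_corepresentableBy_of_isClosedCondition (σ := σ) _
    (fun R g => Sum.elim (Sum.elim (entries bM g.1.1.val) (entries bM g.1.1⁻¹.val))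
      (Sum.elim (entries bL g.1.2.val) (entries bL g.1.2⁻¹.val))) ?_ ?_ ?_
  · intro R g g' h
    have hM : g.1.1.val = g'.1.1.val := by
      rw [← endOfEntries_entries bM g.1.1.val, ← endOfEntries_entries bM g'.1.1.val]
      exact congrArg _ (funext fun k => congrFun h (.inl (.inl k)))
    have hL : g.1.2.val = g'.1.2.val := by
      rw [← endOfEntries_entries bL g.1.2.val, ← endOfEntries_entries bL g'.1.2.val]
      exact congrArg _ (funext fun k => congrFun h (.inr (.inl k)))
    exact Subtype.ext (Prod.ext (Units.ext hM) (Units.ext hL))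
  · intro R S f g
    funext s
    rcases s with (k | k) | (k | k)
    · exact congrFun (entries_pushHom bM f.hom g.1.1.val) k
    · exact congrFun (entries_pushHom bM f.hom g.1.1⁻¹.val) k
    · exact congrFun (entries_pushHom bL f.hom g.1.2.val) k
    · exact congrFun (entries_pushHom bL f.hom g.1.2⁻¹.val) k
  · obtain ⟨E, hE⟩ := hclosed
    refine ⟨E, fun R v => Iff.trans ?_ (hE R v)⟩
    constructor
    · rintro ⟨g, hg⟩
      have e1 : X R v = g.1.1.val := by rw [← hg]; exact endOfEntries_entries _ _
      have e2 : X' R v = g.1.1⁻¹.val := by rw [← hg]; exact endOfEntries_entries _ _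
      have e3 : Y R v = g.1.2.val := by rw [← hg]; exact endOfEntries_entries _ _
      have e4 : Y' R v = g.1.2⁻¹.val := by rw [← hg]; exact endOfEntries_entries _ _
      rw [e1, e2, e3, e4]
      exact ⟨⟨⟨⟨⟨⟨fun m => gl_apply_inv g.1.1 _, fun m => gl_inv_apply g.1.1 _⟩,
        fun m => gl_apply_inv g.1.2 _⟩, fun m => gl_inv_apply g.1.2 _⟩,
        fun β m => g.2.1.1 β _⟩, fun m => g.2.1.2 _⟩, fun m n => g.2.2 _ _⟩
    · rintro ⟨⟨⟨⟨⟨⟨c1, c2⟩, c3⟩, c4⟩, c5⟩, c6⟩, c7⟩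
      let g1 : LinearMap.GeneralLinearGroup R (R ⊗[A] M) :=
        ⟨X R v, X' R v, hom_ext_one_tmul c1, hom_ext_one_tmul c2⟩
      let g2 : LinearMap.GeneralLinearGroup R (R ⊗[A] L) :=
        ⟨Y R v, Y' R v, hom_ext_one_tmul c3, hom_ext_one_tmul c4⟩
      refine ⟨⟨(g1, g2), ⟨fun β => ?_, fun x => ?_⟩, fun x y => ?_⟩, ?_⟩
      · exact LinearMap.congr_fun (f := X R v ∘ₗ scalarAction A R M β)
          (g := scalarAction A R M β ∘ₗ X R v) (hom_ext_one_tmul (c5 β))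
      · exact congrArg (fun Q => Q x) (baseChange_ext (Q₁ := (quadBaseChange R q).comp (X R v))
          (Q₂ := (Y R v).compQuadraticMap (quadBaseChange R q)) c6)
      · exact LinearMap.congr_fun₂ (bilin_ext_one_tmul
          (g := (LinearMap.BilinMap.baseChange R b).compl₁₂ (X R v) (X R v))
          (g' := (LinearMap.BilinMap.baseChange R b).compr₂ (Y R v)) c7) x y
      · funext s
        rcases s with (k | k) | (k | k)
        · exact congrFun (entries_endOfEntries bM _) k
        · exact congrFun (entries_endOfEntries bM _) k
        · exact congrFun (entries_endOfEntries bL _) k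
        · exact congrFun (entries_endOfEntries bL _) k
end

end Corepresentable

/-! ### Hermitian pairs and their deformation along a square-zero ideal -/

section Lifting

variable {R P N : Type*} [CommRing R] [AddCommGroup P] [Module R P] [AddCommGroup N] [Module R N]

/-- The identities between a quadratic map `Q` and a bilinear map `b` on a module over a quadratic
algebra `R[J]`, `J² = t J - n`, which hold for `q` and `s`, and for `q` and `φ`. -/
structure IsHermitianPair (J : Module.End R P) (t n τ τ' μ₀ μ₁ : R) (Q : QuadraticMap R P N)
    (b : LinearMap.BilinMap R P N) : Prop where
  quad : ∀ x, Q (J x) = n • Q x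
  adj : ∀ x y, b (J x) y = b x (t • y - J y)
  polar : ∀ x y, QuadraticMap.polar Q x y = b x (μ₀ • y + μ₁ • J y)
  diag : ∀ x, b x x = τ • Q x
  diag_apply : ∀ x, b x (J x) = τ' • Q x

namespace IsHermitianPair

variable {J : Module.End R P} {t n τ τ' μ₀ μ₁ : R} {Q : QuadraticMap R P N}
  {b : LinearMap.BilinMap R P N}

theorem map_add (h : IsHermitianPair J t n τ τ' μ₀ μ₁ Q b) (x y : P) :
    Q (x + y) = Q x + Q y + b x (μ₀ • y + μ₁ • J y) := by
  rw [← h.polar, QuadraticMap.polar]; abel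

/-- Polarise b(x, x) = τ Q(x) and express the polar form of Q through b. Together with `skew_apply`,
the polarisation of b(x, J x) = τ' Q(x), this takes the place of symmetry, which a form such as φ
need not have. -/
theorem skew (h : IsHermitianPair J t n τ τ' μ₀ μ₁ Q b) (x y : P) :
    b y x = τ • b x (μ₀ • y + μ₁ • J y) - b x y := by
  have h1 := h.diag (x + y)
  rw [h.map_add, smul_add, smul_add, ← h.diag, ← h.diag] at h1
  simp only [_root_.map_add, LinearMap.add_apply, smul_add] at h1 ⊢
  rw [← sub_eq_zero] at h1 ⊢
  rw [← h1]
  abel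

theorem skew_apply (h : IsHermitianPair J t n τ τ' μ₀ μ₁ Q b) (x y : P) :
    b y (J x) = τ' • b x (μ₀ • y + μ₁ • J y) - b x (J y) := by
  have h1 := h.diag_apply (x + y)
  rw [h.map_add, smul_add, smul_add, ← h.diag_apply, ← h.diag_apply] at h1
  simp only [_root_.map_add, LinearMap.add_apply, smul_add] at h1 ⊢
  rw [← sub_eq_zero] at h1 ⊢
  rw [← h1]
  abel

/-- The identities are linear in (Q, b) and survive pullback along a map commuting with J, so the
failure of g to be a similitude with multiplier c is itself a hermitian pair, to which `eq_zero`
applies. -/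
theorem sub_smul (h : IsHermitianPair J t n τ τ' μ₀ μ₁ Q b) {g : Module.End R P}
    (hg : ∀ x, g (J x) = J (g x)) (c : R) :
    IsHermitianPair J t n τ τ' μ₀ μ₁ (Q.comp g - c • Q) (b.compl₁₂ g g - c • b) where
  quad x := by simp [hg, h.quad, smul_sub, smul_comm c n]
  adj x y := by simp [hg, h.adj]
  polar x y := by
    have e : QuadraticMap.polar (Q.comp g - c • Q) x y =
        QuadraticMap.polar Q (g x) (g y) - c • QuadraticMap.polar Q x y := by
      simp only [QuadraticMap.polar, _root_.sub_apply, QuadraticMap.comp_apply,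
        _root_.smul_apply, _root_.map_add, smul_sub]
      abel
    rw [e, h.polar, h.polar]
    simp [hg]
  diag x := by simp [h.diag, smul_sub, smul_comm c τ]
  diag_apply x := by simp [hg, h.diag_apply, smul_sub, smul_comm c τ']

/-- A hermitian pair is determined by its values on generators. -/
theorem eq_zero (h : IsHermitianPair J t n τ τ' μ₀ μ₁ Q b) {ι : Type*} {f : ι → P}
    (hf : Submodule.span R (Set.range f ∪ Set.range (J ∘ f)) = ⊤) {r : ι → ι → Prop}
    (hr : ∀ i j, i ≠ j → r i j ∨ r j i) (hQ : ∀ i, Q (f i) = 0)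
    (hb : ∀ i j, r i j → b (f i) (f j) = 0 ∧ b (f i) (J (f j)) = 0) : Q = 0 ∧ b = 0 := by
  -- Diagonal values are multiples of `Q (f i)`; of two opposite pairs one is covered by `hb` and
  -- the other follows from it by skewness.
  have hall (i j) : b (f i) (f j) = 0 ∧ b (f i) (J (f j)) = 0 := by
    by_cases hij : i = j
    · subst hij
      rw [h.diag, h.diag_apply, hQ, smul_zero, smul_zero]
      exact ⟨rfl, rfl⟩
    rcases hr i j hij with h1 | h1
    · exact hb i j h1
    · obtain ⟨h2, h3⟩ := hb j i h1
      rw [h.skew (f j), h.skew_apply (f j)]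
      simp [h2, h3]
  have hfi (i) : b (f i) = 0 := by
    refine LinearMap.ext_on hf ?_
    rintro _ (⟨j, rfl⟩ | ⟨j, rfl⟩)
    · exact (hall i j).1
    · exact (hall i j).2
  have hb0 : b = 0 := by
    refine LinearMap.ext_on hf ?_
    rintro _ (⟨i, rfl⟩ | ⟨i, rfl⟩)
    · exact hfi i
    · refine LinearMap.ext fun y => ?_
      rw [Function.comp_apply, h.adj, hfi]
      rfl
  refine ⟨QuadraticMap.ext fun x => ?_, hb0⟩
  have hx : x ∈ Submodule.span R (Set.range f ∪ Set.range (J ∘ f)) := hf ▸ Submodule.mem_top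
  induction hx using Submodule.span_induction with
  | zero => simp
  | add x y _ _ hx hy => rw [h.map_add, hx, hy, hb0]; simp
  | smul a x _ hx => rw [QuadraticMap.map_smul, hx]; simp
  | mem x hx =>
    rcases hx with ⟨i, rfl⟩ | ⟨i, rfl⟩
    · exact hQ i
    · rw [Function.comp_apply, h.quad, hQ, smul_zero]; rfl

end IsHermitianPair

/-- A similitude modulo an ideal `I` of square zero of a hermitian pair, which is nondegenerate up
to one basis vector `f o` with `Q (f o) = 1`, can be deformed to a similitude. -/
theorem IsHermitianPair.exists_deformation {J : Module.End R P} {t n τ τ' μ₀ μ₁ : R}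
    {Q : QuadraticMap R P R} {b : LinearMap.BilinMap R P R}
    (h : IsHermitianPair J t n τ τ' μ₀ μ₁ Q b) (hJ : ∀ x, J (J x) = t • J x - n • x)
    {ι : Type*} [Fintype ι] [DecidableEq ι] (F : Module.Basis (ι ⊕ ι) R P) {f : ι → P}
    (hFl : ∀ i, F (.inl i) = f i) (hFr : ∀ i, F (.inr i) = J (f i))
    {o : ι} {r : ι → ι → Prop} [DecidableRel r] (hr : ∀ i j, i ≠ j → r i j ∨ r j i)
    (hr' : ∀ i j, r i j → ¬ r j i) (hro : ∀ j, ¬ r o j)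
    {z w : ι → P} (hz : ∀ i, i ≠ o → ∀ k, b (f k) (z i) = if k = i then 1 else 0)
    (hz' : ∀ i, i ≠ o → ∀ k, b (f k) (J (z i)) = 0)
    (hw : ∀ i, i ≠ o → ∀ k, b (f k) (w i) = 0)
    (hw' : ∀ i, i ≠ o → ∀ k, b (f k) (J (w i)) = if k = i then 1 else 0)
    (ho : Q (f o) = 1) {a₀ a₁ : R} (ha : a₀ * μ₀ + a₁ * μ₁ = 1)
    {I : Ideal R} (hI : I ^ 2 = ⊥) {g : Module.End R P} (hg : ∀ x, g (J x) = J (g x))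
    {γ γ' : R} (hγ : γ * γ' = 1) (hgQ : ∀ x, Q (g x) - γ * Q x ∈ I)
    (hgb : ∀ x y, b (g x) (g y) - γ * b x y ∈ I) :
    ∃ (η : Module.End R P) (c : R), c ∈ I ∧ (∀ x, η x ∈ I • (⊤ : Submodule R P)) ∧
      (∀ x, η (J x) = J (η x)) ∧ (∀ x, Q (g (x + η x)) = γ * (1 + c) * Q x) ∧
      ∀ x y, b (g (x + η x)) (g (y + η y)) = γ * (1 + c) * b x y := by
  have hI0 {x y : R} (hx : x ∈ I) (hy : y ∈ I) : x * y = 0 := by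
    have := Ideal.mul_mem_mul hx hy
    rwa [← pow_two, hI] at this
  have hr_ne (i j) (hij : r i j) : i ≠ j := by
    rintro rfl; exact hr' _ _ hij hij
  -- There is no dual vector at o. Since `Q (f o) = 1`, changing γ to γ (1 + c) absorbs the error of
  -- `Q (f o)` instead.
  set c := γ' * (Q (g (f o)) - γ * Q (f o)) with hc
  have hcI : c ∈ I := I.mul_mem_left _ (hgQ _)
  -- `d` and `e` are what the correction η must add to Q and b, measured before applying g, to reach
  -- the new multiplier.
  let d (j : ι) : R := c * Q (f j) - γ' * (Q (g (f j)) - γ * Q (f j))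
  let e (x y : P) : R := c * b x y - γ' * (b (g x) (g y) - γ * b x y)
  have hd (j) : d j ∈ I := sub_mem (I.mul_mem_right _ hcI) (I.mul_mem_left _ (hgQ _))
  have he (x y) : e x y ∈ I := sub_mem (I.mul_mem_right _ hcI) (I.mul_mem_left _ (hgb _ _))
  have hdo : d o = 0 := by simp only [d, hc, ho]; ring
  -- `u i j` and `v i j` prescribe `b (f i)` at `y j` and at `J (y j)`. For a pair with `r i j` the
  -- whole correction goes into `y j`; on the diagonal the weights a₀, a₁ make μ₀ u + μ₁ v equal to
  -- `d j`. The row i = o vanishes, because `d o = 0` and o never comes first in r, so `z o` and `w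
  -- o` play no role.
  let u (i j : ι) : R := if r i j then e (f i) (f j) else if i = j then a₀ * d j else 0
  let v (i j : ι) : R := if r i j then e (f i) (J (f j)) else if i = j then a₁ * d j else 0
  have hu (i j) : u i j ∈ I := by
    simp only [u]; split_ifs
    exacts [he _ _, I.mul_mem_left _ (hd _), zero_mem _]
  have hv (i j) : v i j ∈ I := by
    simp only [v]; split_ifs
    exacts [he _ _, I.mul_mem_left _ (hd _), zero_mem _]
  have huo (j) : u o j = 0 := by
    simp only [u]; rw [if_neg (hro j)]; split_ifs with h1
    · rw [← h1, hdo, mul_zero]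
    · rfl
  have hvo (j) : v o j = 0 := by
    simp only [v]; rw [if_neg (hro j)]; split_ifs with h1
    · rw [← h1, hdo, mul_zero]
    · rfl
  let y (j : ι) : P := ∑ i, (u i j • z i + v i j • w i)
  have hyI (j) : y j ∈ I • (⊤ : Submodule R P) :=
    sum_mem fun i _ => add_mem (Submodule.smul_mem_smul (hu i j) trivial)
      (Submodule.smul_mem_smul (hv i j) trivial)
  have hby (k j) : b (f k) (y j) = u k j := by
    simp only [y, map_sum, _root_.map_add, map_smul, smul_eq_mul]
    rw [Finset.sum_eq_single k]
    · by_cases hk : k = o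
      · rw [hk, huo, hvo]; simp
      · rw [hz k hk, hw k hk]; simp
    · intro i _ hik
      by_cases hi : i = o
      · rw [hi, huo, hvo]; simp
      · rw [hz i hi, hw i hi, if_neg hik.symm]; simp
    · simp
  have hbJy (k j) : b (f k) (J (y j)) = v k j := by
    simp only [y, map_sum, _root_.map_add, map_smul, smul_eq_mul]
    rw [Finset.sum_eq_single k]
    · by_cases hk : k = o
      · rw [hk, huo, hvo]; simp
      · rw [hz' k hk, hw' k hk]; simp
    · intro i _ hik
      by_cases hi : i = o
      · rw [hi, huo, hvo]; simp
      · rw [hz' i hi, hw' i hi, if_neg hik.symm]; simp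
    · simp
  let η : Module.End R P := F.constr R (Sum.elim y (fun j => J (y j)))
  have hηf (j) : η (f j) = y j := by
    rw [← hFl, Module.Basis.constr_basis, Sum.elim_inl]
  have hηJf (j) : η (J (f j)) = J (y j) := by
    rw [← hFr, Module.Basis.constr_basis, Sum.elim_inr]
  have hηJ (x) : η (J x) = J (η x) := by
    refine LinearMap.congr_fun (f := η ∘ₗ J) (g := J ∘ₗ η) (F.ext ?_) x
    rintro (i | i)
    · simp only [hFl, LinearMap.comp_apply, hηJf, hηf]
    · simp only [hFr, LinearMap.comp_apply, hηJf, hJ, map_sub, map_smul, hηf]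
  have hmapI (T : Module.End R P) {x : P} (hx : x ∈ I • (⊤ : Submodule R P)) :
      T x ∈ I • (⊤ : Submodule R P) := Submodule.smul_top_le_comap_smul_top I T hx
  have hηI (x) : η x ∈ I • (⊤ : Submodule R P) := by
    rw [← F.sum_repr x, map_sum]
    refine sum_mem fun i _ => ?_
    rw [map_smul]
    refine Submodule.smul_mem _ _ ?_
    rcases i with i | i
    · rw [hFl, hηf]; exact hyI i
    · rw [hFr, hηJf]; exact hmapI J (hyI i)
  -- The error of g lies in I and I² = 0, so g is an exact similitude for b once one argument lies
  -- in I • P.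
  have hb_right (x y : P) (hy : y ∈ I • (⊤ : Submodule R P)) : b (g x) (g y) = γ * b x y := by
    refine Submodule.smul_induction_on hy (fun a ha p _ => ?_) (fun p p' hp hp' => ?_)
    · have := hI0 ha (hgb x p)
      simp only [map_smul, smul_eq_mul]
      linear_combination this
    · simp only [_root_.map_add, hp, hp', mul_add]
  have hb_left (x y : P) (hx : x ∈ I • (⊤ : Submodule R P)) : b (g x) (g y) = γ * b x y := by
    refine Submodule.smul_induction_on hx (fun a ha p _ => ?_) (fun p p' hp hp' => ?_)
    · have := hI0 ha (hgb p y)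
      simp only [map_smul, smul_eq_mul, LinearMap.smul_apply]
      linear_combination this
    · simp only [_root_.map_add, hp, hp', mul_add, LinearMap.add_apply]
  have hb_both (x y : P) (hx : x ∈ I • (⊤ : Submodule R P)) (hy : y ∈ I • (⊤ : Submodule R P)) :
      b x y = 0 := by
    refine Submodule.smul_induction_on hx (fun a ha p _ => ?_) (fun p p' hp hp' => ?_)
    · refine Submodule.smul_induction_on hy (fun a' ha' p' _ => ?_) (fun p p' hp hp' => ?_)
      · simp only [map_smul, smul_eq_mul, LinearMap.smul_apply]
        linear_combination b p p' * hI0 ha ha'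
      · rw [_root_.map_add, hp, hp', add_zero]
    · rw [_root_.map_add, LinearMap.add_apply, hp, hp', add_zero]
  have hJI' (x) (hx : x ∈ I • (⊤ : Submodule R P)) : μ₀ • x + μ₁ • J x ∈ I • (⊤ : Submodule R P) := by
    refine add_mem (Submodule.smul_mem _ _ hx) (Submodule.smul_mem _ _ ?_)
    exact hmapI J hx
  have hQI (x : P) (hx : x ∈ I • (⊤ : Submodule R P)) : Q x = 0 := by
    have : x ∈ I • (⊤ : Submodule R P) ∧ Q x = 0 := by
      refine Submodule.smul_induction_on hx (fun a ha p _ => ?_) (fun p p' hp hp' => ?_)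
      · refine ⟨Submodule.smul_mem_smul ha trivial, ?_⟩
        rw [QuadraticMap.map_smul, hI0 ha ha, zero_smul]
      · refine ⟨add_mem hp.1 hp'.1, ?_⟩
        rw [h.map_add, hp.2, hp'.2, hb_both _ _ hp.1 (hJI' _ hp'.1)]
        simp
    exact this.2
  let g' : Module.End R P := g ∘ₗ (LinearMap.id + η)
  have hg' (x) : g' x = g (x + η x) := rfl
  have hspan : Submodule.span R (Set.range f ∪ Set.range (J ∘ f)) = ⊤ := by
    rw [eq_top_iff, ← F.span_eq]
    refine Submodule.span_mono ?_
    rintro _ ⟨i | i, rfl⟩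
    · exact Or.inl ⟨i, (hFl i).symm⟩
    · exact Or.inr ⟨i, (hFr i).symm⟩
  -- The error of g (1 + η) with multiplier γ (1 + c) is a hermitian pair, so only its values on
  -- generators have to be computed.
  have hmain := (h.sub_smul (g := g') (fun x => by simp only [hg', hηJ, hg, _root_.map_add])
    (γ * (1 + c))).eq_zero hspan hr (fun j => ?_) (fun i j hij => ?_)
  · refine ⟨η, c, hcI, hηI, hηJ, fun x => ?_, fun x y => ?_⟩
    · have := congrArg (fun q => q x) hmain.1
      exact sub_eq_zero.1 this
    · exact sub_eq_zero.1 (LinearMap.congr_fun₂ hmain.2 x y)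
  · change Q (g (f j + η (f j))) - γ * (1 + c) * Q (f j) = 0
    -- The term quadratic in `y j` vanishes, and Q changes by γ b(f j, μ₀ y j + μ₁ J (y j)) = γ (μ₀
    -- a₀ + μ₁ a₁) d j = γ d j.
    rw [hηf, _root_.map_add, h.map_add, hQI _ (hmapI g (hyI j)), ← hg, ← map_smul, ← map_smul,
      ← _root_.map_add, hb_right _ _ (hJI' _ (hyI j)), _root_.map_add, map_smul, map_smul, hby,
      hbJy]
    have h1 : u j j = a₀ * d j := by
      simp only [u]; rw [if_neg fun h1 => hr_ne _ _ h1 rfl, if_pos trivial]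
    have h2 : v j j = a₁ * d j := by
      simp only [v]; rw [if_neg fun h1 => hr_ne _ _ h1 rfl, if_pos trivial]
    rw [h1, h2, smul_eq_mul, smul_eq_mul]
    simp only [d]
    linear_combination γ * (c * Q (f j) - γ' * (Q (g (f j)) - γ * Q (f j))) * ha -
      (Q (g (f j)) - γ * Q (f j)) * hγ
  · have hji : ¬ r j i := hr' i j hij
    have hne := hr_ne _ _ hij
    have hu0 : u j i = 0 := by simp only [u]; rw [if_neg hji, if_neg hne.symm]
    have hv0 : v j i = 0 := by simp only [v]; rw [if_neg hji, if_neg hne.symm]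
    have hue : u i j = e (f i) (f j) := if_pos hij
    have hve : v i j = e (f i) (J (f j)) := if_pos hij
    -- The correction of `f i` does not disturb the pair (i, j): by skewness these values are
    -- combinations of `u j i` and `v j i`, which are zero because `r j i` fails.
    have e1 : b (y i) (f j) = 0 := by
      rw [h.skew (f j)]; simp [hby, hbJy, hu0, hv0]
    have e2 : b (y i) (J (f j)) = 0 := by
      rw [h.skew_apply (f j)]; simp [hby, hbJy, hu0, hv0]
    constructor
    · change b (g (f i + η (f i))) (g (f j + η (f j))) - γ * (1 + c) * b (f i) (f j) = 0
      rw [hηf, hηf]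
      simp only [_root_.map_add, LinearMap.add_apply]
      rw [hb_right _ _ (hyI j), hb_left _ _ (hyI i), hb_right _ _ (hyI j),
        hb_both _ _ (hyI i) (hyI j), hby, hue, e1]
      simp only [e]
      linear_combination -(b (g (f i)) (g (f j)) - γ * b (f i) (f j)) * hγ
    · change b (g (f i + η (f i))) (g (J (f j) + η (J (f j)))) - γ * (1 + c) * b (f i) (J (f j)) = 0
      rw [hηf, hηJf]
      have hJy : J (y j) ∈ I • (⊤ : Submodule R P) := by
        have := hηI (J (f j)); rwa [hηJf] at this
      simp only [_root_.map_add, LinearMap.add_apply]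
      rw [hb_right _ _ hJy, hb_left _ _ (hyI i), hb_right _ _ hJy,
        hb_both _ _ (hyI i) hJy, hbJy, hve, e2]
      simp only [e]
      linear_combination -(b (g (f i)) (g (J (f j))) - γ * b (f i) (J (f j))) * hγ

end Lifting

/-! ### Formal smoothness of the similitude functor -/

section Smooth

/-- By Yoneda, lifting a map H → R/I to R is the same as lifting an element of F(R/I) to F(R). -/
theorem formallySmooth_of_corepresentableBy {A : Type u} [CommRing A]
    {F : CommAlgCat.{u} A ⥤ GrpCat.{u}} {H : CommAlgCat.{u} A}
    (ρ : (F ⋙ forget GrpCat).CorepresentableBy H)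
    (hF : ∀ (R : Type u) [CommRing R] [Algebra A R] (I : Ideal R), I ^ 2 = ⊥ →
      Function.Surjective (F.map (CommAlgCat.ofHom (Ideal.Quotient.mkₐ A I)))) :
    Algebra.FormallySmooth A H := by
  refine Algebra.FormallySmooth.of_comp_surjective fun R _ _ I hI f => ?_
  obtain ⟨x, hx⟩ := hF R I hI (ρ.homEquiv (CommAlgCat.ofHom f))
  refine ⟨(ρ.homEquiv.symm x : H ⟶ .of A R).hom, ?_⟩
  have h : ρ.homEquiv.symm x ≫ CommAlgCat.ofHom (Ideal.Quotient.mkₐ A I) = CommAlgCat.ofHom f := by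
    refine ρ.homEquiv.injective ?_
    rw [ρ.homEquiv_comp, Equiv.apply_symm_apply]
    exact hx
  exact congrArg CommAlgCat.Hom.hom h

theorem isUnit_of_isUnit_mk {R : Type*} [CommRing R] {I : Ideal R} (hI : I ^ 2 = ⊥) {x : R}
    (hx : IsUnit (Ideal.Quotient.mk I x)) : IsUnit x := by
  obtain ⟨y, hy⟩ := hx.exists_right_inv
  obtain ⟨y, rfl⟩ := Ideal.Quotient.mk_surjective y
  have h : x * y - 1 ∈ I := by
    rw [← Ideal.Quotient.eq_zero_iff_mem, map_sub, map_mul, hy, map_one, sub_self]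
  have h2 : (x * y - 1) ^ 2 = 0 := by
    have := Ideal.pow_mem_pow h 2
    rwa [hI] at this
  -- If x y = 1 + δ with δ² = 0, then x y (2 - x y) = 1 - δ² = 1.
  exact IsUnit.of_mul_eq_one (y * (2 - x * y)) (by linear_combination -h2)

variable {A : Type*} [CommRing A] {R S : Type*} [CommRing R] [Algebra A R] [CommRing S]
  [Algebra A S] {M L N : Type*} [AddCommGroup M] [Module A M] [AddCommGroup L] [Module A L]

/-- Each identity is an equality of quadratic or bilinear maps on R ⊗ M and may be checked on
vectors 1 ⊗ m. -/
theorem IsHermitianPair.baseChange {J : Module.End A M} {t n τ τ' μ₀ μ₁ : A}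
    {Q : QuadraticMap A M L} {b : LinearMap.BilinMap A M L}
    (h : IsHermitianPair J t n τ τ' μ₀ μ₁ Q b) (R : Type*) [CommRing R] [Algebra A R] :
    IsHermitianPair (J.baseChange R) (algebraMap A R t) (algebraMap A R n) (algebraMap A R τ)
      (algebraMap A R τ') (algebraMap A R μ₀) (algebraMap A R μ₁) (quadBaseChange R Q)
      (LinearMap.BilinMap.baseChange R b) where
  quad x := by
    refine congrArg (fun q => q x) (baseChange_ext (Q₁ := (quadBaseChange R Q).comp (J.baseChange R))
      (Q₂ := algebraMap A R n • quadBaseChange R Q) fun m => ?_)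
    simp [quadBaseChange_one_tmul, h.quad]
  adj x y := by
    have e : (LinearMap.BilinMap.baseChange R b) ∘ₗ J.baseChange R =
        (LinearMap.BilinMap.baseChange R b).compl₂
          (algebraMap A R t • (1 : Module.End R (R ⊗[A] M)) - J.baseChange R) :=
      bilin_ext_one_tmul fun m n => by simp [h.adj, TensorProduct.tmul_sub]
    exact LinearMap.congr_fun₂ e x y
  polar x y := by
    rw [← QuadraticMap.polarBilin_apply_apply, polarBilin_quadBaseChange]
    have e : LinearMap.BilinMap.baseChange R Q.polarBilin =
        (LinearMap.BilinMap.baseChange R b).compl₂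
          (algebraMap A R μ₀ • (1 : Module.End R (R ⊗[A] M)) + algebraMap A R μ₁ • J.baseChange R) :=
      bilin_ext_one_tmul fun m n => by simp [h.polar, TensorProduct.tmul_add]
    exact LinearMap.congr_fun₂ e x y
  diag x := by
    refine congrArg (fun q => q x) (baseChange_ext
      (Q₁ := (LinearMap.BilinMap.baseChange R b).toQuadraticMap)
      (Q₂ := algebraMap A R τ • quadBaseChange R Q) fun m => ?_)
    simp [quadBaseChange_one_tmul, h.diag]
  diag_apply x := by
    refine congrArg (fun q => q x) (baseChange_ext
      (Q₁ := LinearMap.BilinMap.toQuadraticMap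
        ((LinearMap.BilinMap.baseChange R b).compl₂ (J.baseChange R)))
      (Q₂ := algebraMap A R τ' • quadBaseChange R Q) fun m => ?_)
    simp [quadBaseChange_one_tmul, h.diag_apply]

theorem IsHermitianPair.postcomp {P N N' : Type*} [AddCommGroup P] [Module R P] [AddCommGroup N]
    [Module R N] [AddCommGroup N'] [Module R N'] {J : Module.End R P} {t n τ τ' μ₀ μ₁ : R}
    {Q : QuadraticMap R P N} {b : LinearMap.BilinMap R P N}
    (h : IsHermitianPair J t n τ τ' μ₀ μ₁ Q b) (ω : N →ₗ[R] N') :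
    IsHermitianPair J t n τ τ' μ₀ μ₁ (ω.compQuadraticMap Q) (b.compr₂ ω) where
  quad x := by simp [h.quad]
  adj x y := by simp [h.adj]
  polar x y := by
    rw [LinearMap.compr₂_apply, ← h.polar]
    simp [QuadraticMap.polar]
  diag x := by simp [h.diag]
  diag_apply x := by simp [h.diag_apply]

theorem changeRing_mk_eq_zero_of_mem {I : Ideal R} {x : R ⊗[A] M}
    (hx : x ∈ I • (⊤ : Submodule R (R ⊗[A] M))) :
    changeRing (Ideal.Quotient.mkₐ A I) M x = 0 := by
  refine Submodule.smul_induction_on hx (fun a ha p _ => ?_) (fun p p' hp hp' => ?_)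
  · rw [changeRing_smul, Ideal.Quotient.mkₐ_eq_mk, Ideal.Quotient.eq_zero_iff_mem.2 ha, zero_smul]
  · rw [map_add, hp, hp', add_zero]

theorem changeRing_mk_surjective (I : Ideal R) :
    Function.Surjective (changeRing (Ideal.Quotient.mkₐ A I) M) :=
  LinearMap.rTensor_surjective M Ideal.Quotient.mk_surjective

/-- The determinant is a unit modulo I, hence a unit. -/
theorem isUnit_of_isUnit_pushHom_mk {κ : Type*} [Fintype κ] [DecidableEq κ]
    (b : Module.Basis κ A M) {I : Ideal R} (hI : I ^ 2 = ⊥) {g : Module.End R (R ⊗[A] M)}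
    (hg : IsUnit (show Module.End (R ⧸ I) ((R ⧸ I) ⊗[A] M) from
      pushHom (Ideal.Quotient.mkₐ A I) g)) : IsUnit g := by
  rw [← LinearMap.isUnit_toMatrix_iff (b.baseChange R), Matrix.isUnit_iff_isUnit_det]
  refine isUnit_of_isUnit_mk hI ?_
  rw [← LinearMap.isUnit_toMatrix_iff (b.baseChange (R ⧸ I)), Matrix.isUnit_iff_isUnit_det] at hg
  rw [RingHom.map_det]
  convert hg using 2
  ext i j
  exact (congrFun (entries_pushHom b (Ideal.Quotient.mkₐ A I) g) (i, j)).symm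

/-- The coordinate `R ⊗ L ≃ R` induced by `L ≃ A`. -/
noncomputable def coordBaseChange (ω : L ≃ₗ[A] A) (R : Type*) [CommRing R] [Algebra A R] :
    R ⊗[A] L ≃ₗ[R] R :=
  (ω.baseChange A R L A).trans (TensorProduct.AlgebraTensorModule.rid A R R)

theorem coordBaseChange_one_tmul (ω : L ≃ₗ[A] A) (x : L) :
    coordBaseChange ω R (1 ⊗ₜ x) = algebraMap A R (ω x) := by
  simp [coordBaseChange, Algebra.smul_def]

theorem coordBaseChange_changeRing (ω : L ≃ₗ[A] A) (f : R →ₐ[A] S) (x : R ⊗[A] L) :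
    coordBaseChange ω S (changeRing f L x) = f (coordBaseChange ω R x) := by
  induction x with
  | zero => simp
  | add x y hx hy => simp only [map_add, hx, hy]
  | tmul r x => simp [coordBaseChange, Algebra.smul_def]

/-- An endomorphism of a free module of rank one is multiplication by the coordinate of its value at
the generator. -/
theorem coordBaseChange_gl (ω : L ≃ₗ[A] A) (g : Module.End R (R ⊗[A] L)) (x : R ⊗[A] L) :
    coordBaseChange ω R (g x) =
      coordBaseChange ω R (g ((coordBaseChange ω R).symm 1)) * coordBaseChange ω R x := by
  have : x = coordBaseChange ω R x • (coordBaseChange ω R).symm 1 := by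
    rw [← map_smul, smul_eq_mul, mul_one, LinearEquiv.symm_apply_apply]
  conv_lhs => rw [this]
  rw [map_smul, map_smul, smul_eq_mul, mul_comm]

variable {B : Type*} [CommRing B] [Algebra A B] [Module B M] [IsScalarTower A B M]

theorem scalarAction_one_tmul (β : B) (m : M) :
    scalarAction A R M β (1 ⊗ₜ m) = 1 ⊗ₜ (β • m) := by
  simp [scalarAction]

/-- It suffices to commute with a generator. -/
theorem commute_scalarAction_of_adjoin {π : B} (hπ : Algebra.adjoin A {π} = ⊤)
    {g : Module.End R (R ⊗[A] M)}
    (hg : ∀ x, g (scalarAction A R M π x) = scalarAction A R M π (g x)) (β : B) (x : R ⊗[A] M) :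
    g (scalarAction A R M β x) = scalarAction A R M β (g x) := by
  have hβ : β ∈ Algebra.adjoin A {π} := hπ ▸ Algebra.mem_top
  induction hβ using Algebra.adjoin_induction generalizing x with
  | mem y hy => rw [Set.mem_singleton_iff.1 hy]; exact hg x
  | algebraMap a =>
    have h (y : R ⊗[A] M) : scalarAction A R M (algebraMap A B a) y = algebraMap A R a • y := by
      refine LinearMap.congr_fun (f := scalarAction A R M (algebraMap A B a))
        (g := algebraMap A R a • (1 : Module.End R (R ⊗[A] M))) (hom_ext_one_tmul fun m => ?_) y
      rw [scalarAction_one_tmul]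
      simp
    rw [h, h, map_smul]
  | add y z _ _ hy hz =>
    have h (w : R ⊗[A] M) : scalarAction A R M (y + z) w =
        scalarAction A R M y w + scalarAction A R M z w := by
      simp [scalarAction, LinearMap.baseChange_add]
    rw [h, h, map_add, hy, hz]
  | mul y z _ _ hy hz =>
    have h (w : R ⊗[A] M) : scalarAction A R M (y * z) w =
        scalarAction A R M y (scalarAction A R M z w) := by
      simp only [scalarAction, map_mul, Module.End.mul_eq_comp, LinearMap.baseChange_comp,
        LinearMap.comp_apply]
    rw [h, h, hy, hz]

/-- The trivialisation ω of L makes the forms R-valued, as `IsHermitianPair.exists_deformation`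
requires. What is added here is a first lift commuting with π, a lift of the multiplier, and the
invertibility of the corrected maps. -/
theorem exists_lift_simGroupPreserving {q : QuadraticMap A M L} {b : LinearMap.BilinMap A M L}
    {π : B} (hπ : Algebra.adjoin A {π} = ⊤) {t n τ τ' μ₀ μ₁ a₀ a₁ : A}
    (h : IsHermitianPair (Algebra.lsmul A A M π) t n τ τ' μ₀ μ₁ q b)
    (hπ' : π ^ 2 = algebraMap A B t * π - algebraMap A B n)
    {ι : Type*} [Fintype ι] [LinearOrder ι] (F : Module.Basis (ι ⊕ ι) A M) {f : ι → M}
    (hFl : ∀ i, F (.inl i) = f i) (hFr : ∀ i, F (.inr i) = π • f i) (ω : L ≃ₗ[A] A)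
    {o : ι} {z w : ι → M}
    (hz : ∀ i, i ≠ o → ∀ k, ω (b (f k) (z i)) = if k = i then 1 else 0)
    (hz' : ∀ i, i ≠ o → ∀ k, b (f k) (π • z i) = 0)
    (hw : ∀ i, i ≠ o → ∀ k, b (f k) (w i) = 0)
    (hw' : ∀ i, i ≠ o → ∀ k, ω (b (f k) (π • w i)) = if k = i then 1 else 0)
    (ho : ω (q (f o)) = 1) (ha : a₀ * μ₀ + a₁ * μ₁ = 1) {I : Ideal R} (hI : I ^ 2 = ⊥)
    {g : LinearMap.GeneralLinearGroup (R ⧸ I) ((R ⧸ I) ⊗[A] M) ×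
      LinearMap.GeneralLinearGroup (R ⧸ I) ((R ⧸ I) ⊗[A] L)}
    (hg : g ∈ simGroupPreserving B q b (R ⧸ I)) :
    ∃ g' ∈ simGroupPreserving B q b R, pushGL (Ideal.Quotient.mkₐ A I) M g'.1 = g.1 ∧
      pushGL (Ideal.Quotient.mkₐ A I) L g'.2 = g.2 := by
  classical
  set mk := Ideal.Quotient.mkₐ A I with hmk
  have hmk0 (x : R) : mk x = 0 ↔ x ∈ I := Ideal.Quotient.eq_zero_iff_mem
  let J : Module.End R (R ⊗[A] M) := scalarAction A R M π
  have hRt := (h.baseChange R).postcomp (coordBaseChange ω R).toLinearMap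
  have hJ (x) : J (J x) = algebraMap A R t • J x - algebraMap A R n • x := by
    refine LinearMap.congr_fun (f := J ∘ₗ J)
      (g := algebraMap A R t • J - algebraMap A R n • (1 : Module.End R (R ⊗[A] M)))
      (hom_ext_one_tmul fun m => ?_) x
    have e : π • π • m = t • π • m - n • m := by
      rw [smul_smul, ← pow_two, hπ', sub_smul, mul_smul, algebraMap_smul, algebraMap_smul]
    simp only [J, LinearMap.comp_apply, scalarAction_one_tmul, LinearMap.sub_apply,
      LinearMap.smul_apply, Module.End.one_apply, e, TensorProduct.tmul_sub,
      TensorProduct.tmul_smul, algebraMap_smul]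
  -- Only the images of the `f j` are lifted freely; the image of π • f j is taken to be π times
  -- that of `f j`, so that the lift `g₀` commutes with π.
  choose p hp using fun j => changeRing_mk_surjective I (g.1.val (1 ⊗ₜ f j))
  let F' := F.baseChange R
  have hFl' (i) : F' (.inl i) = 1 ⊗ₜ f i := by
    rw [Module.Basis.baseChange_apply, hFl]
  have hFr' (i) : F' (.inr i) = J (1 ⊗ₜ f i) := by
    rw [Module.Basis.baseChange_apply, hFr, scalarAction_one_tmul]
  let g₀ : Module.End R (R ⊗[A] M) := F'.constr R (Sum.elim p (fun j => J (p j)))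
  have hg₀l (j) : g₀ (1 ⊗ₜ f j) = p j := by
    rw [← hFl', Module.Basis.constr_basis, Sum.elim_inl]
  have hg₀r (j) : g₀ (J (1 ⊗ₜ f j)) = J (p j) := by
    rw [← hFr', Module.Basis.constr_basis, Sum.elim_inr]
  have hg₀J (x) : g₀ (J x) = J (g₀ x) := by
    refine LinearMap.congr_fun (f := g₀ ∘ₗ J) (g := J ∘ₗ g₀) (F'.ext ?_) x
    rintro (i | i)
    · simp only [hFl', LinearMap.comp_apply, hg₀l, hg₀r]
    · simp only [hFr', LinearMap.comp_apply, hg₀r, hJ, map_sub, map_smul, hg₀l]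
  have hpush : pushHom mk g₀ = g.1.val := by
    refine (F.baseChange (R ⧸ I)).ext ?_
    rintro (i | i)
    · rw [Module.Basis.baseChange_apply, hFl, pushHom_one_tmul, hg₀l, hp]
    · rw [Module.Basis.baseChange_apply, hFr, pushHom_one_tmul, ← scalarAction_one_tmul, hg₀r,
        ← scalarAction_one_tmul, hg.1.1, ← hp, scalarAction_changeRing]
  have hg₀ (x) : changeRing mk M (g₀ x) = g.1.val (changeRing mk M x) := by
    rw [← hpush, pushHom_changeRing]
  set c₀ := coordBaseChange ω (R ⧸ I) (g.2.val ((coordBaseChange ω (R ⧸ I)).symm 1)) with hc₀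
  have hc₀u : IsUnit c₀ := by
    refine IsUnit.of_mul_eq_one
      (coordBaseChange ω (R ⧸ I) (g.2⁻¹.val ((coordBaseChange ω (R ⧸ I)).symm 1))) ?_
    rw [hc₀, ← coordBaseChange_gl, gl_apply_inv, LinearEquiv.apply_symm_apply]
  obtain ⟨γ, hγ⟩ := Ideal.Quotient.mk_surjective c₀
  obtain ⟨γ', hγ'⟩ := (isUnit_of_isUnit_mk hI (hγ ▸ hc₀u)).exists_right_inv
  -- The relation used is the strict order of ι with o moved to the end.
  have hrt : ∀ i j : ι, i ≠ j → (i ≠ o ∧ (j = o ∨ i < j)) ∨ (j ≠ o ∧ (i = o ∨ j < i)) := by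
    intro i j hij
    rcases lt_or_gt_of_ne hij with h1 | h1
    · by_cases hi : i = o
      · exact Or.inr ⟨fun hj => hij (hi.trans hj.symm), Or.inl hi⟩
      · exact Or.inl ⟨hi, Or.inr h1⟩
    · by_cases hj : j = o
      · exact Or.inl ⟨fun hi => hij (hi.trans hj.symm), Or.inl hj⟩
      · exact Or.inr ⟨hj, Or.inr h1⟩
  have hra : ∀ i j : ι, (i ≠ o ∧ (j = o ∨ i < j)) → ¬ (j ≠ o ∧ (i = o ∨ j < i)) := by
    rintro i j ⟨hi, hj | hj⟩ ⟨hj', hi' | hi'⟩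
    · exact hi hi'
    · exact hj' hj
    · exact hi hi'
    · exact lt_asymm hj hi'
  have hquad (x) : (coordBaseChange ω R) (quadBaseChange R q (g₀ x)) -
      γ * (coordBaseChange ω R) (quadBaseChange R q x) ∈ I := by
    rw [← hmk0, map_sub, map_mul, ← coordBaseChange_changeRing, ← coordBaseChange_changeRing,
      ← quad_changeRing, ← quad_changeRing, hg₀, hg.1.2, coordBaseChange_gl, ← hc₀, ← hγ]
    exact sub_self _
  have hbil (x y) : (coordBaseChange ω R) (LinearMap.BilinMap.baseChange R b (g₀ x) (g₀ y)) -
      γ * (coordBaseChange ω R) (LinearMap.BilinMap.baseChange R b x y) ∈ I := by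
    rw [← hmk0, map_sub, map_mul, ← coordBaseChange_changeRing, ← coordBaseChange_changeRing,
      ← bilin_changeRing (M' := M), ← bilin_changeRing (M' := M), hg₀, hg₀, hg.2,
      coordBaseChange_gl, ← hc₀, ← hγ]
    exact sub_self _
  obtain ⟨η, c, hc, hηI, hηJ, hQ, hb⟩ := hRt.exists_deformation hJ F' hFl' hFr' (o := o)
    hrt hra (fun j hj => hj.1 rfl) (z := fun i => 1 ⊗ₜ z i) (w := fun i => 1 ⊗ₜ w i)
    (fun i hi k => by
      simp [coordBaseChange_one_tmul, hz i hi k, apply_ite (algebraMap A R)])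
    (fun i hi k => by simp [hz' i hi k])
    (fun i hi k => by simp [hw i hi k])
    (fun i hi k => by
      simp [coordBaseChange_one_tmul, hw' i hi k, apply_ite (algebraMap A R)])
    (by simp [quadBaseChange_one_tmul, coordBaseChange_one_tmul, ho])
    (a₀ := algebraMap A R a₀) (a₁ := algebraMap A R a₁)
    (by rw [← map_mul, ← map_mul, ← map_add, ha, map_one]) hI hg₀J hγ' hquad hbil
  let g₁ : Module.End R (R ⊗[A] M) := g₀ ∘ₗ (1 + η)
  have hpush₁ : pushHom mk g₁ = g.1.val := by
    refine hom_ext_one_tmul fun m => ?_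
    have e : g₁ (1 ⊗ₜ m) = g₀ (1 ⊗ₜ m) + g₀ (η (1 ⊗ₜ m)) := map_add g₀ _ _
    rw [pushHom_one_tmul, e, map_add, hg₀, hg₀, changeRing_mk_eq_zero_of_mem (hηI _), map_zero,
      add_zero]
    simp
  have hγc : mk (γ * (1 + c)) = c₀ := by
    rw [map_mul, map_add, (hmk0 c).2 hc, map_one, add_zero, mul_one]; exact hγ
  -- The corrected map and multiplier still reduce to the given ones modulo I, hence are invertible.
  obtain ⟨U₁, hU₁⟩ : IsUnit g₁ :=
    isUnit_of_isUnit_pushHom_mk F hI (hpush₁.symm ▸ g.1.isUnit)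
  obtain ⟨U₂, hU₂⟩ : IsUnit (γ * (1 + c)) := isUnit_of_isUnit_mk hI (hγc.symm ▸ hc₀u)
  let U₃ : LinearMap.GeneralLinearGroup R (R ⊗[A] L) :=
    Units.map (algebraMap R (Module.End R (R ⊗[A] L))).toMonoidHom U₂
  have hU₃ (x) : U₃.val x = (γ * (1 + c)) • x := by rw [← hU₂]; rfl
  refine ⟨(U₁, U₃), ⟨⟨?_, fun x => ?_⟩, fun x y => ?_⟩, Units.ext ?_, Units.ext ?_⟩
  · refine commute_scalarAction_of_adjoin hπ fun x => ?_
    rw [hU₁]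
    change g₀ (J x + η (J x)) = J (g₀ (x + η x))
    rw [show η (J x) = J (η x) from hηJ x, ← map_add J, hg₀J]
  · refine (coordBaseChange ω R).injective ?_
    rw [hU₁, hU₃, map_smul]
    exact hQ x
  · refine (coordBaseChange ω R).injective ?_
    rw [hU₁, hU₃, map_smul]
    exact hb x y
  · rw [pushGL_val, hU₁, hpush₁]
  · refine hom_ext_one_tmul fun m => (coordBaseChange ω (R ⧸ I)).injective ?_
    rw [pushGL_val, pushHom_one_tmul, hU₃, changeRing_smul, map_smul, hγc, coordBaseChange_gl,
      ← hc₀, smul_eq_mul]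
    simp

end Smooth

/-! ### The generic fiber -/

section GenericFiber

variable {A K B F M V L : Type u} [CommRing A] [Field K] [Algebra A K] [CommRing B] [Algebra A B]
  [CommRing F] [Algebra K F] [Algebra B F] [AddCommGroup M] [Module A M] [Module B M]
  [IsScalarTower A B M] [AddCommGroup V] [Module A V] [Module K V] [IsScalarTower A K V]
  [Module F V] [IsScalarTower K F V] [AddCommGroup L] [Module A L]

section compare
variable {R S : Type u} [CommRing R] [Algebra A R] [Algebra K R] [IsScalarTower A K R]
  [CommRing S] [Algebra A S] [Algebra K S] [IsScalarTower A K S]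

theorem compareMap_one_tmul (i : M →ₗ[A] V) (m : M) :
    compareMap (K := K) i R (1 ⊗ₜ m) = 1 ⊗ₜ i m := by
  simp [compareMap]

theorem compareMap_changeRing (i : M →ₗ[A] V) (f : R →ₐ[K] S) (x : R ⊗[A] M) :
    compareMap (K := K) i S (changeRing (f.restrictScalars A) M x) =
      changeRing f V (compareMap i R x) := by
  induction x with
  | zero => simp
  | add x y hx hy => simp only [map_add, hx, hy]
  | tmul r m =>
    have h := changeRing_smul f r ((1 : R) ⊗ₜ[K] i m)
    simp only [LinearMap.rTensor_tmul, AlgHom.toLinearMap_apply, compareMap,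
      LinearMap.liftBaseChange_tmul] at h ⊢
    rw [map_one] at h
    exact h.symm

/-- If `i` maps a basis to a basis then the comparison map is an isomorphism. -/
theorem compareMap_bijective {i : M →ₗ[A] V} {κ : Type*} (bM : Module.Basis κ A M)
    (bV : Module.Basis κ K V) (hi : ∀ k, i (bM k) = bV k) :
    Function.Bijective (compareMap (K := K) i R) := by
  have h : compareMap (K := K) i R =
       ((bM.baseChange R).equiv (bV.baseChange R) (Equiv.refl κ)).toLinearMap := by
    refine (bM.baseChange R).ext fun k => ?_
    rw [LinearEquiv.coe_coe, Module.Basis.equiv_apply, Module.Basis.baseChange_apply,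
      Module.Basis.baseChange_apply, compareMap_one_tmul, hi]
    rfl
  rw [h]
  exact LinearEquiv.bijective _

theorem compareMap_quadBaseChange {i : M →ₗ[A] V} {j : L →ₗ[A] K} {q : QuadraticMap A M L}
    {qV : QuadraticMap K V K} (hq : ∀ m, qV (i m) = j (q m)) (x : R ⊗[A] M) :
    quadBaseChange R qV (compareMap i R x) = compareMap j R (quadBaseChange R q x) :=
  congrArg (fun Q => Q x) (baseChange_ext (Q₁ := (quadBaseChange R qV).comp (compareMap i R))
    (Q₂ := (compareMap j R).compQuadraticMap (quadBaseChange R q)) fun m => by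
      simp [compareMap_one_tmul, quadBaseChange_one_tmul, hq])

theorem compareMap_bilinBaseChange {i : M →ₗ[A] V} {j : L →ₗ[A] K} {b : LinearMap.BilinMap A M L}
    {bV : LinearMap.BilinMap K V K} (hb : ∀ m n, bV (i m) (i n) = j (b m n)) (x y : R ⊗[A] M) :
    LinearMap.BilinMap.baseChange R bV (compareMap i R x) (compareMap i R y) =
      compareMap j R (LinearMap.BilinMap.baseChange R b x y) := by
  have e : (LinearMap.BilinMap.baseChange R bV).compl₁₂ (compareMap i R) (compareMap i R) =
      (LinearMap.BilinMap.baseChange R b).compr₂ (compareMap j R) :=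
    bilin_ext_one_tmul fun m n => by simp [compareMap_one_tmul, hb]
  exact LinearMap.congr_fun₂ e x y

theorem compareMap_scalarAction {i : M →ₗ[A] V} {β : B} {x : F} (hβ : ∀ m, i (β • m) = x • i m)
    (y : R ⊗[A] M) :
    compareMap i R (scalarAction A R M β y) = scalarAction K R V x (compareMap i R y) :=
  LinearMap.congr_fun (f := compareMap i R ∘ₗ scalarAction A R M β)
    (g := scalarAction K R V x ∘ₗ compareMap i R) (hom_ext_one_tmul fun m => by
      simp [compareMap_one_tmul, scalarAction_one_tmul, hβ]) y

end compare

section linear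
variable {R : Type*} [CommRing R] [Algebra K R] {h : LinearMap.BilinMap K V F}

theorem quadBaseChange_eq_of_hermitian {qV : QuadraticMap K V K} {ψ : F →ₗ[K] K}
    (hq : ∀ x, qV x = ψ (h x x)) (x : R ⊗[K] V) :
    quadBaseChange R qV x = ψ.baseChange R (LinearMap.BilinMap.baseChange R h x x) :=
  congrArg (fun Q => Q x) (baseChange_ext (Q₁ := quadBaseChange R qV)
    (Q₂ := LinearMap.BilinMap.toQuadraticMap
      ((LinearMap.BilinMap.baseChange R h).compr₂ (ψ.baseChange R))) fun m => by
      simp [quadBaseChange_one_tmul, hq])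

theorem bilinBaseChange_eq_of_hermitian {bV : LinearMap.BilinMap K V K} {ψ : F →ₗ[K] K}
    (hb : ∀ x y, bV x y = ψ (h x y)) (x y : R ⊗[K] V) :
    LinearMap.BilinMap.baseChange R bV x y =
      ψ.baseChange R (LinearMap.BilinMap.baseChange R h x y) := by
  have e : LinearMap.BilinMap.baseChange R bV =
      (LinearMap.BilinMap.baseChange R h).compr₂ (ψ.baseChange R) :=
    bilin_ext_one_tmul fun m n => by simp [hb]
  exact LinearMap.congr_fun₂ e x y

/-- A formula expressing h linearly through the polar form of q persists over R; thus a similitude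
of q commuting with `x₀` is a similitude of h. -/
theorem hermitianBaseChange_eq {qV : QuadraticMap K V K} {x₀ : F} {θ₀ θ₁ : K →ₗ[K] F}
    (hh : ∀ x y, h x y = θ₀ (QuadraticMap.polar qV x y) + θ₁ (QuadraticMap.polar qV x (x₀ • y)))
    (x y : R ⊗[K] V) :
    LinearMap.BilinMap.baseChange R h x y =
      θ₀.baseChange R (QuadraticMap.polar (quadBaseChange R qV) x y) +
      θ₁.baseChange R (QuadraticMap.polar (quadBaseChange R qV) x (scalarAction K R V x₀ y)) := by
  have e : LinearMap.BilinMap.baseChange R h =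
      (LinearMap.BilinMap.baseChange R qV.polarBilin).compr₂ (θ₀.baseChange R) +
      ((LinearMap.BilinMap.baseChange R qV.polarBilin).compl₂
        (scalarAction K R V x₀)).compr₂ (θ₁.baseChange R) :=
    bilin_ext_one_tmul fun m n => by simp [hh, scalarAction_one_tmul, TensorProduct.tmul_add]
  rw [← polarBilin_quadBaseChange] at e
  exact LinearMap.congr_fun₂ e x y

end linear

section Equiv

variable {q : QuadraticMap A M L} {b : LinearMap.BilinMap A M L} {h : LinearMap.BilinMap K V F}
  {i : M →ₗ[A] V}

/-- The underlying automorphism on `V ⊗ R` of a similitude of `M ⊗ R`. -/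
noncomputable def genericAction {R : Type u} [CommRing R] [Algebra A R]
    [Algebra K R] [IsScalarTower A K R] (hi : Function.Bijective (compareMap (K := K) i R)) :
    LinearMap.GeneralLinearGroup R (R ⊗[A] M) ≃* LinearMap.GeneralLinearGroup R (R ⊗[K] V) :=
  LinearMap.GeneralLinearGroup.congrLinearEquiv (LinearEquiv.ofBijective _ hi)

theorem genericAction_apply {R : Type u} [CommRing R] [Algebra A R]
    [Algebra K R] [IsScalarTower A K R] (hi : Function.Bijective (compareMap (K := K) i R))
    (g : LinearMap.GeneralLinearGroup R (R ⊗[A] M)) (x : R ⊗[A] M) :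
    (genericAction hi g).val (compareMap i R x) = compareMap i R (g.val x) := by
  change compareMap i R (g.val ((LinearEquiv.ofBijective _ hi).symm
    (LinearEquiv.ofBijective _ hi x))) = _
  rw [LinearEquiv.symm_apply_apply]

/-- If `(M, q, b)` is a lattice in `V` whose forms are obtained linearly from `h` and conversely,
then the similitudes of `(M, q, b)` over a `K`-algebra are those of `(V, h)`. -/
theorem exists_generic_equiv {κ : Type*} (bM : Module.Basis κ A M) (bV : Module.Basis κ K V)
    (hi : ∀ k, i (bM k) = bV k) (hiB : ∀ (β : B) m, i (β • m) = algebraMap B F β • i m) {π : B}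
    (hF : ∀ x : F, ∃ k₀ k₁ : K, x = algebraMap K F k₀ + algebraMap K F k₁ * algebraMap B F π)
    (ω : L ≃ₗ[A] A) {j : L →ₗ[A] K} {ℓ : K} (hℓ : ℓ ≠ 0) (hj : ∀ y, j y = algebraMap A K (ω y) * ℓ)
    {qV : QuadraticMap K V K} {b' : LinearMap.BilinMap K V K} (hqV : ∀ m, qV (i m) = j (q m))
    (hbV : ∀ m n, b' (i m) (i n) = j (b m n)) {ψ ψ' : F →ₗ[K] K} (hψ : ∀ x, qV x = ψ (h x x))
    (hψ' : ∀ x y, b' x y = ψ' (h x y)) {θ₀ θ₁ : K →ₗ[K] F}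
    (hh : ∀ x y, h x y = θ₀ (QuadraticMap.polar qV x y) +
      θ₁ (QuadraticMap.polar qV x (algebraMap B F π • y)))
    {o : M} (ho : ω (q o) = 1) :
    ∃ τ : ∀ (R : Type u) [CommRing R] [Algebra A R] [Algebra K R] [IsScalarTower A K R],
      (simPreservingFunctor B q b).obj (.of A R) ≃* (guFunctor h).obj (.of K R),
      (∀ (R S : Type u) [CommRing R] [Algebra A R] [Algebra K R] [IsScalarTower A K R]
        [CommRing S] [Algebra A S] [Algebra K S] [IsScalarTower A K S] (f : R →ₐ[K] S)
        (x : (simPreservingFunctor B q b).obj (.of A R)),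
        (guFunctor h).map (CommAlgCat.ofHom f) (τ R x) =
          τ S ((simPreservingFunctor B q b).map (CommAlgCat.ofHom (f.restrictScalars A)) x)) ∧
      ∀ (R : Type u) [CommRing R] [Algebra A R] [Algebra K R] [IsScalarTower A K R]
        (g : (simPreservingFunctor B q b).obj (.of A R)) (x : R ⊗[A] M),
        (guFunctorAction h (.of K R) (τ R g)).val (compareMap i R x) =
          compareMap i R ((simPreservingFunctorAction q b (.of A R) g).val x) := by
  have hbij (R : Type u) [CommRing R] [Algebra A R] [Algebra K R] [IsScalarTower A K R] :
      Function.Bijective (compareMap (K := K) i R) := compareMap_bijective bM bV hi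
  have hjR (R : Type u) [CommRing R] [Algebra A R] [Algebra K R] [IsScalarTower A K R] :
      Function.Injective (compareMap (K := K) j R) := by
    -- In coordinates, R ⊗ L → R ⊗ K is multiplication by ℓ, which is a unit of the K-algebra R.
    have e (y : R ⊗[A] L) : TensorProduct.AlgebraTensorModule.rid K R R (compareMap (K := K) j R y) =
        coordBaseChange ω R y * algebraMap K R ℓ := by
      induction y with
      | zero => simp
      | add x y hx hy => simp only [map_add, hx, hy, add_mul]
      | tmul r y =>
        simp only [compareMap, coordBaseChange, LinearMap.liftBaseChange_tmul, LinearMap.comp_apply,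
          LinearMap.restrictScalars_apply, TensorProduct.mk_apply, hj, map_smul,
          LinearEquiv.trans_apply, LinearEquiv.baseChange_tmul,
          TensorProduct.AlgebraTensorModule.rid_tmul, smul_eq_mul, Algebra.smul_def, map_mul,
          ← IsScalarTower.algebraMap_apply]
        ring
    intro x y hxy
    have h1 := congrArg (TensorProduct.AlgebraTensorModule.rid K R R) hxy
    rw [e, e] at h1
    exact (coordBaseChange ω R).injective
      (((IsUnit.mk0 ℓ hℓ).map (algebraMap K R)).mul_right_cancel h1)
  have hlin (R : Type u) [CommRing R] [Algebra A R] [Algebra K R] [IsScalarTower A K R]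
      (g : LinearMap.GeneralLinearGroup R (R ⊗[A] M)) :
      genericAction (hbij R) g ∈ linearGroup K F V R ↔ g ∈ linearGroup A B M R := by
    have hβ (β : B) (x : R ⊗[A] M) : compareMap (K := K) i R (scalarAction A R M β x) =
        scalarAction K R V (algebraMap B F β) (compareMap i R x) :=
      compareMap_scalarAction (hiB β) x
    constructor
    · intro hg β x
      refine (hbij R).1 ?_
      rw [hβ, ← genericAction_apply (hbij R), ← genericAction_apply (hbij R), hβ, hg]
    · intro hg x y
      obtain ⟨y, rfl⟩ := (hbij R).2 y
      -- Since F = K + K π, commuting with π is enough for F-linearity.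
      obtain ⟨k₀, k₁, rfl⟩ := hF x
      have h1 (w : R ⊗[K] V) : scalarAction K R V
          (algebraMap K F k₀ + algebraMap K F k₁ * algebraMap B F π) w =
          algebraMap K R k₀ • w + algebraMap K R k₁ • scalarAction K R V (algebraMap B F π) w := by
        refine LinearMap.congr_fun (f := scalarAction K R V _)
          (g := algebraMap K R k₀ • (1 : Module.End R (R ⊗[K] V)) +
            algebraMap K R k₁ • scalarAction K R V (algebraMap B F π))
          (hom_ext_one_tmul fun m => ?_) w
        simp only [scalarAction_one_tmul, LinearMap.add_apply, LinearMap.smul_apply,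
          Module.End.one_apply, algebraMap_smul, ← TensorProduct.tmul_smul,
          ← TensorProduct.tmul_add, add_smul, mul_smul]
      rw [h1, h1, map_add, map_smul, map_smul, ← hβ, genericAction_apply, genericAction_apply, hg,
        hβ]
  have hsim (R : Type u) [CommRing R] [Algebra A R] [Algebra K R] [IsScalarTower A K R]
      (g : simGroupPreserving B q b R) : genericAction (hbij R) g.1.1 ∈ guGroup h R := by
    set G := genericAction (hbij R) g.1.1 with hG
    have hGlin : G ∈ linearGroup K F V R := (hlin R _).2 g.2.1.1
    -- The automorphism γ of the rank one module R ⊗ L is multiplication by a unit, and this unit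
    -- will be the multiplier of h.
    obtain ⟨c, hc⟩ : ∃ c : Rˣ, ∀ y, g.1.2.val y = (c : R) • y := by
      set y₁ := (coordBaseChange ω R).symm 1 with hy₁
      refine ⟨⟨coordBaseChange ω R (g.1.2.val y₁), coordBaseChange ω R (g.1.2⁻¹.val y₁), ?_, ?_⟩,
        fun y => (coordBaseChange ω R).injective ?_⟩
      · rw [← coordBaseChange_gl, gl_apply_inv, hy₁, LinearEquiv.apply_symm_apply]
      · rw [← coordBaseChange_gl, gl_inv_apply, hy₁, LinearEquiv.apply_symm_apply]
      · rw [coordBaseChange_gl, map_smul, smul_eq_mul]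
    have hGq (x) : quadBaseChange R qV (G.val x) = (c : R) • quadBaseChange R qV x := by
      obtain ⟨x, rfl⟩ := (hbij R).2 x
      rw [genericAction_apply, compareMap_quadBaseChange hqV, compareMap_quadBaseChange hqV,
        g.2.1.2, hc, map_smul]
    have hGp (x y) : QuadraticMap.polar (quadBaseChange R qV) (G.val x) (G.val y) =
        (c : R) • QuadraticMap.polar (quadBaseChange R qV) x y := by
      simp only [QuadraticMap.polar, ← map_add, hGq, smul_sub]
    refine ⟨hGlin, c, fun x y => ?_⟩
    rw [hermitianBaseChange_eq hh, hermitianBaseChange_eq hh, ← hGlin, hGp, hGp, map_smul, map_smul,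
      smul_add]
  have hsurj (R : Type u) [CommRing R] [Algebra A R] [Algebra K R] [IsScalarTower A K R]
      (g : LinearMap.GeneralLinearGroup R (R ⊗[A] M)) (hg : genericAction (hbij R) g ∈ guGroup h R) :
      ∃ c, (g, c) ∈ simGroupPreserving B q b R := by
    obtain ⟨hGlin, c, hc⟩ := hg
    -- The candidate for γ is multiplication by c. The identities are checked after the injection
    -- into R ⊗ K, where q and b are linear functions of h.
    refine ⟨Units.map (algebraMap R (Module.End R (R ⊗[A] L))).toMonoidHom c,
      ⟨(hlin R g).1 hGlin, fun x => hjR R ?_⟩, fun x y => hjR R ?_⟩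
    · change compareMap j R (quadBaseChange R q (g.val x)) =
        compareMap j R ((c : R) • quadBaseChange R q x)
      rw [← compareMap_quadBaseChange hqV, ← genericAction_apply (hbij R),
        quadBaseChange_eq_of_hermitian hψ, hc, map_smul, map_smul,
        ← quadBaseChange_eq_of_hermitian hψ, compareMap_quadBaseChange hqV]
    · change compareMap j R (LinearMap.BilinMap.baseChange R b (g.val x) (g.val y)) =
        compareMap j R ((c : R) • LinearMap.BilinMap.baseChange R b x y)
      rw [← compareMap_bilinBaseChange hbV, ← genericAction_apply (hbij R),
        ← genericAction_apply (hbij R), bilinBaseChange_eq_of_hermitian hψ', hc, map_smul, map_smul,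
        ← bilinBaseChange_eq_of_hermitian hψ', compareMap_bilinBaseChange hbV]
  have hinj (R : Type u) [CommRing R] [Algebra A R] [Algebra K R] [IsScalarTower A K R]
      {g g' : simGroupPreserving B q b R} (hgg : g.1.1 = g'.1.1) : g = g' := by
    -- The generator of R ⊗ L is a value of q, so γ is determined on it by φ.
    have hqo : (coordBaseChange ω R).symm 1 = quadBaseChange R q (1 ⊗ₜ o) := by
      rw [LinearEquiv.symm_apply_eq, quadBaseChange_one_tmul, coordBaseChange_one_tmul, ho, map_one]
    refine Subtype.ext (Prod.ext hgg (Units.ext (LinearMap.ext fun y =>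
      (coordBaseChange ω R).injective ?_)))
    rw [coordBaseChange_gl, coordBaseChange_gl ω g'.1.2.val, hqo, ← g.2.1.2, ← g'.2.1.2, hgg]
  let τ (R : Type u) [CommRing R] [Algebra A R] [Algebra K R] [IsScalarTower A K R] :
      simGroupPreserving B q b R →* guGroup h R :=
    (((genericAction (hbij R)).toMonoidHom.comp (MonoidHom.fst _ _)).comp
      (simGroupPreserving B q b R).subtype).codRestrict (guGroup h R) (hsim R)
  have hτ (R : Type u) [CommRing R] [Algebra A R] [Algebra K R] [IsScalarTower A K R] :
      Function.Bijective (τ R) := by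
    constructor
    · intro g g' hgg
      exact hinj R ((genericAction (hbij R)).injective (congrArg Subtype.val hgg))
    · intro g
      obtain ⟨g₀, hg₀⟩ := (genericAction (hbij R)).surjective g.1
      obtain ⟨c, hc⟩ := hsurj R g₀ (hg₀ ▸ g.2)
      exact ⟨⟨_, hc⟩, Subtype.ext hg₀⟩
  refine ⟨fun R _ _ _ _ => MulEquiv.ofBijective (τ R) (hτ R), ?_, ?_⟩
  · intro R S _ _ _ _ _ _ _ _ f g
    have e : pushHom f (genericAction (hbij R) g.1.1).val ∘ₗ compareMap i S =
        (genericAction (hbij S) (pushGL (f.restrictScalars A) M g.1.1)).val ∘ₗ compareMap i S := by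
      refine hom_ext_one_tmul fun m => ?_
      have h1 : compareMap (K := K) i S (1 ⊗ₜ m) = changeRing f V (compareMap i R (1 ⊗ₜ m)) := by
        rw [compareMap_one_tmul, compareMap_one_tmul]; simp
      rw [LinearMap.comp_apply, LinearMap.comp_apply, genericAction_apply, h1, pushHom_changeRing,
        genericAction_apply, ← compareMap_changeRing, pushGL_val, pushHom_one_tmul]
    refine Subtype.ext (Units.ext (LinearMap.ext fun v => ?_))
    obtain ⟨v, rfl⟩ := (hbij S).2 v
    exact LinearMap.congr_fun e v
  · intro R _ _ _ _ g x
    exact genericAction_apply (hbij R) _ _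

end Equiv

end GenericFiber

/-! ### Arithmetic of the lattices: bases, duality, hermitian pairs -/

theorem isNoetherianRing_intBase {F₀ : Type*} [Field F₀] [Algebra ℚ_[2] F₀]
    [FiniteDimensional ℚ_[2] F₀] : IsNoetherianRing (IntBase F₀) := by
  have : IsFractionRing (PadicInt.subring 2) ℚ_[2] := inferInstanceAs (IsFractionRing ℤ_[2] ℚ_[2])
  have : IsNoetherianRing (PadicInt.subring 2) := inferInstanceAs (IsNoetherianRing ℤ_[2])
  have : IsIntegrallyClosed (PadicInt.subring 2) := inferInstanceAs (IsIntegrallyClosed ℤ_[2])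
  -- F₀ is finite and separable over the fraction field of the noetherian, integrally closed ring
  -- ℤ₂.
  exact IsIntegralClosure.isNoetherianRing (PadicInt.subring 2) ℚ_[2] F₀ (baseIntegers F₀)

namespace SplitHermitianDatum

section
variable {F₀ F V : Type*} [Field F₀] [Algebra ℚ_[2] F₀] [FiniteDimensional ℚ_[2] F₀]
  [Field F] [Algebra F₀ F] [AddCommGroup V] [Module F V] {m : ℕ}
  (D : SplitHermitianDatum F₀ F V m)

/-- The uniformizer `π`, as an element of `IntExt F₀ F`. -/
def πInt : IntExt F₀ F := D.π

theorem algebraMap_πInt : algebraMap (IntExt F₀ F) F D.πInt = D.π := rfl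

/-- The uniformizer `π₀`, as an element of `IntBase F₀`. -/
def π₀Int : IntBase F₀ := D.π₀

/-- The trace `t` of `π`, as an element of `IntBase F₀`. -/
def tInt : IntBase F₀ := D.t

theorem πInt_sq : D.πInt ^ 2 = algebraMap (IntBase F₀) (IntExt F₀ F) D.tInt * D.πInt -
    algebraMap (IntBase F₀) (IntExt F₀ F) D.π₀Int := by
  refine Subtype.ext ?_
  change (D.π : F) ^ 2 = algebraMap F₀ F D.t * D.π - algebraMap F₀ F D.π₀
  linear_combination D.equation

theorem exists_eq_add_mul_πInt (β : IntExt F₀ F) : ∃ x y : IntBase F₀,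
    β = algebraMap (IntBase F₀) (IntExt F₀ F) x +
      algebraMap (IntBase F₀) (IntExt F₀ F) y * D.πInt := by
  obtain ⟨x, hx, y, hy, h⟩ := D.exists_eq_add_mul_π β.2
  exact ⟨⟨x, hx⟩, ⟨y, hy⟩, Subtype.ext h⟩

theorem adjoin_πInt : Algebra.adjoin (IntBase F₀) {D.πInt} = ⊤ := by
  refine eq_top_iff.2 fun β _ => ?_
  obtain ⟨x, y, rfl⟩ := D.exists_eq_add_mul_πInt β
  exact add_mem (Subalgebra.algebraMap_mem _ x) (mul_mem (Subalgebra.algebraMap_mem _ y)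
    (Algebra.subset_adjoin rfl))

theorem π_not_mem (k : F₀) : algebraMap F₀ F k ≠ D.π := fun h =>
  D.σ_π_ne (by rw [← h, D.σ.commutes])

/-- The basis `1, π` of `F` over `F₀`. -/
theorem exists_basis_one_π :
    ∃ b : Module.Basis Bool F₀ F, b false = 1 ∧ b true = D.π := by
  have hli : LinearIndependent F₀ (fun c : Bool => if c then (D.π : F) else 1) := by
    rw [Fintype.linearIndependent_iff]
    intro g hg
    rw [Fintype.sum_bool, if_pos rfl, if_neg Bool.false_ne_true] at hg
    have h1 : g true = 0 := by
      by_contra h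
      refine D.π_not_mem (-(g true)⁻¹ * g false) ?_
      have h0 := algebraMap_ne (F := F) h
      rw [Algebra.smul_def, Algebra.smul_def] at hg
      rw [map_mul, map_neg, map_inv₀]
      field_simp
      linear_combination -hg
    rw [h1, zero_smul, zero_add, Algebra.smul_def, mul_one] at hg
    have h2 : g false = 0 := FaithfulSMul.algebraMap_injective F₀ F (by rw [hg, map_zero])
    rintro (_ | _)
    exacts [h2, h1]
  refine ⟨basisOfLinearIndependentOfCardEqFinrank hli (by rw [D.finrank_eq]; rfl), ?_, ?_⟩ <;>
    simp

theorem exists_eq_algebraMap_add (x : F) :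
    ∃ k₀ k₁ : F₀, x = algebraMap F₀ F k₀ + algebraMap F₀ F k₁ * D.π := by
  obtain ⟨b, hb, hb'⟩ := D.exists_basis_one_π
  refine ⟨b.repr x false, b.repr x true, ?_⟩
  have := b.sum_repr x
  rw [Fintype.sum_bool, hb, hb', Algebra.smul_def, Algebra.smul_def] at this
  linear_combination -this

theorem lam_ne : D.lam ≠ 0 := fun h => by
  have := D.σ_lam_add_lam
  rw [h, map_zero, add_zero] at this
  exact one_ne_zero this.symm

theorem latticeCoeff_ne (i : ℕ) (j : Fin (2 * m + 1)) : D.latticeCoeff i j ≠ 0 := by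
  unfold latticeCoeff
  split_ifs
  exacts [inv_ne_zero D.π_ne, one_ne_zero, D.lam_ne]

/-- The generators of the lattice. -/
noncomputable def gen (i : ℕ) (j : Fin (2 * m + 1)) : D.lattice i :=
  ⟨D.latticeCoeff i j • D.e j, Submodule.subset_span ⟨j, rfl⟩⟩

variable [Module F₀ V] [IsScalarTower F₀ F V]

/-- Compatible bases of `Λᵢ` over `O_{F₀}` and of `V` over `F₀`. -/
theorem exists_lattice_basis (i : ℕ) :
    ∃ (b : Module.Basis (Fin (2 * m + 1) ⊕ Fin (2 * m + 1)) (IntBase F₀) (D.lattice i))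
      (bV : Module.Basis (Fin (2 * m + 1) ⊕ Fin (2 * m + 1)) F₀ V),
      (∀ k, D.latticeIncl i (b k) = bV k) ∧ (∀ j, b (.inl j) = D.gen i j) ∧
        ∀ j, b (.inr j) = D.πInt • D.gen i j := by
  obtain ⟨b₂, hb₂, hb₂'⟩ := D.exists_basis_one_π
  -- The basis e rescaled by the nonzero lattice coefficients; multiplying it by 1 and π gives the
  -- F₀-basis `bV`.
  let e' : Module.Basis (Fin (2 * m + 1)) F V :=
    D.e.isUnitSMul (w := D.latticeCoeff i) fun j => IsUnit.mk0 _ (D.latticeCoeff_ne i j)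
  let bV := (b₂.smulTower e').reindex (Equiv.boolProdEquivSum (Fin (2 * m + 1)))
  let v : Fin (2 * m + 1) ⊕ Fin (2 * m + 1) → D.lattice i :=
    Sum.elim (D.gen i) (fun j => D.πInt • D.gen i j)
  have hv (k) : D.latticeIncl i (v k) = bV k := by
    rw [Module.Basis.reindex_apply, Module.Basis.smulTower_apply]
    rcases k with j | j
    · change D.latticeCoeff i j • D.e j = b₂ false • e' j
      rw [hb₂, one_smul, Module.Basis.isUnitSMul_apply]
    · change (D.π : F) • D.latticeCoeff i j • D.e j = b₂ true • e' j
      rw [hb₂', Module.Basis.isUnitSMul_apply]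
  have hli : LinearIndependent (IntBase F₀) v := by
    refine LinearIndependent.of_comp (D.latticeIncl i) ?_
    have : D.latticeIncl i ∘ v = bV := funext hv
    rw [this]
    refine bV.linearIndependent.restrict_scalars fun a b hab => Subtype.ext ?_
    have h1 : algebraMap (IntBase F₀) F₀ a = algebraMap (IntBase F₀) F₀ b := by
      simpa [Algebra.smul_def] using hab
    exact h1
  -- The O_{F₀}-span of the candidates is stable under π because π² = t π - π₀; as O_F = O_{F₀} +
  -- O_{F₀} π, it is then the whole lattice.
  have hπ (x : D.lattice i) (hx : x ∈ Submodule.span (IntBase F₀) (Set.range v)) :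
      D.πInt • x ∈ Submodule.span (IntBase F₀) (Set.range v) := by
    induction hx using Submodule.span_induction with
    | zero => rw [smul_zero]; exact zero_mem _
    | add x y _ _ hx hy => rw [smul_add]; exact add_mem hx hy
    | smul a x _ hx => rw [smul_comm]; exact Submodule.smul_mem _ a hx
    | mem x hx =>
      obtain ⟨j | j, rfl⟩ := hx
      · exact Submodule.subset_span ⟨.inr j, rfl⟩
      · change D.πInt • D.πInt • D.gen i j ∈ _
        rw [smul_smul, ← pow_two, D.πInt_sq, sub_smul, mul_smul, algebraMap_smul, algebraMap_smul]
        exact sub_mem (Submodule.smul_mem _ _ (Submodule.subset_span ⟨.inr j, rfl⟩))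
          (Submodule.smul_mem _ _ (Submodule.subset_span ⟨.inl j, rfl⟩))
  have hspan : ⊤ ≤ Submodule.span (IntBase F₀) (Set.range v) := by
    rintro ⟨x, hx⟩ -
    induction hx using Submodule.span_induction with
    | zero => exact zero_mem _
    | add x y hx hy hx' hy' => exact add_mem hx' hy'
    | smul β x hx hx' =>
      obtain ⟨a, c, rfl⟩ := D.exists_eq_add_mul_πInt β
      have : (⟨(algebraMap (IntBase F₀) (IntExt F₀ F) a +
          algebraMap (IntBase F₀) (IntExt F₀ F) c * D.πInt) • x, Submodule.smul_mem _ _ hx⟩ :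
          D.lattice i) = a • ⟨x, hx⟩ + c • D.πInt • ⟨x, hx⟩ := by
        rw [← algebraMap_smul (IntExt F₀ F) a, ← algebraMap_smul (IntExt F₀ F) c, smul_smul,
          ← add_smul]
        rfl
      rw [this]
      exact add_mem (Submodule.smul_mem _ _ hx') (Submodule.smul_mem _ _ (hπ _ hx'))
    | mem x hx =>
      obtain ⟨j, rfl⟩ := hx
      exact Submodule.subset_span ⟨.inl j, rfl⟩
  refine ⟨Module.Basis.mk hli hspan, bV, fun k => ?_, fun j => ?_, fun j => ?_⟩
  · rw [Module.Basis.mk_apply, hv]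
  · rw [Module.Basis.mk_apply]; rfl
  · rw [Module.Basis.mk_apply]; rfl

end
end SplitHermitianDatum
namespace SplitHermitianDatum

section
variable {F₀ F V : Type*} [Field F₀] [Algebra ℚ_[2] F₀] [FiniteDimensional ℚ_[2] F₀]
  [Field F] [Algebra F₀ F] [AddCommGroup V] [Module F V] {m : ℕ}
  (D : SplitHermitianDatum F₀ F V m)

theorem ε_ne : D.ε ≠ 0 := by
  unfold ε
  split_ifs with h
  · exact two_ne
  · exact fun h' => h (Subtype.ext h')

theorem trace_σ (x : F) : Algebra.trace F₀ F (D.σ x) = Algebra.trace F₀ F x := by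
  refine FaithfulSMul.algebraMap_injective F₀ F ?_
  rw [D.algebraMap_trace, D.algebraMap_trace, D.σ_σ, add_comm]

theorem trace_one (D : SplitHermitianDatum F₀ F V m) : Algebra.trace F₀ F 1 = 2 := by
  have := Algebra.trace_algebraMap (S := F) (1 : F₀)
  rw [map_one, D.finrank_eq] at this
  rw [this]; norm_num

theorem trace_algebraMap_mul (a : F₀) (x : F) :
    Algebra.trace F₀ F (algebraMap F₀ F a * x) = a * Algebra.trace F₀ F x := by
  rw [← Algebra.smul_def, map_smul, smul_eq_mul]

theorem trace_π : Algebra.trace F₀ F (D.π : F) = D.t := by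
  refine FaithfulSMul.algebraMap_injective F₀ F ?_
  rw [D.algebraMap_trace, D.σ_π]; ring

theorem exists_h_self (x : V) : ∃ a : F₀, D.h x x = algebraMap F₀ F a := by
  obtain ⟨a, ha⟩ := D.exists_of_σ_eq (D.hermitian x x)
  exact ⟨a, ha.symm⟩

theorem h_π_smul_left (x y : V) : D.h ((D.π : F) • x) y = D.π * D.h x y := by simp

theorem h_π_smul_right (x y : V) : D.h x ((D.π : F) • y) = D.σ D.π * D.h x y := by
  rw [LinearMap.map_smulₛₗ, smul_eq_mul]; rfl

/-- The quotient `t / π₀ ∈ O_{F₀}`. -/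
theorem exists_tInt_eq : ∃ s : IntBase F₀, D.tInt = D.π₀Int * s := by
  obtain ⟨s, hs, h⟩ := D.dvd_t
  exact ⟨⟨s, hs⟩, Subtype.ext h⟩

/-- If the trace form `b ↦ Tr(κ b)` is integral with `Tr(κ σ(π)) = ± 1`, then it is perfect on
`O_F`. -/
theorem exists_dual_basis {κ : F} (hκ : IsDual F₀ κ)
    (h1 : Algebra.trace F₀ F (κ * D.σ D.π) ^ 2 = 1) (a b : baseIntegers F₀) :
    ∃ β : IntExt F₀ F, Algebra.trace F₀ F (κ * D.σ (algebraMap _ F β)) = a ∧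
      Algebra.trace F₀ F (κ * D.σ (algebraMap _ F (D.πInt * β))) = b := by
  set T₀ := Algebra.trace F₀ F κ with hT₀
  set T₁ := Algebra.trace F₀ F (κ * D.σ D.π) with hT₁
  have hT₀' : T₀ ∈ baseIntegers F₀ := hκ.trace_mem
  have hT₁' : T₁ ∈ baseIntegers F₀ := by
    rw [hT₁, mul_comm]; exact hκ _ D.σ_π_mem
  obtain ⟨s, hs, hts⟩ := D.dvd_t
  -- For β = x + y π the conditions read x T₀ + y T₁ = a and x T₁ + y (t T₁ - π₀ T₀) = b. As t = π₀
  -- s and T₁² = 1, the determinant is -(1 + π₀ (T₀² - s T₀ T₁)), a unit; the x and y below are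
  -- given by Cramer's rule.
  obtain ⟨hne, hinv⟩ := D.inv_one_add_mem (c := T₀ ^ 2 - s * T₀ * T₁)
    (sub_mem (pow_mem hT₀' 2) (mul_mem (mul_mem hs hT₀') hT₁'))
  set d := 1 + (D.π₀ : F₀) * (T₀ ^ 2 - s * T₀ * T₁) with hd
  have hx : (b * T₁ - a * (D.t * T₁ - D.π₀ * T₀)) * d⁻¹ ∈ baseIntegers F₀ :=
    mul_mem (sub_mem (mul_mem b.2 hT₁') (mul_mem a.2 (sub_mem (mul_mem D.t.2 hT₁')
      (mul_mem D.π₀.2 hT₀')))) hinv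
  have hy : (a * T₁ - b * T₀) * d⁻¹ ∈ baseIntegers F₀ :=
    mul_mem (sub_mem (mul_mem a.2 hT₁') (mul_mem b.2 hT₀')) hinv
  set x := (b * T₁ - a * (D.t * T₁ - D.π₀ * T₀)) * d⁻¹ with hxd
  set y := (a * T₁ - b * T₀) * d⁻¹ with hyd
  have htr (x y : F₀) : Algebra.trace F₀ F (κ * D.σ (algebraMap F₀ F x + algebraMap F₀ F y * D.π)) =
      x * T₀ + y * T₁ := by
    have e : κ * D.σ (algebraMap F₀ F x + algebraMap F₀ F y * D.π) =
        algebraMap F₀ F x * κ + algebraMap F₀ F y * (κ * D.σ D.π) := by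
      simp only [map_add, map_mul, D.σ.commutes]; ring
    rw [e, map_add, trace_algebraMap_mul, trace_algebraMap_mul]
  refine ⟨algebraMap (IntBase F₀) (IntExt F₀ F) ⟨x, hx⟩ +
    algebraMap (IntBase F₀) (IntExt F₀ F) ⟨y, hy⟩ * D.πInt, ?_, ?_⟩
  · refine (htr x y).trans ?_
    rw [hxd, hyd]
    field_simp
    rw [hd]
    linear_combination (a : F₀) * h1 - a * T₁ * T₀ * hts
  · have e : (D.π : F) * (algebraMap F₀ F x + algebraMap F₀ F y * D.π) =
        algebraMap F₀ F (-D.π₀ * y) + algebraMap F₀ F (x + D.t * y) * D.π := by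
      simp only [map_add, map_mul, map_neg]
      linear_combination algebraMap F₀ F y * D.equation
    change Algebra.trace F₀ F (κ * D.σ ((D.π : F) * (algebraMap F₀ F x + algebraMap F₀ F y * D.π))) = b
    rw [e, htr, hxd, hyd]
    field_simp
    rw [hd]
    linear_combination (b : F₀) * h1 - b * T₁ * T₀ * hts

variable [Module F₀ V] [IsScalarTower F₀ F V]

/-- The constants come from h(x, x) ∈ F₀, which gives s(x, x) = 2 q(x) and s(x, π x) = Tr(σ π) q(x)
= t q(x). The polar form is s itself, so (μ₀, μ₁) = (1, 0). -/
theorem isHermitianPair_s : IsHermitianPair (Algebra.lsmul F₀ F₀ V (D.π : F)) D.t D.π₀ 2 D.t 1 0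
    D.q D.s where
  quad x := by
    have h2 := two_ne (F₀ := F₀)
    have e : D.h ((D.π : F) • x) ((D.π : F) • x) = algebraMap F₀ F D.π₀ * D.h x x := by
      rw [h_π_smul_left, h_π_smul_right, ← D.π_mul_σ_π, mul_assoc]
    rw [Algebra.lsmul_coe, q_apply, q_apply, s_apply, s_apply, e, trace_algebraMap_mul, smul_eq_mul]
    ring
  adj x y := by
    change D.s ((D.π : F) • x) y = D.s x ((D.t : F₀) • y - (D.π : F) • y)
    rw [s_apply, s_apply, map_sub, ← algebraMap_smul F (D.t : F₀) y,
      h_π_smul_left, h_π_smul_right, LinearMap.map_smulₛₗ, D.σ_π, RingHom.coe_coe, D.σ.commutes,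
      smul_eq_mul, ← sub_mul]
    congr 3; ring
  polar x y := by rw [polar_q, one_smul, zero_smul, add_zero]
  diag x := by
    have h2 := two_ne (F₀ := F₀)
    rw [q_apply, smul_eq_mul]; field_simp
  diag_apply x := by
    have h2 := two_ne (F₀ := F₀)
    obtain ⟨a, ha⟩ := D.exists_h_self x
    rw [Algebra.lsmul_coe, q_apply, s_apply, s_apply, h_π_smul_right, ha, mul_comm (D.σ D.π),
      trace_algebraMap_mul, trace_σ, trace_π, ← mul_one (algebraMap F₀ F a), trace_algebraMap_mul,
      D.trace_one, smul_eq_mul]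
    field_simp

theorem φ_apply' (x y : V) : D.φ x y = D.ε⁻¹ * Algebra.trace F₀ F ((D.σ D.π)⁻¹ * D.h x y) := by
  rw [φ_apply, LinearMap.map_smulₛₗ, smul_eq_mul, RingHom.coe_coe, map_inv₀]

theorem φ_π_smul (x y : V) : D.φ x ((D.π : F) • y) = D.s x y := by
  rw [φ_apply, smul_smul, inv_mul_cancel₀ D.π_ne, one_smul, s_apply]

/-- Since φ(x, π y) = s(x, y), here (μ₀, μ₁) = (0, 1) and φ(x, π x) = 2 q(x). From (σ π)⁻¹ = π / π₀
one gets φ(x, x) = (t / π₀) q(x), with an integral constant because π₀ divides t. -/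
theorem isHermitianPair_φ {s : F₀} (hs : (D.t : F₀) = D.π₀ * s) :
    IsHermitianPair (Algebra.lsmul F₀ F₀ V (D.π : F)) D.t D.π₀ s 2 0 1 D.q D.φ where
  quad := D.isHermitianPair_s.quad
  adj x y := by
    change D.φ ((D.π : F) • x) y = D.φ x ((D.t : F₀) • y - (D.π : F) • y)
    rw [φ_apply', φ_apply', map_sub, ← algebraMap_smul F (D.t : F₀) y,
      h_π_smul_left, h_π_smul_right, LinearMap.map_smulₛₗ, D.σ_π, RingHom.coe_coe, D.σ.commutes,
      smul_eq_mul, ← sub_mul]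
    congr 4; ring
  polar x y := by rw [polar_q, zero_smul, zero_add, one_smul, Algebra.lsmul_coe, φ_π_smul]
  diag x := by
    have h2 := two_ne (F₀ := F₀)
    have hπ := D.π₀_ne
    obtain ⟨a, ha⟩ := D.exists_h_self x
    have e : (D.σ D.π)⁻¹ = algebraMap F₀ F (D.π₀ : F₀)⁻¹ * D.π := by
      have h0 := D.σ_π_ne_zero
      have h1 := D.π_ne
      rw [map_inv₀, ← D.π_mul_σ_π]; field_simp
    have e' : (D.σ D.π)⁻¹ * algebraMap F₀ F a = algebraMap F₀ F (a * (D.π₀ : F₀)⁻¹) * D.π := by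
      rw [e, map_mul]; ring
    rw [φ_apply', q_apply, s_apply, ha, e', trace_algebraMap_mul, trace_π, hs,
      ← mul_one (algebraMap F₀ F a), trace_algebraMap_mul, D.trace_one, smul_eq_mul]
    field_simp
  diag_apply x := by
    have h2 := two_ne (F₀ := F₀)
    rw [Algebra.lsmul_coe, φ_π_smul, q_apply, smul_eq_mul]; field_simp

end
end SplitHermitianDatum

/-! ### Dual vectors and the common theorem for both lattices -/

namespace SplitHermitianDatum

section
variable {F₀ F V : Type*} [Field F₀] [Algebra ℚ_[2] F₀] [FiniteDimensional ℚ_[2] F₀]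
  [Field F] [Algebra F₀ F] [AddCommGroup V] [Module F V] {m : ℕ}
  (D : SplitHermitianDatum F₀ F V m)

theorem exists_valueModule_equiv : ∃ ω : D.valueModule ≃ₗ[IntBase F₀] IntBase F₀,
    ∀ y : D.valueModule, (y : F₀) = algebraMap (IntBase F₀) F₀ (ω y) * D.ε⁻¹ := by
  have hε := inv_ne_zero D.ε_ne
  let f : IntBase F₀ →ₗ[IntBase F₀] D.valueModule :=
    LinearMap.toSpanSingleton (IntBase F₀) D.valueModule ⟨D.ε⁻¹, Submodule.subset_span rfl⟩
  have hf (a) : (f a : F₀) = algebraMap (IntBase F₀) F₀ a * D.ε⁻¹ := rfl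
  have hbij : Function.Bijective f := by
    refine ⟨fun a c hac => Subtype.ext ?_, fun y => ?_⟩
    · have := congrArg Subtype.val hac
      rw [hf, hf] at this
      exact mul_right_cancel₀ hε this
    · obtain ⟨a, ha⟩ := Submodule.mem_span_singleton.1 y.2
      exact ⟨a, Subtype.ext ha⟩
  refine ⟨(LinearEquiv.ofBijective f hbij).symm, fun y => ?_⟩
  rw [← hf]
  exact congrArg Subtype.val ((LinearEquiv.ofBijective f hbij).apply_symm_apply y).symm

variable [Module F₀ V] [IsScalarTower F₀ F V]

/-- As h pairs e_j only with its mirror, the vector sought is a multiple β of the generator with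
index `j.rev`, and β comes from the perfect trace form of `exists_dual_basis`. -/
theorem exists_dual_gen {i : ℕ} {b : LinearMap.BilinMap (IntBase F₀) (D.lattice i) D.valueModule}
    {w : F} (hb : ∀ x y : D.lattice i, (b x y : F₀) = D.ε⁻¹ * Algebra.trace F₀ F (w * D.h x y))
    {ω : D.valueModule ≃ₗ[IntBase F₀] IntBase F₀}
    (hω : ∀ y : D.valueModule, (y : F₀) = algebraMap (IntBase F₀) F₀ (ω y) * D.ε⁻¹)
    {j : Fin (2 * m + 1)} {κ : F} (hκ : w * (D.latticeCoeff i j * D.σ (D.latticeCoeff i j.rev)) = κ)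
    (hd : IsDual F₀ κ) (h1 : Algebra.trace F₀ F (κ * D.σ D.π) ^ 2 = 1) (a c : IntBase F₀) :
    ∃ z : D.lattice i, ∀ k, ω (b (D.gen i k) z) = (if k = j then a else 0) ∧
      ω (b (D.gen i k) (D.πInt • z)) = if k = j then c else 0 := by
  obtain ⟨β, hβ, hβ'⟩ := D.exists_dual_basis hd h1 a c
  have key (δ : IntExt F₀ F) (a : IntBase F₀)
      (hδ : Algebra.trace F₀ F (κ * D.σ (algebraMap _ F δ)) = algebraMap (IntBase F₀) F₀ a) (k) :
      ω (b (D.gen i k) (δ • D.gen i j.rev)) = if k = j then a else 0 := by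
    refine Subtype.ext (mul_right_cancel₀ (inv_ne_zero D.ε_ne) ?_)
    refine (hω _).symm.trans ?_
    have e : D.h (D.gen i k) ((δ • D.gen i j.rev : D.lattice i) : V) =
        D.σ (algebraMap _ F δ) * if k = j then
          D.latticeCoeff i j * D.σ (D.latticeCoeff i j.rev) else 0 := by
      change D.h (D.latticeCoeff i k • D.e k)
        (algebraMap _ F δ • D.latticeCoeff i j.rev • D.e j.rev) = _
      rw [LinearMap.map_smulₛₗ, h_gen, smul_eq_mul]
      by_cases hk : k = j
      · subst hk; simp
      · rw [if_neg hk, if_neg fun h => hk (Fin.rev_injective h).symm]; simp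
    rw [hb, e]
    split_ifs with hk
    · rw [mul_left_comm, hκ, mul_comm _ κ, hδ, mul_comm]; rfl
    · rw [mul_zero, mul_zero, map_zero, mul_zero]; exact (zero_mul _).symm
  refine ⟨β • D.gen i j.rev, fun k => ⟨key β a hβ k, ?_⟩⟩
  rw [smul_smul]
  exact key _ c hβ' k

theorem isHermitianPair_lattice {i : ℕ} (hi : i ≤ m)
    {b : LinearMap.BilinMap (IntBase F₀) (D.lattice i) D.valueModule}
    {b' : LinearMap.BilinMap F₀ V F₀} (hb : ∀ x y : D.lattice i, (b x y : F₀) = b' x y)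
    {t n τ τ' μ₀ μ₁ : IntBase F₀}
    (h : IsHermitianPair (Algebra.lsmul F₀ F₀ V (D.π : F)) (algebraMap (IntBase F₀) F₀ t)
      (algebraMap (IntBase F₀) F₀ n) (algebraMap (IntBase F₀) F₀ τ) (algebraMap (IntBase F₀) F₀ τ')
      (algebraMap (IntBase F₀) F₀ μ₀) (algebraMap (IntBase F₀) F₀ μ₁) D.q b') :
    IsHermitianPair (Algebra.lsmul (IntBase F₀) (IntBase F₀) (D.lattice i) D.πInt) t n τ τ' μ₀ μ₁
      (D.latticeQ i hi) b where
  quad x := Subtype.ext (h.quad x)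
  adj x y := Subtype.ext ((hb _ _).trans ((h.adj x y).trans (hb x (t • y - D.πInt • y)).symm))
  polar x y := Subtype.ext ((h.polar x y).trans (hb x (μ₀ • y + μ₁ • D.πInt • y)).symm)
  diag x := Subtype.ext ((hb _ _).trans (h.diag x))
  diag_apply x := Subtype.ext ((hb _ _).trans (h.diag_apply x))

theorem exists_h_eq : ∃ θ₀ θ₁ : F₀ →ₗ[F₀] F, ∀ x y, D.hBilin x y =
    θ₀ (QuadraticMap.polar D.q x y) +
      θ₁ (QuadraticMap.polar D.q x (algebraMap (IntExt F₀ F) F D.πInt • y)) := by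
  have hd : (D.π : F) - D.σ D.π ≠ 0 := sub_ne_zero.2 D.σ_π_ne.symm
  have hε := algebraMap_ne (F := F) D.ε_ne
  -- Solve h + σ h = ε s(x, y) and σ(π) h + π σ h = ε s(x, π y) for h = h(x, y): π times the first
  -- equation minus the second is (π - σ π) h.
  refine ⟨LinearMap.toSpanSingleton F₀ F (algebraMap F₀ F D.ε * D.π / (D.π - D.σ D.π)),
    LinearMap.toSpanSingleton F₀ F (-algebraMap F₀ F D.ε / (D.π - D.σ D.π)), fun x y => ?_⟩
  change D.h x y = _
  rw [algebraMap_πInt, polar_q, polar_q, LinearMap.toSpanSingleton_apply,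
    LinearMap.toSpanSingleton_apply, s_apply, s_apply, Algebra.smul_def, Algebra.smul_def,
    map_mul, map_mul, D.algebraMap_trace, D.algebraMap_trace, h_π_smul_right, map_mul, D.σ_σ,
    map_inv₀]
  field_simp
  ring

/-- The index of the middle basis vector `e_{m + 1}`. -/
def mid (m : ℕ) : Fin (2 * m + 1) := ⟨m, by omega⟩

/-- The middle index is its own mirror and has coefficient 1 in every Λᵢ, so q takes the value ε⁻¹
Tr(1) / 2, the generator of 𝓛. -/
theorem q_gen_mid {i : ℕ} (hi : i ≤ m) : D.q (D.gen i (mid m)) = D.ε⁻¹ := by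
  have h2 := two_ne (F₀ := F₀)
  have hrev : mid m = (mid m).rev := Fin.ext (by rw [Fin.val_rev]; simp only [mid]; omega)
  have hc : D.latticeCoeff i (mid m) = 1 := by
    unfold latticeCoeff
    rw [if_neg (show ¬ (mid m : ℕ) < i from not_lt.2 hi), if_pos (show (mid m : ℕ) ≤ m from le_rfl)]
  change D.q (D.latticeCoeff i (mid m) • D.e (mid m)) = _
  rw [q_apply, s_apply, h_gen, if_pos hrev, hc, map_one, mul_one, D.trace_one]
  field_simp

end

section
variable {F₀ F V : Type u} [Field F₀] [Algebra ℚ_[2] F₀] [FiniteDimensional ℚ_[2] F₀]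
  [Field F] [Algebra F₀ F] [AddCommGroup V] [Module F₀ V] [Module F V] [IsScalarTower F₀ F V]
  {m : ℕ} (D : SplitHermitianDatum F₀ F V m)

/-- The two cases of the theorem differ only in w, in the constants of the hermitian pair and in the
verification of `hκ`. The latter says that b is perfect on each pair of mirror indices off the
middle; at the middle nothing is asked of b, since q takes a generator of 𝓛 there. -/
theorem exists_groupScheme_simPreservingFunctor {i : ℕ} (hi : i ≤ m)
    {b : LinearMap.BilinMap (IntBase F₀) (D.lattice i) D.valueModule}
    {b' : LinearMap.BilinMap F₀ V F₀} (hb : ∀ x y : D.lattice i, (b x y : F₀) = b' x y)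
    {w : F} (hb' : ∀ x y, b' x y = D.ε⁻¹ * Algebra.trace F₀ F (w * D.h x y))
    {τ τ' μ₀ μ₁ a₀ a₁ : IntBase F₀}
    (h : IsHermitianPair (Algebra.lsmul F₀ F₀ V (D.π : F)) D.t
      D.π₀ (algebraMap (IntBase F₀) F₀ τ) (algebraMap (IntBase F₀) F₀ τ')
      (algebraMap (IntBase F₀) F₀ μ₀) (algebraMap (IntBase F₀) F₀ μ₁) D.q b')
    (ha : a₀ * μ₀ + a₁ * μ₁ = 1)
    (hκ : ∀ j, j ≠ mid m → ∃ κ, w * (D.latticeCoeff i j * D.σ (D.latticeCoeff i j.rev)) = κ ∧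
      IsDual F₀ κ ∧ Algebra.trace F₀ F (κ * D.σ D.π) ^ 2 = 1) :
    ∃ (G : Over (Spec (.of (IntBase F₀)))) (_ : GrpObj G), IsAffine G.left ∧ Smooth G.hom ∧
      ∃ (α : pointsFunctor G ≅ simPreservingFunctor (IntExt F₀ F) (D.latticeQ i hi) b)
        (β : pointsFunctor (baseChangeScheme (IntBase F₀) F₀ G) ≅ D.unitarySimilitudes),
        GenericCompatible (D.latticeIncl i) (simPreservingFunctorAction _ _)
          (guFunctorAction _) α β := by
  have := isNoetherianRing_intBase (F₀ := F₀)
  obtain ⟨ω, hω⟩ := D.exists_valueModule_equiv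
  obtain ⟨bM, bV, hbi, hbl, hbr⟩ := D.exists_lattice_basis i
  obtain ⟨θ₀, θ₁, hθ⟩ := D.exists_h_eq
  obtain ⟨H, ⟨ρ⟩, hfp⟩ := exists_corepresentableBy_simPreservingFunctor (B := IntExt F₀ F) bM
    ((Module.Basis.singleton Unit (IntBase F₀)).map ω.symm) (D.latticeQ i hi) b
  have hbw (x y : D.lattice i) : (b x y : F₀) = D.ε⁻¹ * Algebra.trace F₀ F (w * D.h x y) :=
    (hb x y).trans (hb' x y)
  have ho : ω (D.latticeQ i hi (D.gen i (mid m))) = 1 := by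
    refine Subtype.ext (mul_right_cancel₀ (inv_ne_zero D.ε_ne) ?_)
    refine (hω _).symm.trans ?_
    rw [coe_latticeQ, q_gen_mid D hi]
    exact (one_mul _).symm
  have hdual (a c : IntBase F₀) : ∃ z : Fin (2 * m + 1) → D.lattice i, ∀ j, j ≠ mid m → ∀ k,
      ω (b (D.gen i k) (z j)) = (if k = j then a else 0) ∧
        ω (b (D.gen i k) (D.πInt • z j)) = if k = j then c else 0 := by
    have h' (j) : ∃ z : D.lattice i, j ≠ mid m → ∀ k,
        ω (b (D.gen i k) z) = (if k = j then a else 0) ∧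
          ω (b (D.gen i k) (D.πInt • z)) = if k = j then c else 0 := by
      by_cases hj : j = mid m
      · exact ⟨0, fun h => absurd hj h⟩
      · obtain ⟨κ, hκ, hd, h1⟩ := hκ j hj
        obtain ⟨z, hz⟩ := D.exists_dual_gen hbw hω hκ hd h1 a c
        exact ⟨z, fun _ => hz⟩
    choose z hz using h'
    exact ⟨z, hz⟩
  -- `z` is dual to the generators under x ↦ b(fₖ, x) and killed by x ↦ b(fₖ, π x); for `v` the
  -- roles are exchanged.
  obtain ⟨z, hz⟩ := hdual 1 0
  obtain ⟨v, hv⟩ := hdual 0 1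
  have hpair : IsHermitianPair (Algebra.lsmul (IntBase F₀) (IntBase F₀) (D.lattice i) D.πInt)
      D.tInt D.π₀Int τ τ' μ₀ μ₁ (D.latticeQ i hi) b := D.isHermitianPair_lattice hi hb h
  have hfs : Algebra.FormallySmooth (IntBase F₀) H := by
    refine formallySmooth_of_corepresentableBy ρ fun R _ _ I hI g => ?_
    obtain ⟨g', hg', h1, h2⟩ := exists_lift_simGroupPreserving (R := R) D.adjoin_πInt hpair
      D.πInt_sq bM hbl hbr ω (o := mid m) (fun j hj k => (hz j hj k).1)
      (fun j hj k => ω.map_eq_zero_iff.1 (((hz j hj k).2).trans (ite_self 0)))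
      (fun j hj k => ω.map_eq_zero_iff.1 (((hv j hj k).1).trans (ite_self 0)))
      (fun j hj k => (hv j hj k).2) ho ha hI
      (g := (show simGroupPreserving (IntExt F₀ F) (D.latticeQ i hi) b (R ⧸ I) from g).1)
      (show simGroupPreserving (IntExt F₀ F) (D.latticeQ i hi) b (R ⧸ I) from g).2
    exact ⟨(⟨g', hg'⟩ : simGroupPreserving (IntExt F₀ F) (D.latticeQ i hi) b R),
      Subtype.ext (Prod.ext h1 h2)⟩
  have : Algebra.Smooth (IntBase F₀) H := ⟨hfs, hfp⟩
  obtain ⟨T, hT, hT'⟩ := exists_generic_equiv (B := IntExt F₀ F) (F := F) (h := D.hBilin)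
    (q := D.latticeQ i hi) (b := b) (i := D.latticeIncl i) (π := D.πInt) bM bV hbi
    (fun β x => rfl) D.exists_eq_algebraMap_add ω
    (j := D.valueModule.subtype) (inv_ne_zero D.ε_ne) hω (qV := D.q) (b' := b') (fun _ => rfl)
    (fun x y => (hb x y).symm) (ψ := (2⁻¹ * D.ε⁻¹ : F₀) • Algebra.trace F₀ F)
    (ψ' := D.ε⁻¹ • (Algebra.trace F₀ F ∘ₗ LinearMap.mulLeft F₀ w))
    (fun x => (mul_assoc (2⁻¹ : F₀) D.ε⁻¹ _).symm) hb' hθ ho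
  exact exists_smooth_affine_groupScheme (D.latticeIncl i) ρ _ _ T hT hT'

end
end SplitHermitianDatum

/-! ### The cases Λₘ and Λ₀ -/

section
variable {A B M L : Type u} [CommRing A] [CommRing B] [Algebra A B]
  [AddCommGroup M] [Module A M] [Module B M] [IsScalarTower A B M] [AddCommGroup L] [Module A L]

/-- Polar values are differences of values of q, hence are transformed by γ as well. -/
theorem simGroupPreserving_polarBilin (q : QuadraticMap A M L) (R : Type*) [CommRing R]
    [Algebra A R] : simGroupPreserving B q q.polarBilin R = simGroup B q R := by
  refine le_antisymm (fun g hg => hg.1) fun g hg => ⟨hg, fun x y => ?_⟩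
  rw [← polarBilin_quadBaseChange, QuadraticMap.polarBilin_apply_apply,
    QuadraticMap.polarBilin_apply_apply, QuadraticMap.polar, QuadraticMap.polar, ← map_add, hg.2,
    hg.2, hg.2, map_sub, map_sub]

/-- Similitudes preserve the polar form automatically. -/
noncomputable def simPreservingPolarIso (q : QuadraticMap A M L) :
    simPreservingFunctor B q q.polarBilin ≅ simFunctor B q :=
  NatIso.ofComponents
    (fun R => (MulEquiv.subgroupCongr (simGroupPreserving_polarBilin q R)).toGrpIso)
    (fun _ => rfl)

end

namespace SplitHermitianDatum

section
variable {F₀ F V : Type*} [Field F₀] [Algebra ℚ_[2] F₀] [FiniteDimensional ℚ_[2] F₀]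
  [Field F] [Algebra F₀ F] [AddCommGroup V] [Module F V] {m : ℕ}
  (D : SplitHermitianDatum F₀ F V m)

theorem trace_lam : Algebra.trace F₀ F D.lam = 1 := by
  refine FaithfulSMul.algebraMap_injective F₀ F ?_
  rw [D.algebraMap_trace, D.σ_lam_add_lam, map_one]

/-- If t = 0 then σ π = -π and the trace is -1; otherwise the argument of the trace is `lam`, of
trace 1. This sign is the reason why the square of the trace is used. -/
theorem trace_inv_π_mul_sq :
    Algebra.trace F₀ F ((D.π : F)⁻¹ * D.σ D.lam * D.σ D.π) ^ 2 = 1 := by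
  have hπ := D.π_ne
  by_cases h : D.t = 0
  · have hσ : D.σ D.π = -D.π := by rw [D.σ_π, h]; simp
    have e : (D.π : F)⁻¹ * D.σ D.lam * D.σ D.π = -D.σ D.lam := by rw [hσ]; field_simp
    rw [e, map_neg, trace_σ, trace_lam, neg_one_sq]
  · have ht : algebraMap F₀ F D.t ≠ 0 := algebraMap_ne fun h' => h (Subtype.ext h')
    have hlam : D.lam = D.σ D.π / algebraMap F₀ F D.t := if_neg h
    have e : (D.π : F)⁻¹ * D.σ D.lam * D.σ D.π = D.lam := by
      rw [hlam, map_div₀, D.σ.commutes, D.σ_σ]; field_simp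
    rw [e, trace_lam, one_pow]

/-- κ is π⁻¹ σ(lam) for j < m and (σ π)⁻¹ lam for j > m. The inverse of π comes from the generators:
in Λₘ all of the first m carry the factor π⁻¹. -/
theorem isDual_latticeCoeff_m {j : Fin (2 * m + 1)} (hj : j ≠ mid m) :
    ∃ κ, 1 * (D.latticeCoeff m j * D.σ (D.latticeCoeff m j.rev)) = κ ∧ IsDual F₀ κ ∧
      Algebra.trace F₀ F (κ * D.σ D.π) ^ 2 = 1 := by
  obtain ⟨h1, h2, -, -⟩ := D.isDual_basic
  have hσπ := D.σ_π_ne_zero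
  have hne : (j : ℕ) ≠ m := fun h => hj (Fin.ext h)
  have hlt := j.2
  have hrev : (j.rev : ℕ) = 2 * m - j := by rw [Fin.val_rev]; omega
  unfold latticeCoeff
  rw [hrev]
  by_cases c : (j : ℕ) < m
  · refine ⟨_, ?_, h1, D.trace_inv_π_mul_sq⟩
    rw [if_pos c, if_neg (by omega), if_neg (by omega), one_mul]
  · refine ⟨_, ?_, h2, ?_⟩
    · rw [if_neg c, if_neg (by omega), if_pos (by omega), map_inv₀, one_mul, mul_comm]
    · rw [mul_right_comm, inv_mul_cancel₀ hσπ, one_mul, trace_lam, one_pow]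

/-- No generator of Λ₀ carries π⁻¹; the factor (σ π)⁻¹ is supplied by φ, so that κ is (σ π)⁻¹ σ(lam)
or (σ π)⁻¹ lam, and multiplication by σ π leaves an element of trace 1. -/
theorem isDual_latticeCoeff_zero {j : Fin (2 * m + 1)} (hj : j ≠ mid m) :
    ∃ κ, (D.σ D.π)⁻¹ * (D.latticeCoeff 0 j * D.σ (D.latticeCoeff 0 j.rev)) = κ ∧ IsDual F₀ κ ∧
      Algebra.trace F₀ F (κ * D.σ D.π) ^ 2 = 1 := by
  obtain ⟨-, h2, h3, -⟩ := D.isDual_basic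
  have hσπ := D.σ_π_ne_zero
  have hne : (j : ℕ) ≠ m := fun h => hj (Fin.ext h)
  have hlt := j.2
  have hrev : (j.rev : ℕ) = 2 * m - j := by rw [Fin.val_rev]; omega
  unfold latticeCoeff
  rw [hrev, if_neg (Nat.not_lt_zero _), if_neg (Nat.not_lt_zero _)]
  by_cases c : (j : ℕ) ≤ m
  · refine ⟨_, ?_, h3, ?_⟩
    · rw [if_pos c, if_neg (by omega), one_mul]
    · rw [mul_right_comm, inv_mul_cancel₀ hσπ, one_mul, trace_σ, trace_lam, one_pow]
  · refine ⟨_, ?_, h2, ?_⟩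
    · rw [if_neg c, if_pos (by omega), map_one, mul_one]
    · rw [mul_right_comm, inv_mul_cancel₀ hσπ, one_mul, trace_lam, one_pow]

end

section
variable {F₀ F V : Type u} [Field F₀] [Algebra ℚ_[2] F₀] [FiniteDimensional ℚ_[2] F₀]
  [Field F] [Algebra F₀ F] [AddCommGroup V] [Module F₀ V] [Module F V] [IsScalarTower F₀ F V]
  {m : ℕ} (D : SplitHermitianDatum F₀ F V m)

theorem exists_groupScheme_simLatticeM :
    ∃ (G : Over (Spec (.of (IntBase F₀)))) (_ : GrpObj G), IsAffine G.left ∧ Smooth G.hom ∧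
      ∃ (α : pointsFunctor G ≅ D.simLatticeM)
        (β : pointsFunctor (baseChangeScheme (IntBase F₀) F₀ G) ≅ D.unitarySimilitudes),
        GenericCompatible (D.latticeIncl m) (simFunctorAction _) (guFunctorAction _) α β := by
  have h : IsHermitianPair (Algebra.lsmul F₀ F₀ V (D.π : F)) D.t D.π₀
      (algebraMap (IntBase F₀) F₀ 2) (algebraMap (IntBase F₀) F₀ D.tInt)
      (algebraMap (IntBase F₀) F₀ 1) (algebraMap (IntBase F₀) F₀ 0) D.q D.s := by
    rw [map_ofNat, map_one, map_zero]
    exact D.isHermitianPair_s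
  obtain ⟨G, hG, h1, h2, α, β, hc⟩ := D.exists_groupScheme_simPreservingFunctor (i := m) le_rfl
    (b := (D.latticeQ m le_rfl).polarBilin) (b' := D.s) (fun x y => D.polar_q x y) (w := 1)
    (fun x y => by rw [one_mul, s_apply]) (a₀ := 1) (a₁ := 0) h (by rw [one_mul, zero_mul, add_zero])
    fun j hj => D.isDual_latticeCoeff_m hj
  exact ⟨G, hG, h1, h2, α ≪≫ simPreservingPolarIso _, β, hc⟩

theorem exists_groupScheme_simLatticeZero :
    ∃ (G : Over (Spec (.of (IntBase F₀)))) (_ : GrpObj G), IsAffine G.left ∧ Smooth G.hom ∧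
      ∃ (α : pointsFunctor G ≅ D.simLatticeZero)
        (β : pointsFunctor (baseChangeScheme (IntBase F₀) F₀ G) ≅ D.unitarySimilitudes),
        GenericCompatible (D.latticeIncl 0) (simPreservingFunctorAction _ _)
          (guFunctorAction _) α β := by
  obtain ⟨s, hs⟩ := D.exists_tInt_eq
  have h : IsHermitianPair (Algebra.lsmul F₀ F₀ V (D.π : F)) D.t D.π₀
      (algebraMap (IntBase F₀) F₀ s) (algebraMap (IntBase F₀) F₀ 2)
      (algebraMap (IntBase F₀) F₀ 0) (algebraMap (IntBase F₀) F₀ 1) D.q D.φ := by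
    rw [map_ofNat, map_one, map_zero]
    exact D.isHermitianPair_φ (congrArg Subtype.val hs)
  exact D.exists_groupScheme_simPreservingFunctor (Nat.zero_le m) D.coe_latticeφ D.φ_apply'
    (a₀ := 0) (a₁ := 1) h (by rw [one_mul, zero_mul, zero_add])
    fun j hj => D.isDual_latticeCoeff_zero hj

end
end SplitHermitianDatum
end UnitarySimilitude

theorem mainTheorem8 {F₀ F V : Type u} [Field F₀] [Algebra ℚ_[2] F₀] [FiniteDimensional ℚ_[2] F₀]
    [Field F] [Algebra F₀ F] [AddCommGroup V] [Module F₀ V] [Module F V] [IsScalarTower F₀ F V]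
    {m : ℕ} (hm : 1 ≤ m) (D : UnitarySimilitude.SplitHermitianDatum F₀ F V m) :
    (∃ (G : Over (Spec (.of (UnitarySimilitude.IntBase F₀)))) (_ : GrpObj G),
      IsAffine G.left ∧ Smooth G.hom ∧
      ∃ (α : UnitarySimilitude.pointsFunctor G ≅ D.simLatticeM)
        (β : UnitarySimilitude.pointsFunctor
          (UnitarySimilitude.baseChangeScheme (UnitarySimilitude.IntBase F₀) F₀ G) ≅
            D.unitarySimilitudes),
        UnitarySimilitude.GenericCompatible (D.latticeIncl m)
          (UnitarySimilitude.simFunctorAction _) (UnitarySimilitude.guFunctorAction _) α β) ∧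
    (∃ (G : Over (Spec (.of (UnitarySimilitude.IntBase F₀)))) (_ : GrpObj G),
      IsAffine G.left ∧ Smooth G.hom ∧
      ∃ (α : UnitarySimilitude.pointsFunctor G ≅ D.simLatticeZero)
        (β : UnitarySimilitude.pointsFunctor
          (UnitarySimilitude.baseChangeScheme (UnitarySimilitude.IntBase F₀) F₀ G) ≅
            D.unitarySimilitudes),
        UnitarySimilitude.GenericCompatible (D.latticeIncl 0)
          (UnitarySimilitude.simPreservingFunctorAction _ _) (UnitarySimilitude.guFunctorAction _)
          α β) := by
  exact ⟨D.exists_groupScheme_simLatticeM, D.exists_groupScheme_simLatticeZero⟩
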